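/- \textbf{Model.} Let $F$ be a finite discrete distribution on $\mathbb{R}_{\ge 0}$, with distinct realizations $v_1,\dots,v_m$ and probabilities $p_1,\dots,p_m>0$. There are $n\ge 1$ boxes with hidden values $X_1,\dots,X_n$ drawn once upfront i.i.d.\ from $F$. A testing algorithm with multiple tests per box knows $F$ and may make up to $n$ threshold tests in total; a test of box $i$ with threshold $t$ reveals only whether $X_i\ge t$, boxes and thresholds may be chosen adaptively, and each box may be tested any number of times. Finally it chooses a box $\sigma\in\{1,\dots,n\}$ and receives $X_\sigma$. The algorithm is \emph{sequential} if its first test is of box $1$ and each subsequent test is applied either to the box tested last or to the box following it. A sequential algorithm is \emph{optimal} if it maximizes $\mathbb{E}[X_\sigma]$ among all (possibly randomized) sequential algorithms with $n$ tests, and an algorithm is \emph{$c$-competitive} if $\mathbb{E}[X_\sigma]\ge c\cdot\mathbb{E}[\max\{X_1,\dots,X_n\}]$. \textbf{Corollary 10.} There is a sequence $c_n\to 1$ (independent of the distribution) such that: (a) for every $n\ge 1$ and every finite discrete distribution $F$ on $\mathbb{R}_{\ge0}$, an optimal sequential testing algorithm with multiple tests per box exists, and every such optimal algorithm is $c_n$-competitive;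 (b) an optimal (and hence $c_n$-competitive) sequential algorithm can be computed in polynomial time: there are one deterministic program for a random access machine with logarithmic cost, and a polynomial $q$, such that for every $n\ge 1$ and every $F$ with rational values and probabilities, given as a list of (value, probability) pairs, the program outputs, within time $q(n+L)$ where $L$ is the binary length of the list, a complete description of an optimal deterministic sequential algorithm. The description is a finite table of states; each entry either names a box to be chosen, or names a box and a realization $v_j$ for the next threshold test, together with the successor states for the negative and the positive outcome. -/

import Mathlib

open Filter Topology MeasureTheory

namespace ThresholdTesting

/-! ### Finite discrete distributions -/

/-- A finite discrete distribution on the nonnegative reals: the value `v j` is taken with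
probability `p j > 0`. -/
structure FinDist where
  m : ℕ
  v : Fin m → ℝ
  p : Fin m → ℝ
  v_nonneg : ∀ j, 0 ≤ v j
  v_injective : Function.Injective v
  p_pos : ∀ j, 0 < p j
  p_sum : ∑ j, p j = 1

/-- `F.expect n g` is `E[g (X_1, …, X_n)]` for i.i.d. `X_i ∼ F`. -/
noncomputable def FinDist.expect (F : FinDist) (n : ℕ) (g : (Fin n → ℝ) → ℝ) : ℝ :=
  ∑ x : Fin n → Fin F.m, (∏ i, F.p (x i)) * g (fun i => F.v (x i))

/-- `E[max {X_1, …, X_n}]` (for `n ≥ 1`). -/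
noncomputable def FinDist.expectMax (F : FinDist) (n : ℕ) : ℝ :=
  F.expect n (fun X => ⨆ i, X i)

/-! ### Testing algorithms with several tests per box -/

/-- A deterministic adaptive testing algorithm for `n` boxes, as a decision tree: either stop and
choose a box, or test whether `t ≤ X_i` and go on according to the feedback. -/
inductive TestTree (n : ℕ) : Type
  | choose (i : Fin n) : TestTree n
  | test (i : Fin n) (t : ℝ) (neg pos : TestTree n) : TestTree n

namespace TestTree

variable {n : ℕ}

/-- The box `σ` that is chosen if the hidden realizations are `X`. -/
noncomputable def select : TestTree n → (Fin n → ℝ) → Fin n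
  | choose i, _ => i
  | test i t neg pos, X => if t ≤ X i then pos.select X else neg.select X

/-- The largest number of tests made on any run. -/
def numTests : TestTree n → ℕ
  | choose _ => 0
  | test _ _ neg pos => max neg.numTests pos.numTests + 1

/-- `A.SequentialFrom k`: the boxes with index `< k` have been opened for testing so far, the
current box being the one with index `k - 1` (if `0 < k`); every test of `A` is applied to the
current box, or to the next one, which then becomes the current box. -/
def SequentialFrom : ℕ → TestTree n → Prop
  | _, choose _ => True
  | k, test i _ neg pos =>
      ((i : ℕ) + 1 = k ∨ (i : ℕ) = k) ∧
        neg.SequentialFrom ((i : ℕ) + 1) ∧ pos.SequentialFrom ((i : ℕ) + 1)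

/-- A sequential testing algorithm for `n` boxes with a budget of `n` tests in total: the boxes
are tested one after the other, starting with the first, each of them any number of times. -/
def IsSequentialAlgorithm (A : TestTree n) : Prop :=
  A.SequentialFrom 0 ∧ A.numTests ≤ n

/-- The expected reward `E[X_σ]`. -/
noncomputable def reward (F : FinDist) (A : TestTree n) : ℝ :=
  F.expect n (fun X => X (A.select X))

/-- `A` is an optimal sequential testing algorithm for `F`: its expected reward is at least that
of every sequential testing algorithm `B` that may use internal randomization, that is, a random
seed `ω` drawn from `μ` independently of the boxes. -/
def IsOptimal (F : FinDist) (A : TestTree n) : Prop :=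
  A.IsSequentialAlgorithm ∧
    ∀ (Ω : Type) [MeasurableSpace Ω] (μ : Measure Ω) [IsProbabilityMeasure μ]
      (B : Ω → TestTree n), (∀ ω, (B ω).IsSequentialAlgorithm) →
        Measurable (fun ω => (B ω).reward F) →
        ∫ ω, (B ω).reward F ∂μ ≤ A.reward F

/-- `A` is `c`-competitive for `F`. -/
def IsCompetitive (c : ℝ) (F : FinDist) (A : TestTree n) : Prop :=
  c * F.expectMax n ≤ A.reward F

end TestTree

/-! ### Inputs of the computational problem -/

/-- A finite discrete distribution given as a list of (value, probability) pairs of rational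
numbers, with distinct values, in any order. -/
structure RatDist where
  m : ℕ
  v : Fin m → ℚ≥0
  p : Fin m → ℚ≥0
  v_injective : Function.Injective v
  p_pos : ∀ j, 0 < p j
  p_sum : ∑ j, p j = 1

/-- The distribution that the list describes. -/
noncomputable def RatDist.toFinDist (G : RatDist) : FinDist where
  m := G.m
  v j := (G.v j : ℝ)
  p j := (G.p j : ℝ)
  v_nonneg j := NNRat.cast_nonneg _
  v_injective _ _ h := G.v_injective (NNRat.cast_injective h)
  p_pos j := NNRat.cast_pos.mpr (G.p_pos j)
  p_sum := by rw [← NNRat.cast_sum, G.p_sum, NNRat.cast_one]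

/-- The input as a list of natural numbers: `n`, `m`, and the numerators and denominators of the
values and probabilities. -/
def RatDist.encode (n : ℕ) (G : RatDist) : List ℕ :=
  n :: G.m :: (List.finRange G.m).flatMap
    (fun j => [(G.v j).num, (G.v j).den, (G.p j).num, (G.p j).den])

/-- The input size: the number of boxes plus the binary length of the list of pairs. -/
def RatDist.inputSize (n : ℕ) (G : RatDist) : ℕ :=
  n + ∑ j, ((G.v j).num.size + (G.v j).den.size + (G.p j).num.size + (G.p j).den.size)

/-! ### Outputs of the computational problem -/

/-- An entry of the table that describes a testing algorithm, one entry for each state of the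
algorithm: choose box `i`, or test box `i` for the `j`-th value of the distribution and go on with
entry number `neg` or `pos`, according to the feedback. -/
inductive Entry (n m : ℕ) : Type
  | choose (i : Fin n) : Entry n m
  | test (i : Fin n) (j : Fin m) (neg pos : ℕ) : Entry n m

/-- An entry as a block of five natural numbers. -/
def Entry.encode {n m : ℕ} : Entry n m → List ℕ
  | choose i => [0, i, 0, 0, 0]
  | test i j neg pos => [1, i, j, neg, pos]

/-- `Describes F D k A`: started in entry number `k`, the table `D` carries out `A`. -/
inductive Describes {n : ℕ} (F : FinDist) (D : List (Entry n F.m)) : ℕ → TestTree n → Prop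
  | choose {k : ℕ} {i : Fin n} (h : D[k]? = some (Entry.choose i)) :
      Describes F D k (TestTree.choose i)
  | test {k : ℕ} {i : Fin n} {j : Fin F.m} {a b : ℕ} {neg pos : TestTree n}
      (h : D[k]? = some (Entry.test i j a b))
      (hneg : Describes F D a neg) (hpos : Describes F D b pos) :
      Describes F D k (TestTree.test i (F.v j) neg pos)

/-! ### Random access machine with logarithmic cost -/

/-- Memory: registers and random-access cells holding natural numbers, and a write-only output
tape. -/
structure Store where
  reg : ℕ → ℕ
  cell : ℕ → ℕ
  out : List ℕ

/-- Arithmetic operations of the machine: truncated subtraction, integer division, and a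
comparison with result `0` or `1` are included. -/
inductive Op : Type
  | add | sub | mul | div | le

def Op.eval : Op → ℕ → ℕ → ℕ
  | add, a, b => a + b
  | sub, a, b => a - b
  | mul, a, b => a * b
  | div, a, b => a / b
  | le, a, b => if a ≤ b then 1 else 0

/-- Arithmetic expressions; `cell e` reads the memory cell with address `e`. -/
inductive Expr : Type
  | lit (c : ℕ) : Expr
  | reg (x : ℕ) : Expr
  | cell (e : Expr) : Expr
  | op (o : Op) (e₁ e₂ : Expr) : Expr

def Expr.eval (s : Store) : Expr → ℕ
  | lit c => c
  | reg x => s.reg x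
  | cell e => s.cell (e.eval s)
  | op o e₁ e₂ => o.eval (e₁.eval s) (e₂.eval s)

/-- Logarithmic cost: each evaluation step costs one plus the binary length of its result (the
lengths of the operands and addresses are charged when these are evaluated). -/
def Expr.cost (s : Store) : Expr → ℕ
  | lit c => 1 + c.size
  | reg x => 1 + (s.reg x).size
  | cell e => e.cost s + 1 + (s.cell (e.eval s)).size
  | op o e₁ e₂ => e₁.cost s + e₂.cost s + 1 + (o.eval (e₁.eval s) (e₂.eval s)).size

/-- Programs of the machine. -/
inductive Program : Type
  | skip : Program
  | assign (x : ℕ) (e : Expr) : Program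
  | store (a e : Expr) : Program
  | emit (e : Expr) : Program
  | seq (P Q : Program) : Program
  | branch (e : Expr) (P Q : Program) : Program
  | loop (e : Expr) (P : Program) : Program

/-- `Runs P s t s'`: started in memory `s`, the program `P` halts after time `t` in memory `s'`.
`branch e P Q` runs `P` if `e ≠ 0` and `Q` otherwise; `loop e P` repeats `P` while `e ≠ 0`. -/
inductive Runs : Program → Store → ℕ → Store → Prop
  | skip (s : Store) : Runs Program.skip s 1 s
  | assign (x : ℕ) (e : Expr) (s : Store) :
      Runs (Program.assign x e) s (e.cost s + 1)
        { s with reg := Function.update s.reg x (e.eval s) }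
  | store (a e : Expr) (s : Store) :
      Runs (Program.store a e) s (a.cost s + e.cost s + 1)
        { s with cell := Function.update s.cell (a.eval s) (e.eval s) }
  | emit (e : Expr) (s : Store) :
      Runs (Program.emit e) s (e.cost s + 1) { s with out := s.out ++ [e.eval s] }
  | seq {P Q : Program} {s₁ s₂ s₃ : Store} {t₁ t₂ : ℕ}
      (hP : Runs P s₁ t₁ s₂) (hQ : Runs Q s₂ t₂ s₃) :
      Runs (Program.seq P Q) s₁ (t₁ + t₂) s₃
  | branch_true {e : Expr} {P Q : Program} {s s' : Store} {t : ℕ}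
      (he : e.eval s ≠ 0) (hP : Runs P s t s') :
      Runs (Program.branch e P Q) s (e.cost s + 1 + t) s'
  | branch_false {e : Expr} {P Q : Program} {s s' : Store} {t : ℕ}
      (he : e.eval s = 0) (hQ : Runs Q s t s') :
      Runs (Program.branch e P Q) s (e.cost s + 1 + t) s'
  | loop_done {e : Expr} {P : Program} {s : Store} (he : e.eval s = 0) :
      Runs (Program.loop e P) s (e.cost s + 1) s
  | loop_step {e : Expr} {P : Program} {s₁ s₂ s₃ : Store} {t₁ t₂ : ℕ}
      (he : e.eval s₁ ≠ 0) (hP : Runs P s₁ t₁ s₂) (hloop : Runs (Program.loop e P) s₂ t₂ s₃) :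
      Runs (Program.loop e P) s₁ (e.cost s₁ + 1 + t₁ + t₂) s₃

/-- The initial memory: the input is written to the cells `0, 1, 2, …`. -/
def initStore (input : List ℕ) : Store where
  reg _ := 0
  cell a := input.getD a 0
  out := []

/-- On the given input, `P` halts within time `T` and its output is `output`. -/
def OutputsWithin (P : Program) (input output : List ℕ) (T : ℕ) : Prop :=
  ∃ t s, Runs P (initStore input) t s ∧ t ≤ T ∧ s.out = output

end ThresholdTesting

open ThresholdTesting

namespace ThresholdTesting

/-! ### Rewards with respect to product weights -/

section Weighted

variable {n m : ℕ}

/-! Existence. A threshold matters only through the set of values that pass it, so each step has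
finitely many essentially different tests, and backward induction over the budget yields a best
deterministic tree (`exists_best_tree`). Randomization only averages deterministic rewards.

Competitiveness. One good sequential algorithm is enough. Sort the values into `g + 2` levels, cut
at the quantiles `lam, lam ^ 2, …, lam ^ g`, and scan `N = n - (g + 1)` boxes, always asking whether
the current box exceeds the highest level found so far. A failure moves on to the next box, at most
`N` times; a success raises the level, at most `g + 1` times. So the budget suffices, and the choice
is the first box of maximal level whenever some scanned box has positive level (`scan_reward_ge`).
The expected maximum is at most the sum of `v j * p j * geomSum₂ n a b` with `a = P(X < v j)` and `b
= P(X ≤ v j)`; for the scan the same formula holds as a lower bound, with `N` for `n` and levels in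
place of values. Three losses separate them: `N / n` for the boxes not scanned
(`mul_geomSum₂_le_mul`), `lam ^ n` since `P(level < level j) ≥ lam * a`
(`mul_below_le_sum_level_lt`), and `1 - lam ^ (g * n)` for the values below the lowest quantile
(`mul_expectMax_le_sum_upto_ge`). With `r` about `n ^ (1 / 4)`, `lam = 1 - 1 / (r * n)` and `g = r ^
2`, all three tend to `1` uniformly in the distribution.

Computation. After some tests, every box left behind is known to lie in an interval and will not be
tested again. Only the one with the largest conditional mean can be worth choosing later, so a state
consists of the number of remaining tests, the current box, and two intervals: that of the best
previous box and that of the current one. This gives polynomially many states. To avoid fractions,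
probabilities and values are scaled to integers, and `dp r c qp qc` stores the conditional expected
reward times `W qp * W qc * W 0 ^ (r + 1)`. Optimality is a pair of inequalities: `upperBound` for
every tree, `dp_le_wreward_tree` for the tree that is read off from the table.

Running time. The stored integers have binary length quadratic in the input size (`dp_fst_le`,
`Data.fits`). The program consists of nested counting loops over branch-free expressions, and `Exec`
tracks correctness, time and memory bounds together. The printed table has one entry per state; the
part reachable from entry `0` unfolds to the optimal tree (`describes_tree`). -/

/-- The total reward of `A` when the boxes carry the product weight `∏ i, f i`, the values that
are tested are given by `val` and the payoff by `g`. -/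
noncomputable def wreward (val g : Fin m → ℝ) (f : Fin n → Fin m → ℝ) (A : TestTree n) : ℝ :=
  ∑ x : Fin n → Fin m, (∏ i, f i (x i)) * g (x (A.select (fun i => val (x i))))

theorem sum_prod_eq_prod_sum (f : Fin n → Fin m → ℝ) :
    ∑ x : Fin n → Fin m, ∏ i, f i (x i) = ∏ i, ∑ j, f i j := by
  rw [Finset.prod_univ_sum, Fintype.piFinset_univ]

theorem prod_update_apply (f : Fin n → Fin m → ℝ) (i : Fin n) (h : Fin m → ℝ)
    (x : Fin n → Fin m) :
    ∏ l, Function.update f i h l (x l) = h (x i) * ∏ l ∈ Finset.univ.erase i, f l (x l) := by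
  rw [← Finset.mul_prod_erase Finset.univ _ (Finset.mem_univ i), Function.update_self]
  congr 1
  refine Finset.prod_congr rfl fun l hl => ?_
  rw [Function.update_of_ne (Finset.ne_of_mem_erase hl)]

/-- The payoff depends on coordinate `i` only, so it can be absorbed into the factor `f i`; then the
sum over all outcomes factors. -/
theorem wreward_choose (val g : Fin m → ℝ) (f : Fin n → Fin m → ℝ) (i : Fin n) :
    wreward val g f (.choose i) =
      (∑ j, f i j * g j) * ∏ l ∈ Finset.univ.erase i, ∑ j, f l j := by
  have h := sum_prod_eq_prod_sum (Function.update f i (fun j => f i j * g j))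
  rw [← Finset.mul_prod_erase Finset.univ _ (Finset.mem_univ i), Function.update_self] at h
  rw [Finset.prod_congr rfl (g := fun l => ∑ j, f l j)
    (fun l hl => by rw [Function.update_of_ne (Finset.ne_of_mem_erase hl)])] at h
  rw [← h]
  refine Finset.sum_congr rfl fun x _ => ?_
  rw [prod_update_apply, ← Finset.mul_prod_erase Finset.univ _ (Finset.mem_univ i)]
  simp only [TestTree.select]
  ring

/-- Either outcome truncates the factor of the tested box and leaves a product weight. Unnormalized
weights make conditioning a mere restriction, with no division and no exception for null events. -/
theorem wreward_test (val g : Fin m → ℝ) (f : Fin n → Fin m → ℝ) (i : Fin n) (t : ℝ)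
    (neg pos : TestTree n) :
    wreward val g f (.test i t neg pos) =
      wreward val g (Function.update f i (fun j => if t ≤ val j then 0 else f i j)) neg +
      wreward val g (Function.update f i (fun j => if t ≤ val j then f i j else 0)) pos := by
  unfold wreward
  rw [← Finset.sum_add_distrib]
  refine Finset.sum_congr rfl fun x _ => ?_
  rw [prod_update_apply, prod_update_apply,
    ← Finset.mul_prod_erase Finset.univ _ (Finset.mem_univ i)]
  simp only [TestTree.select]
  split_ifs <;> ring

theorem wreward_nonneg {val g : Fin m → ℝ} {f : Fin n → Fin m → ℝ} (hg : ∀ j, 0 ≤ g j)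
    (hf : ∀ i j, 0 ≤ f i j) (A : TestTree n) : 0 ≤ wreward val g f A :=
  Finset.sum_nonneg fun _ _ => mul_nonneg (Finset.prod_nonneg fun _ _ => hf _ _) (hg _)

theorem wreward_eq_zero {val g : Fin m → ℝ} {f : Fin n → Fin m → ℝ} {i : Fin n}
    (hf : ∀ j, f i j = 0) (A : TestTree n) : wreward val g f A = 0 :=
  Finset.sum_eq_zero fun _ _ => by
    rw [Finset.prod_eq_zero (Finset.mem_univ i) (hf _), zero_mul]

/-- Backward induction. Real thresholds are indexed by the set of values they accept, which leaves a
finite set of candidates to maximize over. -/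
theorem exists_best_tree (hn : 0 < n) (val g : Fin m → ℝ) (r : ℕ) :
    ∀ (k : ℕ) (f : Fin n → Fin m → ℝ), ∃ A : TestTree n, A.SequentialFrom k ∧ A.numTests ≤ r ∧
      ∀ B : TestTree n, B.SequentialFrom k → B.numTests ≤ r →
        wreward val g f B ≤ wreward val g f A := by
  have : Nonempty (Fin n) := ⟨⟨0, hn⟩⟩
  induction r with
  | zero =>
    intro k f
    obtain ⟨i, -, hi⟩ := Finset.exists_max_image Finset.univ
      (fun i : Fin n => wreward val g f (.choose i)) Finset.univ_nonempty
    refine ⟨.choose i, trivial, le_rfl, fun B _ hB => ?_⟩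
    cases B with
    | choose l => exact hi l (Finset.mem_univ _)
    | test => simp [TestTree.numTests] at hB
  | succ r ih =>
    intro k f
    choose best hseq hnum hbest using ih
    let tree : Fin n → ℝ → TestTree n := fun i t => .test i t
      (best (i + 1) (Function.update f i (fun j => if t ≤ val j then 0 else f i j)))
      (best (i + 1) (Function.update f i (fun j => if t ≤ val j then f i j else 0)))
    classical
    -- A pair that is not a legal test, or not the acceptance set of any threshold, falls back to a
    -- choice, so that every candidate is admissible.
    let cand : Fin n ⊕ (Fin n × Finset (Fin m)) → TestTree n := fun o =>
      match o with
      | .inl i => .choose i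
      | .inr (i, T) =>
        if h : ((i : ℕ) + 1 = k ∨ (i : ℕ) = k) ∧
            ∃ t, Finset.univ.filter (fun j => t ≤ val j) = T then
          tree i h.2.choose
        else .choose i
    obtain ⟨o, -, ho⟩ := Finset.exists_max_image Finset.univ
      (fun o => wreward val g f (cand o)) Finset.univ_nonempty
    refine ⟨cand o, ?_, ?_, fun B hB hBn => ?_⟩
    · rcases o with i | ⟨i, T⟩
      · trivial
      · simp only [cand]
        split_ifs with h
        · exact ⟨h.1, hseq _ _, hseq _ _⟩
        · trivial
    · rcases o with i | ⟨i, T⟩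
      · simp [cand, TestTree.numTests]
      · simp only [cand]
        split_ifs with h
        · exact Nat.succ_le_succ (max_le (hnum _ _) (hnum _ _))
        · simp [TestTree.numTests]
    · cases B with
      | choose l => exact ho (.inl l) (Finset.mem_univ _)
      | test i t neg pos =>
        obtain ⟨hi, hneg, hpos⟩ := hB
        simp only [TestTree.numTests, add_le_add_iff_right, max_le_iff] at hBn
        have hex : ∃ t', Finset.univ.filter (fun j => t' ≤ val j) =
          Finset.univ.filter (fun j => t ≤ val j) := ⟨t, rfl⟩
        refine le_trans ?_ (ho (.inr (i, Finset.univ.filter (fun j => t ≤ val j)))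
          (Finset.mem_univ _))
        simp only [cand, dif_pos (And.intro hi hex)]
        have hiff : ∀ j, hex.choose ≤ val j ↔ t ≤ val j := fun j => by
          have := congrArg (j ∈ ·) hex.choose_spec
          simpa using this
        simp only [tree]
        rw [wreward_test, wreward_test]
        simp only [hiff]
        exact add_le_add (hbest _ _ _ hneg hBn.1) (hbest _ _ _ hpos hBn.2)

end Weighted

/-! ### Optimal algorithms exist, and randomization does not help. -/

namespace TestTree

variable {n : ℕ}

theorem reward_nonneg (F : FinDist) (A : TestTree n) : 0 ≤ A.reward F :=
  wreward_nonneg F.v_nonneg (fun _ j => (F.p_pos j).le) A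

/-- A randomized algorithm earns an average of deterministic rewards. These are nonnegative, so
monotonicity of the integral needs integrability of the constant bound only. -/
theorem isOptimal_of_forall_le {F : FinDist} {A : TestTree n} (hA : A.IsSequentialAlgorithm)
    (h : ∀ B : TestTree n, B.IsSequentialAlgorithm → B.reward F ≤ A.reward F) :
    A.IsOptimal F := by
  refine ⟨hA, fun Ω _ μ _ B hB _ => ?_⟩
  refine (integral_mono_of_nonneg (ae_of_all _ fun ω => reward_nonneg F (B ω))
    (integrable_const (A.reward F)) (ae_of_all _ fun ω => h _ (hB ω))).trans ?_
  simp

/-- A deterministic competitor is a randomized one with a one-point seed space. -/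
theorem IsOptimal.reward_le {F : FinDist} {A B : TestTree n} (hA : A.IsOptimal F)
    (hB : B.IsSequentialAlgorithm) : B.reward F ≤ A.reward F := by
  simpa using hA.2 Unit (Measure.dirac ()) (fun _ => B) (fun _ => hB) measurable_const

theorem exists_isOptimal (hn : 1 ≤ n) (F : FinDist) : ∃ A : TestTree n, A.IsOptimal F := by
  obtain ⟨A, h1, h2, h3⟩ := exists_best_tree hn F.v F.v n 0 (fun _ => F.p)
  exact ⟨A, isOptimal_of_forall_le ⟨h1, h2⟩ fun B hB => h3 B hB.1 hB.2⟩

end TestTree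

/-! ### The distribution of the first box of maximal level -/

/-- `∑_{i < n} a^i b^(n-1-i)`. -/
noncomputable def geomSum₂ (n : ℕ) (a b : ℝ) : ℝ := ∑ i ∈ Finset.range n, a ^ i * b ^ (n - 1 - i)

theorem geomSum₂_nonneg (n : ℕ) {a b : ℝ} (ha : 0 ≤ a) (hb : 0 ≤ b) : 0 ≤ geomSum₂ n a b :=
  Finset.sum_nonneg fun _ _ => by positivity

/-- For `a = P(X < v)` and `p = P(X = v)`, both sides are the probability that the maximum of `n`
draws is `v`; on the left it is split by the first box attaining it. -/
theorem mul_geomSum₂_add (n : ℕ) (a p : ℝ) :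
    p * geomSum₂ n a (a + p) = (a + p) ^ n - a ^ n := by
  have h := (Commute.all a (a + p)).geom_sum₂_mul n
  unfold geomSum₂
  linear_combination -h

theorem geomSum₂_succ (n : ℕ) (a b : ℝ) :
    geomSum₂ (n + 1) a b = b * geomSum₂ n a b + a ^ n := by
  unfold geomSum₂
  rw [Finset.sum_range_succ, Finset.mul_sum]
  congr 1
  · refine Finset.sum_congr rfl fun i hi => ?_
    have : n + 1 - 1 - i = (n - 1 - i) + 1 := by have := Finset.mem_range.mp hi; omega
    rw [this]; ring
  · simp

theorem card_mul_pow_le_geomSum₂ (n : ℕ) {a b : ℝ} (ha : 0 ≤ a) (hab : a ≤ b) :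
    n * a ^ n ≤ a * geomSum₂ n a b := by
  unfold geomSum₂
  rw [Finset.mul_sum]
  calc (n : ℝ) * a ^ n = ∑ i ∈ Finset.range n, a ^ n := by simp
    _ ≤ _ := Finset.sum_le_sum fun i hi => by
      have : n = 1 + i + (n - 1 - i) := by have := Finset.mem_range.mp hi; omega
      calc a ^ n = a * (a ^ i * a ^ (n - 1 - i)) := by conv_lhs => rw [this, pow_add, pow_add]
                                                       ring
        _ ≤ _ := by gcongr

/-- This bounds the loss from using `N` boxes in place of `n`. The quotient `geomSum₂ n a b / n`
does not increase with `n`: one more box multiplies the old sum by `b ≤ 1` and adds `a ^ n`, which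
is at most the average of the old terms. -/
theorem mul_geomSum₂_le_mul {N n : ℕ} (h : N ≤ n) {a b : ℝ} (ha : 0 ≤ a) (hab : a ≤ b)
    (hb : b ≤ 1) : N * geomSum₂ n a b ≤ n * geomSum₂ N a b := by
  rcases Nat.eq_zero_or_pos N with rfl | hN
  · simp [geomSum₂]
  induction n, h using Nat.le_induction with
  | base => exact le_rfl
  | succ n hn ih =>
    have hn0 : (0 : ℝ) < n := by exact_mod_cast lt_of_lt_of_le hN hn
    have h0 : 0 ≤ geomSum₂ n a b := geomSum₂_nonneg n ha (ha.trans hab)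
    have h1 : (n : ℝ) * geomSum₂ (n + 1) a b ≤ (n + 1) * geomSum₂ n a b := by
      rw [geomSum₂_succ]
      have := card_mul_pow_le_geomSum₂ n ha hab
      have h2 : (n : ℝ) * (b * geomSum₂ n a b) ≤ n * geomSum₂ n a b := by
        gcongr; exact mul_le_of_le_one_left h0 hb
      have h3 : a * geomSum₂ n a b ≤ geomSum₂ n a b :=
        mul_le_of_le_one_left h0 (hab.trans hb)
      linarith
    refine le_of_mul_le_mul_left ?_ hn0
    calc (n : ℝ) * (N * geomSum₂ (n + 1) a b) = N * (n * geomSum₂ (n + 1) a b) := by ring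
      _ ≤ N * ((n + 1) * geomSum₂ n a b) := by gcongr
      _ = (n + 1) * (N * geomSum₂ n a b) := by ring
      _ ≤ (n + 1) * (n * geomSum₂ N a b) := by gcongr
      _ = n * (((n + 1 : ℕ) : ℝ) * geomSum₂ N a b) := by push_cast; ring

/-- Among the first `N` boxes, box `i` is the first one of maximal level. -/
def IsFirstMax {n : ℕ} {α : Type*} [LinearOrder α] (N : ℕ) (φ : Fin n → α) (i : Fin n) : Prop :=
  ∀ l : Fin n, (l < i → φ l < φ i) ∧ (i < l → (l : ℕ) < N → φ l ≤ φ i)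

theorem prod_range_piecewise {i N n : ℕ} (hi : i < N) (hN : N ≤ n) (Q p R : ℝ) :
    ∏ l ∈ Finset.range n, (if l < i then Q else if l = i then p else if l < N then R else 1) =
      Q ^ i * p * R ^ (N - 1 - i) := by
  have hn : n = i + 1 + (N - 1 - i) + (n - N) := by omega
  rw [hn, Finset.prod_range_add, Finset.prod_range_add, Finset.prod_range_succ]
  rw [Finset.prod_congr rfl (g := fun _ => Q) (fun l hl => by rw [if_pos (Finset.mem_range.mp hl)])]
  rw [Finset.prod_congr rfl (s₁ := Finset.range (N - 1 - i)) (g := fun _ => R) (fun l hl => by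
    have := Finset.mem_range.mp hl
    rw [if_neg (by omega), if_neg (by omega), if_pos (by omega)])]
  rw [Finset.prod_congr rfl (s₁ := Finset.range (n - N)) (g := fun _ => (1 : ℝ)) (fun l hl => by
    rw [if_neg (by omega), if_neg (by omega), if_neg (by omega)])]
  simp

-- Once the value `j` of box `i` is fixed, being the first maximum is a separate condition on each
-- box: strictly lower level before `i`, no higher level between `i` and `N`, and nothing from `N`
-- on. Independence turns this into a product.
open Classical in
theorem expect_isFirstMax (F : FinDist) {n N : ℕ} (hN : N ≤ n) {α : Type*} [LinearOrder α]
    (φ : Fin F.m → α) (i : Fin n) (hi : (i : ℕ) < N) (w : Fin F.m → ℝ) :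
    ∑ x : Fin n → Fin F.m, (∏ l, F.p (x l)) *
        (if IsFirstMax N (fun l => φ (x l)) i then w (x i) else 0) =
      ∑ j, w j * F.p j * ((∑ k, if φ k < φ j then F.p k else 0) ^ (i : ℕ) *
        (∑ k, if φ k ≤ φ j then F.p k else 0) ^ (N - 1 - i)) := by
  let ind : Fin F.m → Fin n → Fin F.m → Prop := fun j l k =>
    if (l : ℕ) < i then φ k < φ j else if (l : ℕ) = i then k = j else
      if (l : ℕ) < N then φ k ≤ φ j else True
  have key : ∀ j, (∑ x : Fin n → Fin F.m, ∏ l, (if ind j l (x l) then F.p (x l) else 0)) =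
      F.p j * ((∑ k, if φ k < φ j then F.p k else 0) ^ (i : ℕ) *
        (∑ k, if φ k ≤ φ j then F.p k else 0) ^ (N - 1 - i)) := by
    intro j
    rw [sum_prod_eq_prod_sum (fun l k => if ind j l k then F.p k else 0)]
    rw [← mul_assoc, mul_comm (F.p j), ← prod_range_piecewise hi hN,
      ← Fin.prod_univ_eq_prod_range (fun l => if l < (i : ℕ) then
        (∑ k, if φ k < φ j then F.p k else 0) else if l = i then F.p j else if l < N then
        (∑ k, if φ k ≤ φ j then F.p k else 0) else 1) n]
    refine Finset.prod_congr rfl fun l _ => ?_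
    simp only [ind]
    split_ifs with h1 h2 h3
    · rfl
    · simp
    · rfl
    · simp [F.p_sum]
  rw [Finset.sum_congr rfl (g := fun j => ∑ x : Fin n → Fin F.m, w j *
    ∏ l, (if ind j l (x l) then F.p (x l) else 0)) (fun j _ => by
      rw [← Finset.mul_sum, key]; ring), Finset.sum_comm]
  refine Finset.sum_congr rfl fun x _ => ?_
  have hprod : ∀ j, ∏ l, (if ind j l (x l) then F.p (x l) else 0) =
      if ∀ l, ind j l (x l) then ∏ l, F.p (x l) else 0 := by
    intro j
    split_ifs with h
    · exact Finset.prod_congr rfl fun l _ => if_pos (h l)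
    · push Not at h
      obtain ⟨l, hl⟩ := h
      exact Finset.prod_eq_zero (Finset.mem_univ l) (if_neg hl)
  have hiff : ∀ j, (∀ l, ind j l (x l)) ↔ x i = j ∧ IsFirstMax N (fun l => φ (x l)) i := by
    intro j
    constructor
    · intro h
      have hij : x i = j := by simpa [ind] using h i
      refine ⟨hij, fun l => ⟨fun hl => ?_, fun hl hlN => ?_⟩⟩
      · have := h l
        simp only [ind, if_pos (Fin.lt_def.mp hl)] at this
        simpa only [hij] using this
      · have := h l
        have hl' := Fin.lt_def.mp hl
        simp only [ind, if_neg (not_lt.mpr hl'.le), if_neg hl'.ne', if_pos hlN] at this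
        simpa only [hij] using this
    · rintro ⟨rfl, h⟩ l
      simp only [ind]
      split_ifs with h1 h2 h3
      · exact (h l).1 h1
      · rw [Fin.ext h2]
      · exact (h l).2 (Fin.lt_def.mpr (by omega)) h3
  simp only [hprod, hiff]
  rw [Finset.sum_eq_single (x i)]
  · simp only [true_and]
    split_ifs <;> ring
  · intro j _ hj
    rw [if_neg (fun h => hj h.1.symm), mul_zero]
  · simp

namespace FinDist

variable (F : FinDist)

theorem m_pos : 0 < F.m := by
  rcases Nat.eq_zero_or_pos F.m with h | h
  · have h1 := F.p_sum
    have : IsEmpty (Fin F.m) := by rw [h]; infer_instance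
    simp at h1
  · exact h

/-- `P(X < v j)` -/
noncomputable def below (j : Fin F.m) : ℝ := ∑ k, if F.v k < F.v j then F.p k else 0

/-- `P(X ≤ v j)` -/
noncomputable def upto (j : Fin F.m) : ℝ := ∑ k, if F.v k ≤ F.v j then F.p k else 0

theorem sum_ite_nonneg (P : Fin F.m → Prop) [DecidablePred P] :
    0 ≤ ∑ k, if P k then F.p k else 0 :=
  Finset.sum_nonneg fun k _ => by split_ifs; exacts [(F.p_pos k).le, le_rfl]

theorem sum_ite_mono {P Q : Fin F.m → Prop} [DecidablePred P] [DecidablePred Q]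
    (h : ∀ k, P k → Q k) :
    (∑ k, if P k then F.p k else 0) ≤ ∑ k, if Q k then F.p k else 0 :=
  Finset.sum_le_sum fun k _ => by
    have := (F.p_pos k).le
    split_ifs with h1 h2 h2
    exacts [le_rfl, absurd (h k h1) h2, this, le_rfl]

theorem sum_ite_le_one (P : Fin F.m → Prop) [DecidablePred P] :
    (∑ k, if P k then F.p k else 0) ≤ 1 := by
  rw [← F.p_sum]
  refine Finset.sum_le_sum fun k _ => ?_
  split_ifs
  exacts [le_rfl, (F.p_pos k).le]

theorem below_nonneg (j : Fin F.m) : 0 ≤ F.below j := F.sum_ite_nonneg _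

theorem upto_le_one (j : Fin F.m) : F.upto j ≤ 1 := F.sum_ite_le_one _

theorem upto_eq (j : Fin F.m) : F.upto j = F.below j + F.p j := by
  have : F.p j = ∑ k, if k = j then F.p k else 0 := by simp
  rw [upto, below, this, ← Finset.sum_add_distrib]
  refine Finset.sum_congr rfl fun k _ => ?_
  rcases lt_trichotomy (F.v k) (F.v j) with h | h | h
  · have : k ≠ j := by rintro rfl; exact lt_irrefl _ h
    simp [h, h.le, this]
  · have := F.v_injective h
    subst this; simp
  · have : k ≠ j := by rintro rfl; exact lt_irrefl _ h
    simp [not_lt.mpr h.le, not_le.mpr h, this]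

theorem below_le_upto (j : Fin F.m) : F.below j ≤ F.upto j := by
  rw [upto_eq]; linarith [F.p_pos j]

theorem upto_le_below {k j : Fin F.m} (h : F.v k < F.v j) : F.upto k ≤ F.below j :=
  F.sum_ite_mono fun _ hl => lt_of_le_of_lt hl h

theorem below_lt_one (j : Fin F.m) : F.below j < 1 := by
  have := F.upto_le_one j
  rw [upto_eq] at this
  linarith [F.p_pos j]

-- With the values themselves as levels, some box is the first maximum and it carries the supremum.
-- Summing over all boxes therefore gives an upper bound without an argument for uniqueness.
open Classical in
theorem expectMax_le {n : ℕ} (hn : 1 ≤ n) :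
    F.expectMax n ≤ ∑ j, F.v j * F.p j * geomSum₂ n (F.below j) (F.upto j) := by
  have : Nonempty (Fin n) := ⟨⟨0, hn⟩⟩
  have h := fun i : Fin n => expect_isFirstMax F le_rfl F.v i i.2 F.v
  calc F.expectMax n ≤ ∑ x : Fin n → Fin F.m, ∑ i : Fin n, (∏ l, F.p (x l)) *
        (if IsFirstMax n (fun l => F.v (x l)) i then F.v (x i) else 0) := by
        refine Finset.sum_le_sum fun x _ => ?_
        rw [← Finset.mul_sum]
        refine mul_le_mul_of_nonneg_left ?_ (Finset.prod_nonneg fun _ _ => (F.p_pos _).le)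
        obtain ⟨i0, -, hi0⟩ := Finset.exists_max_image Finset.univ (fun i => F.v (x i))
          Finset.univ_nonempty
        obtain ⟨i, hi, hmin⟩ := Finset.exists_min_image
          (Finset.univ.filter fun i => F.v (x i) = F.v (x i0)) id ⟨i0, by simp⟩
        have hi' := (Finset.mem_filter.mp hi).2
        have hfm : IsFirstMax n (fun l => F.v (x l)) i := by
          refine fun l => ⟨fun hl => ?_, fun _ _ => by simpa [hi'] using hi0 l (Finset.mem_univ _)⟩
          refine lt_of_le_of_ne (by simpa [hi'] using hi0 l (Finset.mem_univ _)) fun heq => ?_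
          exact absurd (hmin l (Finset.mem_filter.mpr ⟨Finset.mem_univ _, heq.trans hi'⟩))
            (not_le.mpr hl)
        calc (⨆ i, F.v (x i)) ≤ F.v (x i) :=
              ciSup_le fun l => by simpa [hi'] using hi0 l (Finset.mem_univ _)
          _ = if IsFirstMax n (fun l => F.v (x l)) i then F.v (x i) else 0 := (if_pos hfm).symm
          _ ≤ _ := Finset.single_le_sum
              (f := fun i => if IsFirstMax n (fun l => F.v (x l)) i then F.v (x i) else 0)
              (fun i _ => by split_ifs; exacts [F.v_nonneg _, le_rfl]) (Finset.mem_univ i)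
    _ = _ := by
        rw [Finset.sum_comm, Finset.sum_congr rfl fun i _ => h i, Finset.sum_comm]
        refine Finset.sum_congr rfl fun j _ => ?_
        rw [← Finset.mul_sum]
        congr 1
        exact Fin.sum_univ_eq_sum_range (fun i => F.below j ^ i * F.upto j ^ (n - 1 - i)) n

/-- The sum telescopes: if the values are inserted in increasing order, a new largest value of mass
`p` above total mass `P` contributes `(P + p) ^ n - P ^ n`. -/
theorem sum_mul_geomSum₂_eq_pow (n : ℕ) (hn : 1 ≤ n) (s : Finset (Fin F.m)) :
    ∑ j ∈ s, F.p j * geomSum₂ n (∑ k ∈ s, if F.v k < F.v j then F.p k else 0)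
      (∑ k ∈ s, if F.v k ≤ F.v j then F.p k else 0) = (∑ j ∈ s, F.p j) ^ n := by
  induction s using Finset.induction_on_max_value F.v with
  | empty => simp [Nat.ne_of_gt hn]
  | insert a s ha hmax ih =>
    rw [Finset.sum_insert ha]
    have hlt : ∀ x ∈ s, F.v x < F.v a := fun x hx => lt_of_le_of_ne (hmax x hx) fun h =>
      ha (F.v_injective h ▸ hx)
    have h1 : (∑ k ∈ insert a s, if F.v k < F.v a then F.p k else 0) = ∑ k ∈ s, F.p k := by
      rw [Finset.sum_insert ha, if_neg (lt_irrefl _), zero_add]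
      exact Finset.sum_congr rfl fun k hk => if_pos (hlt k hk)
    have h2 : (∑ k ∈ insert a s, if F.v k ≤ F.v a then F.p k else 0) =
        (∑ k ∈ s, F.p k) + F.p a := by
      rw [Finset.sum_insert ha, if_pos le_rfl, add_comm]
      congr 1
      exact Finset.sum_congr rfl fun k hk => if_pos (hlt k hk).le
    have h3 : ∑ j ∈ s, F.p j * geomSum₂ n
        (∑ k ∈ insert a s, if F.v k < F.v j then F.p k else 0)
        (∑ k ∈ insert a s, if F.v k ≤ F.v j then F.p k else 0) = (∑ j ∈ s, F.p j) ^ n := by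
      rw [← ih]
      refine Finset.sum_congr rfl fun j hj => ?_
      rw [Finset.sum_insert ha, Finset.sum_insert ha, if_neg (not_lt.mpr (hlt j hj).le),
        if_neg (not_le.mpr (hlt j hj)), zero_add, zero_add]
    rw [h1, h2, h3, mul_geomSum₂_add, Finset.sum_insert ha, add_comm (F.p a)]
    ring

/-- On a lower set `s` of values, the cumulative sums restricted to `s` are the full ones; both
sides are the probability that all `n` draws fall into `s`. -/
theorem sum_lower_mul_geomSum₂ (n : ℕ) (hn : 1 ≤ n) (s : Finset (Fin F.m))
    (hs : ∀ j ∈ s, ∀ k, F.v k ≤ F.v j → k ∈ s) :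
    ∑ j ∈ s, F.p j * geomSum₂ n (F.below j) (F.upto j) = (∑ j ∈ s, F.p j) ^ n := by
  rw [← F.sum_mul_geomSum₂_eq_pow n hn s]
  refine Finset.sum_congr rfl fun j hj => ?_
  have h1 : F.below j = ∑ k ∈ s, if F.v k < F.v j then F.p k else 0 :=
    (Finset.sum_subset (Finset.subset_univ s) fun k _ hk =>
      if_neg fun h => hk (hs j hj k h.le)).symm
  have h2 : F.upto j = ∑ k ∈ s, if F.v k ≤ F.v j then F.p k else 0 :=
    (Finset.sum_subset (Finset.subset_univ s) fun k _ hk =>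
      if_neg fun h => hk (hs j hj k h)).symm
  rw [h1, h2]

/-- Little of the expected maximum is lost with the values below a low quantile. -/
theorem mul_expectMax_le_sum_upto_ge {n : ℕ} (hn : 1 ≤ n) {y : ℝ} (hy0 : 0 ≤ y) (hy1 : y ≤ 1) :
    (1 - y ^ n) * F.expectMax n ≤ ∑ j, if y ≤ F.upto j then
      F.v j * F.p j * geomSum₂ n (F.below j) (F.upto j) else 0 := by
  classical
  set H : Fin F.m → ℝ := fun j => F.p j * geomSum₂ n (F.below j) (F.upto j) with hH
  have hH0 : ∀ j, 0 ≤ H j := fun j => mul_nonneg (F.p_pos j).le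
    (geomSum₂_nonneg n (F.below_nonneg j) ((F.below_nonneg j).trans (F.below_le_upto j)))
  have hmono : ∀ {j k}, F.v k ≤ F.v j → F.upto k ≤ F.upto j := fun h =>
    F.sum_ite_mono fun _ hl => hl.trans h
  set good := Finset.univ.filter fun j => y ≤ F.upto j with hgood
  set bad := Finset.univ.filter fun j => ¬ y ≤ F.upto j with hbad
  have : Nonempty (Fin F.m) := ⟨⟨0, F.m_pos⟩⟩
  have hgne : good.Nonempty := by
    obtain ⟨j, -, hj⟩ := Finset.exists_max_image Finset.univ F.v Finset.univ_nonempty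
    refine ⟨j, Finset.mem_filter.mpr ⟨Finset.mem_univ _, hy1.trans ?_⟩⟩
    rw [← F.p_sum, upto]
    exact Finset.sum_le_sum fun k _ => by rw [if_pos (hj k (Finset.mem_univ _))]
  -- The value `v a` separates the two classes. With `u` the probability that the maximum is bad,
  -- the bad part is at most `v a * u` and the good part at least `v a * (1 - u)`.
  obtain ⟨a, ha, hamin⟩ := Finset.exists_min_image good F.v hgne
  have hbadlow : ∀ j ∈ bad, ∀ k, F.v k ≤ F.v j → k ∈ bad := by
    intro j hj k hk
    simp only [hbad, Finset.mem_filter, Finset.mem_univ, true_and, not_le] at hj ⊢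
    exact (hmono hk).trans_lt hj
  have hsb := F.sum_lower_mul_geomSum₂ n hn bad hbadlow
  have hsu := F.sum_lower_mul_geomSum₂ n hn Finset.univ fun _ _ _ _ => Finset.mem_univ _
  rw [F.p_sum, one_pow] at hsu
  have hsplit := Finset.sum_filter_add_sum_filter_not Finset.univ (fun j => y ≤ F.upto j) H
  set u := (∑ j ∈ bad, F.p j) ^ n with hu
  have hPB : 0 ≤ ∑ j ∈ bad, F.p j := Finset.sum_nonneg fun j _ => (F.p_pos j).le
  have hu0 : 0 ≤ u := by positivity
  have huy : u ≤ y ^ n := by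
    refine pow_le_pow_left₀ hPB ?_ n
    rcases bad.eq_empty_or_nonempty with h | h
    · rw [h]; simpa using hy0
    · obtain ⟨b, hb, hbmax⟩ := Finset.exists_max_image bad F.v h
      have hb' : F.upto b < y := by simpa [hbad] using hb
      refine le_trans ?_ hb'.le
      rw [upto, ← Finset.sum_filter]
      exact Finset.sum_le_sum_of_subset_of_nonneg
        (fun j hj => Finset.mem_filter.mpr ⟨Finset.mem_univ _, hbmax j hj⟩)
        fun j _ _ => (F.p_pos j).le
  have hu1 : u ≤ 1 := huy.trans (pow_le_one₀ hy0 hy1)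
  have hbadle : ∑ j ∈ bad, F.v j * H j ≤ F.v a * u := by
    rw [← hsb, Finset.mul_sum]
    refine Finset.sum_le_sum fun j hj => mul_le_mul_of_nonneg_right ?_ (hH0 j)
    by_contra! hlt
    have := hbadlow j hj a hlt.le
    simp only [hbad, hgood, Finset.mem_filter, Finset.mem_univ, true_and] at this ha
    exact this ha
  have hgoodge : F.v a * (1 - u) ≤ ∑ j ∈ good, F.v j * H j := by
    have : 1 - u = ∑ j ∈ good, H j := by
      have : ∑ j ∈ good, H j + u = 1 := by rw [← hsu, ← hsb]; exact hsplit
      linarith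
    rw [this, Finset.mul_sum]
    exact Finset.sum_le_sum fun j hj => mul_le_mul_of_nonneg_right (hamin j hj) (hH0 j)
  have hmax : F.expectMax n ≤ ∑ j ∈ good, F.v j * H j + ∑ j ∈ bad, F.v j * H j := by
    rw [Finset.sum_filter_add_sum_filter_not Finset.univ (fun j => y ≤ F.upto j)]
    refine (F.expectMax_le hn).trans (le_of_eq (Finset.sum_congr rfl fun j _ => ?_))
    simp only [hH]; ring
  have hE0 : 0 ≤ F.expectMax n := by
    refine Finset.sum_nonneg fun x _ => mul_nonneg
      (Finset.prod_nonneg fun _ _ => (F.p_pos _).le) (Real.iSup_nonneg fun i => F.v_nonneg _)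
  have hres : (∑ j, if y ≤ F.upto j then
      F.v j * F.p j * geomSum₂ n (F.below j) (F.upto j) else 0) = ∑ j ∈ good, F.v j * H j := by
    rw [hgood, Finset.sum_filter]
    refine Finset.sum_congr rfl fun j _ => ?_
    split_ifs
    · simp only [hH]; ring
    · rfl
  rw [hres]
  have hva := F.v_nonneg a
  calc (1 - y ^ n) * F.expectMax n ≤ (1 - u) * F.expectMax n := by gcongr
    _ ≤ (1 - u) * (∑ j ∈ good, F.v j * H j + ∑ j ∈ bad, F.v j * H j) := by
        gcongr
    -- Multiplying the two separation bounds by `1 - u` and `u` gives `(1 - u) * bad ≤ u * good`.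
    _ ≤ _ := by nlinarith

end FinDist

/-! ### Scanning the boxes with increasing levels -/

/-- Test the boxes from `i` on (at most `k` of them) one after the other for the level `c + 1`,
where `c` is the highest level found so far, in box `β`. A success raises the level by one, and the
same box is tested again. -/
noncomputable def scanTree {n : ℕ} (τ : ℕ → ℝ) : ℕ → ℕ → ℕ → ℕ → Fin n → TestTree n
  | 0, _, _, _, β => .choose β
  | s + 1, k, i, c, β =>
    if h : 0 < k ∧ i < n then
      .test ⟨i, h.2⟩ (τ (c + 1)) (scanTree τ s (k - 1) (i + 1) c β)
        (scanTree τ s k i (c + 1) ⟨i, h.2⟩)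
    else .choose β

section Scan

variable {n : ℕ} {τ : ℕ → ℝ}

theorem scanTree_numTests (s : ℕ) : ∀ (k i c : ℕ) (β : Fin n),
    (scanTree τ s k i c β).numTests ≤ s := by
  induction s with
  | zero => intros; simp [scanTree, TestTree.numTests]
  | succ s ih =>
    intro k i c β
    rw [scanTree]
    split_ifs
    · exact Nat.succ_le_succ (max_le (ih _ _ _ _) (ih _ _ _ _))
    · simp [TestTree.numTests]

theorem scanTree_sequentialFrom (s : ℕ) : ∀ (k i c : ℕ) (β : Fin n) (o : ℕ),
    (i + 1 = o ∨ i = o) → (scanTree τ s k i c β).SequentialFrom o := by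
  induction s with
  | zero => intros; exact trivial
  | succ s ih =>
    intro k i c β o ho
    rw [scanTree]
    split_ifs
    · exact ⟨ho, ih _ _ _ _ _ (Or.inr rfl), ih _ _ _ _ _ (Or.inl rfl)⟩
    · trivial

variable {X : Fin n → ℝ} {φ : Fin n → ℕ} {G : ℕ}

theorem scanTree_select_of_le (hτ : ∀ c, 1 ≤ c → ∀ l, τ c ≤ X l ↔ c ≤ φ l) (s : ℕ) :
    ∀ (k i c : ℕ) (β : Fin n), (∀ l : Fin n, i ≤ l → (l : ℕ) < i + k → φ l ≤ c) →
      (scanTree τ s k i c β).select X = β := by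
  induction s with
  | zero => intros; rfl
  | succ s ih =>
    intro k i c β hl
    rw [scanTree]
    split_ifs with h
    · have hi : ¬ τ (c + 1) ≤ X ⟨i, h.2⟩ := by
        rw [hτ _ (by omega)]
        have := hl ⟨i, h.2⟩ le_rfl (by simp; omega)
        omega
      rw [TestTree.select, if_neg hi]
      exact ih _ _ _ _ fun l h1 h2 => hl l (by omega) (by omega)
    · rfl

/-- Every test uses up a box (`k`) or a level (`G - c`), hence the budget `k + (G - c)`. Before box
`a` the recorded level stays below `φ a`, since all earlier boxes have lower levels; at `a` it
climbs to `φ a`, and from then on every test fails. -/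
theorem scanTree_select_of_lt (hτ : ∀ c, 1 ≤ c → ∀ l, τ c ≤ X l ↔ c ≤ φ l) (hG : ∀ l, φ l ≤ G)
    (a : Fin n) (s : ℕ) : ∀ (k i c : ℕ) (β : Fin n), k + (G - c) ≤ s → i ≤ a → (a : ℕ) < i + k →
      c < φ a → (∀ l : Fin n, i ≤ l → l < a → φ l < φ a) →
      (∀ l : Fin n, a < l → (l : ℕ) < i + k → φ l ≤ φ a) →
      (scanTree τ s k i c β).select X = a := by
  induction s with
  | zero => intros; omega
  | succ s ih =>
    intro k i c β hs hia hak hc h1 h2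
    have hin : i < n := lt_of_le_of_lt hia a.2
    rw [scanTree, dif_pos ⟨by omega, hin⟩, TestTree.select]
    have hGa := hG a
    split_ifs with h
    · rw [hτ _ (by omega)] at h
      -- A success that reaches level `φ a` can only occur at `a` itself; any other success leaves
      -- the invariant intact.
      rcases Nat.lt_or_ge (c + 1) (φ a) with hca | hca
      · exact ih _ _ _ _ (by omega) hia hak hca h1 h2
      · have hai : (⟨i, hin⟩ : Fin n) = a := by
          by_contra hne
          have hlt : (⟨i, hin⟩ : Fin n) < a :=
            lt_of_le_of_ne (Fin.le_def.mpr hia) hne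
          have := h1 ⟨i, hin⟩ le_rfl hlt
          omega
        subst hai
        refine scanTree_select_of_le hτ _ _ _ _ _ fun l hl hlk => ?_
        rcases eq_or_lt_of_le (show (⟨i, hin⟩ : Fin n) ≤ l from hl) with he | hlt
        · rw [← he]; omega
        · have := h2 l hlt hlk; omega
    · rw [hτ _ (by omega)] at h
      have hai : i ≠ a := by
        rintro rfl
        have : (⟨(a : ℕ), hin⟩ : Fin n) = a := rfl
        rw [this] at h
        omega
      exact ih _ _ _ _ (by omega) (by omega) (by omega) hc
        (fun l hl hla => h1 l (by omega) hla) (fun l hl hlk => h2 l hl (by omega))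

end Scan

/-- The values of level at least `c` form an upper set, so its least element is a threshold for it;
if the set is empty, a number above all values serves. -/
theorem FinDist.exists_thresholds (F : FinDist) (φ : Fin F.m → ℕ)
    (hφ : ∀ {k j}, F.v k ≤ F.v j → φ k ≤ φ j) :
    ∃ τ : ℕ → ℝ, ∀ c j, τ c ≤ F.v j ↔ c ≤ φ j := by
  have : ∀ c, ∃ t : ℝ, ∀ j, t ≤ F.v j ↔ c ≤ φ j := by
    intro c
    rcases (Finset.univ.filter fun j => c ≤ φ j).eq_empty_or_nonempty with h | h
    · refine ⟨(∑ k, F.v k) + 1, fun j => ⟨fun hj => ?_, fun hj => ?_⟩⟩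
      · have := Finset.single_le_sum (fun k _ => F.v_nonneg k) (Finset.mem_univ j)
        linarith
      · have : j ∈ Finset.univ.filter fun j => c ≤ φ j := by simpa using hj
        simp [h] at this
    · obtain ⟨a, ha, hmin⟩ := Finset.exists_min_image _ F.v h
      refine ⟨F.v a, fun j => ⟨fun hj => ?_, fun hj => hmin j (by simpa using hj)⟩⟩
      have : c ≤ φ a := by simpa using ha
      exact this.trans (hφ hj)
  choose τ hτ using this
  exact ⟨τ, hτ⟩

/-- The scan makes at most `N` failing and `G` successful tests. Level `0` is left out of the bound:
if no box has positive level, the default box is kept, and its nonnegative payoff is discarded. -/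
theorem scan_reward_ge (F : FinDist) {n N G : ℕ} (hn : 1 ≤ n) (hNG : N + G ≤ n)
    (φ : Fin F.m → ℕ) (hφ : ∀ {k j}, F.v k ≤ F.v j → φ k ≤ φ j) (hG : ∀ j, φ j ≤ G) :
    ∃ A : TestTree n, A.IsSequentialAlgorithm ∧
      ∑ j, (if 1 ≤ φ j then F.v j * F.p j * geomSum₂ N (∑ k, if φ k < φ j then F.p k else 0)
        (∑ k, if φ k ≤ φ j then F.p k else 0) else 0) ≤ A.reward F := by
  classical
  obtain ⟨τ, hτ⟩ := F.exists_thresholds φ hφ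
  set A : TestTree n := scanTree τ n N 0 0 ⟨0, hn⟩ with hA
  refine ⟨A, ⟨scanTree_sequentialFrom _ _ _ _ _ _ (Or.inr rfl), scanTree_numTests _ _ _ _ _⟩, ?_⟩
  set w : Fin F.m → ℝ := fun j => if 1 ≤ φ j then F.v j else 0 with hw
  have hw0 : ∀ j, 0 ≤ w j := fun j => by
    simp only [hw]; split_ifs; exacts [F.v_nonneg _, le_rfl]
  have hsum : ∑ j, (if 1 ≤ φ j then F.v j * F.p j *
        geomSum₂ N (∑ k, if φ k < φ j then F.p k else 0)
        (∑ k, if φ k ≤ φ j then F.p k else 0) else 0) =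
      ∑ i : Fin n, if (i : ℕ) < N then ∑ x : Fin n → Fin F.m, (∏ l, F.p (x l)) *
        (if IsFirstMax N (fun l => φ (x l)) i then w (x i) else 0) else 0 := by
    rw [Finset.sum_congr rfl (g := fun i : Fin n => if (i : ℕ) < N then
      ∑ j, w j * F.p j * ((∑ k, if φ k < φ j then F.p k else 0) ^ (i : ℕ) *
        (∑ k, if φ k ≤ φ j then F.p k else 0) ^ (N - 1 - i)) else 0) (fun i _ => by
        split_ifs with hi
        · exact expect_isFirstMax F (by omega) φ i hi w
        · rfl)]
    rw [Fin.sum_univ_eq_sum_range (fun i : ℕ => if i < N then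
      ∑ j, w j * F.p j * ((∑ k, if φ k < φ j then F.p k else 0) ^ i *
        (∑ k, if φ k ≤ φ j then F.p k else 0) ^ (N - 1 - i)) else 0) n,
      ← Finset.sum_filter (fun i => i < N)]
    have : (Finset.range n).filter (fun i => i < N) = Finset.range N := by
      ext i; simp; omega
    rw [this, Finset.sum_comm]
    refine Finset.sum_congr rfl fun j _ => ?_
    rw [← Finset.mul_sum, geomSum₂]
    simp only [hw]
    split_ifs <;> simp
  rw [hsum]
  calc _ ≤ ∑ i : Fin n, ∑ x : Fin n → Fin F.m, (∏ l, F.p (x l)) *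
        (if i = A.select (fun l => F.v (x l)) then F.v (x i) else 0) := by
        refine Finset.sum_le_sum fun i _ => ?_
        split_ifs with hi
        · refine Finset.sum_le_sum fun x _ => mul_le_mul_of_nonneg_left ?_
            (Finset.prod_nonneg fun _ _ => (F.p_pos _).le)
          split_ifs with h1 h2 h2
          · simp only [hw]; split_ifs; exacts [le_rfl, F.v_nonneg _]
          · simp only [hw]
            split_ifs with h3
            · refine absurd ?_ h2
              refine (scanTree_select_of_lt (G := G) (φ := fun l => φ (x l))
                (fun c _ l => hτ c _) (fun l => hG _) i n N 0 0 _ (by omega) (by omega) (by omega)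
                (by omega) (fun l _ hl => (h1 l).1 hl)
                (fun l hl hlN => (h1 l).2 hl (by omega))).symm
            · exact le_rfl
          · exact F.v_nonneg _
          · exact le_rfl
        · refine Finset.sum_nonneg fun x _ => mul_nonneg
            (Finset.prod_nonneg fun _ _ => (F.p_pos _).le) ?_
          split_ifs; exacts [F.v_nonneg _, le_rfl]
    _ = A.reward F := by
        rw [Finset.sum_comm]
        refine Finset.sum_congr rfl fun x _ => ?_
        rw [← Finset.mul_sum]
        simp

/-! ### Levels from geometric quantiles. -/

namespace FinDist

variable (F : FinDist)

/-- The least value `v a` excluded from the sum has `below a ≥ y`, and all smaller values are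
included. -/
theorem le_sum_below_lt {y : ℝ} (hy : y ≤ 1) :
    y ≤ ∑ k, if F.below k < y then F.p k else 0 := by
  rcases (Finset.univ.filter fun j => ¬ F.below j < y).eq_empty_or_nonempty with h | h
  · have : ∀ k, F.below k < y := fun k => by
      by_contra hk
      have : k ∈ Finset.univ.filter fun j => ¬ F.below j < y := by simpa using hk
      rw [h] at this
      exact absurd this (Finset.notMem_empty k)
    simp [this, F.p_sum, hy]
  · obtain ⟨a, ha, hmin⟩ := Finset.exists_min_image _ F.v h
    have ha' : y ≤ F.below a := by simpa using ha
    refine ha'.trans (F.sum_ite_mono fun k hk => ?_)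
    by_contra hk'
    exact absurd (hmin k (by simpa using hk')) (not_le.mpr hk)

/-- The level of the value `v j` with respect to the quantiles `lam, …, lam ^ g`. -/
noncomputable def level (lam : ℝ) (g : ℕ) (j : Fin F.m) : ℕ :=
  (if lam ^ g ≤ F.upto j then 1 else 0) +
    ((Finset.range g).filter fun c => lam ^ (c + 1) ≤ F.below j).card

variable {lam : ℝ} {g : ℕ}

theorem level_le (j : Fin F.m) : F.level lam g j ≤ g + 1 := by
  have := Finset.card_filter_le (Finset.range g) fun c => lam ^ (c + 1) ≤ F.below j
  rw [Finset.card_range] at this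
  unfold level
  split_ifs <;> omega

theorem level_mono {k j : Fin F.m} (h : F.v k ≤ F.v j) : F.level lam g k ≤ F.level lam g j := by
  refine add_le_add ?_ (Finset.card_le_card fun c hc => ?_)
  · have : F.upto k ≤ F.upto j := F.sum_ite_mono fun _ hl => hl.trans h
    split_ifs with h1 h2
    exacts [le_rfl, absurd (h1.trans this) h2, by simp, le_rfl]
  · have : F.below k ≤ F.below j := F.sum_ite_mono fun _ hl => hl.trans_le h
    simp only [Finset.mem_filter] at hc ⊢
    exact ⟨hc.1, hc.2.trans this⟩

/-- Coarsening values to levels merges `v j` with some smaller values; this bounds the mass lost. If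
`below j < lam ^ g`, all smaller values have level `0` and nothing is lost. Otherwise let `lam ^ c`
be the largest quantile not above `below j`. The values with `below k < lam ^ c` have a lower level
and total mass at least `lam ^ c`, which is at least `lam * below j` because `below j < lam ^ (c -
1)`. -/
theorem mul_below_le_sum_level_lt (h0 : 0 ≤ lam) (h1 : lam ≤ 1) {j : Fin F.m}
    (hj : lam ^ g ≤ F.upto j) :
    lam * F.below j ≤ ∑ k, if F.level lam g k < F.level lam g j then F.p k else 0 := by
  rcases lt_or_ge (F.below j) (lam ^ g) with hlt | hge
  · refine (mul_le_of_le_one_left (F.below_nonneg j) h1).trans (F.sum_ite_mono fun k hk => ?_)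
    have hk' : F.upto k < lam ^ g := (F.upto_le_below hk).trans_lt hlt
    have hz : F.level lam g k = 0 := by
      rw [level, if_neg (not_le.mpr hk'), zero_add, Finset.card_eq_zero, Finset.filter_eq_empty_iff]
      intro c hc
      rw [not_le]
      refine (F.below_le_upto k).trans_lt (hk'.trans_le ?_)
      exact pow_le_pow_of_le_one h0 h1 (by have := Finset.mem_range.mp hc; omega)
    rw [hz, level, if_pos hj]
    omega
  · have hex : ∃ c, lam ^ c ≤ F.below j := ⟨g, hge⟩
    classical
    set c := Nat.find hex with hc
    have hc1 : lam ^ c ≤ F.below j := Nat.find_spec hex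
    have hcg : c ≤ g := Nat.find_min' hex hge
    have hcpos : c ≠ 0 := by
      intro h
      rw [h, pow_zero] at hc1
      exact absurd hc1 (not_le.mpr (F.below_lt_one j))
    obtain ⟨d, hd⟩ := Nat.exists_eq_succ_of_ne_zero hcpos
    have hdlt : ¬ lam ^ d ≤ F.below j := Nat.find_min hex (by omega)
    calc lam * F.below j ≤ lam * lam ^ d := by gcongr; exact (not_le.mp hdlt).le
      _ = lam ^ c := by rw [hd, Nat.succ_eq_add_one, pow_succ, mul_comm]
      _ ≤ _ := F.le_sum_below_lt (pow_le_one₀ h0 h1)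
      _ ≤ _ := F.sum_ite_mono fun k hk => ?_
    have hv : F.v k ≤ F.v j := by
      by_contra! h
      have : F.below j ≤ F.below k := (F.below_le_upto j).trans (F.upto_le_below h)
      linarith
    refine add_lt_add_of_le_of_lt ?_ (Finset.card_lt_card ?_)
    · have : F.upto k ≤ F.upto j := F.sum_ite_mono fun _ hl => hl.trans hv
      rw [if_pos hj]
      split_ifs <;> simp
    · have hb : F.below k ≤ F.below j := F.sum_ite_mono fun _ hl => hl.trans_le hv
      refine (Finset.ssubset_iff_of_subset fun e he => ?_).mpr ⟨d, ?_, ?_⟩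
      · simp only [Finset.mem_filter] at he ⊢
        exact ⟨he.1, he.2.trans hb⟩
      · simp only [Finset.mem_filter, Finset.mem_range]
        rw [hd] at hc1
        exact ⟨by omega, hc1⟩
      · simp only [Finset.mem_filter, not_and, not_le]
        intro _
        rw [hd] at hk
        exact hk

/-- Some sequential algorithm is nearly competitive. -/
theorem exists_reward_ge {n : ℕ} (hn : 1 ≤ n) (h0 : 0 ≤ lam) (h1 : lam ≤ 1) (hg : g + 1 ≤ n) :
    ∃ A : TestTree n, A.IsSequentialAlgorithm ∧
      lam ^ n * (((n - (g + 1) : ℕ) : ℝ) / n) * ((1 - (lam ^ g) ^ n) * F.expectMax n) ≤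
        A.reward F := by
  -- The `g + 1` tests held back pay for the successes, one per positive level.
  set N := n - (g + 1) with hN
  obtain ⟨A, hA, hAr⟩ := scan_reward_ge F (N := N) (G := g + 1) hn (by omega) (F.level lam g)
    F.level_mono F.level_le
  refine ⟨A, hA, le_trans ?_ hAr⟩
  refine (mul_le_mul_of_nonneg_left (F.mul_expectMax_le_sum_upto_ge hn (pow_nonneg h0 g)
    (pow_le_one₀ h0 h1)) (by positivity)).trans ?_
  rw [Finset.mul_sum]
  refine Finset.sum_le_sum fun j _ => ?_
  split_ifs with hj hl hl
  · set Q := ∑ k, if F.level lam g k < F.level lam g j then F.p k else 0 with hQ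
    set R := ∑ k, if F.level lam g k ≤ F.level lam g j then F.p k else 0 with hR
    have hQa : lam * F.below j ≤ Q := F.mul_below_le_sum_level_lt h0 h1 hj
    have hRb : F.upto j ≤ R := F.sum_ite_mono fun k hk => F.level_mono hk
    have ha := F.below_nonneg j
    have hb : 0 ≤ F.upto j := ha.trans (F.below_le_upto j)
    have hn0 : (0 : ℝ) < n := by exact_mod_cast hn
    -- The factor `N / n` accounts for the boxes left out. The power of `lam` comes from replacing
    -- `below j` by `Q`, which occurs with exponents less than `n`.
    have hc : lam ^ n * ((N : ℝ) / n) * geomSum₂ n (F.below j) (F.upto j) ≤ geomSum₂ N Q R := by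
      have e1 : (N : ℝ) / n * geomSum₂ n (F.below j) (F.upto j) ≤
          geomSum₂ N (F.below j) (F.upto j) := by
        rw [div_mul_eq_mul_div, div_le_iff₀ hn0, mul_comm _ (n : ℝ)]
        exact mul_geomSum₂_le_mul (by omega) ha (F.below_le_upto j) (F.upto_le_one j)
      have e2 : lam ^ n * geomSum₂ N (F.below j) (F.upto j) ≤ geomSum₂ N Q R := by
        unfold geomSum₂
        rw [Finset.mul_sum]
        refine Finset.sum_le_sum fun i hi => ?_
        have hin : i ≤ n := by have := Finset.mem_range.mp hi; omega
        calc lam ^ n * (F.below j ^ i * F.upto j ^ (N - 1 - i))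
            ≤ lam ^ i * (F.below j ^ i * F.upto j ^ (N - 1 - i)) := by
              exact mul_le_mul_of_nonneg_right (pow_le_pow_of_le_one h0 h1 hin) (by positivity)
          _ = (lam * F.below j) ^ i * F.upto j ^ (N - 1 - i) := by rw [mul_pow]; ring
          _ ≤ _ := by
              have hQ0 : 0 ≤ Q := (mul_nonneg h0 ha).trans hQa
              gcongr
      calc _ = lam ^ n * ((N : ℝ) / n * geomSum₂ n (F.below j) (F.upto j)) := by ring
        _ ≤ lam ^ n * geomSum₂ N (F.below j) (F.upto j) := by gcongr
        _ ≤ _ := e2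
    have hvp : 0 ≤ F.v j * F.p j := mul_nonneg (F.v_nonneg j) (F.p_pos j).le
    calc _ = F.v j * F.p j * (lam ^ n * ((N : ℝ) / n) * geomSum₂ n (F.below j) (F.upto j)) := by
          ring
      _ ≤ _ := by gcongr
  · exfalso
    apply hl
    rw [level, if_pos hj]
    omega
  · rw [mul_zero]
    exact mul_nonneg (mul_nonneg (F.v_nonneg j) (F.p_pos j).le)
      (geomSum₂_nonneg _ (F.sum_ite_nonneg _) (F.sum_ite_nonneg _))
  · rw [mul_zero]

theorem expectMax_nonneg (n : ℕ) : 0 ≤ F.expectMax n :=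
  Finset.sum_nonneg fun _ _ => mul_nonneg (Finset.prod_nonneg fun _ _ => (F.p_pos _).le)
    (Real.iSup_nonneg fun _ => F.v_nonneg _)

end FinDist

/-! ### The explicit competitive ratio. -/

/-- A competitive ratio in terms of `r ≤ n^(1/4)`. -/
noncomputable def ratio (r : ℝ) : ℝ := (1 - (r ^ 2 + 1) / r ^ 4) * (1 - 1 / r) * (1 - Real.exp (-r))

theorem tendsto_ratio : Tendsto ratio atTop (𝓝 1) := by
  have h1 : Tendsto (fun r : ℝ => (r ^ 2 + 1) / r ^ 4) atTop (𝓝 0) := by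
    have : Tendsto (fun r : ℝ => (r ^ 2)⁻¹ + (r ^ 4)⁻¹) atTop (𝓝 (0 + 0)) :=
      (tendsto_inv_atTop_zero.comp (tendsto_pow_atTop (by norm_num))).add
        (tendsto_inv_atTop_zero.comp (tendsto_pow_atTop (by norm_num)))
    rw [add_zero] at this
    refine this.congr' ?_
    filter_upwards [eventually_gt_atTop 0] with r hr
    field_simp
  have h2 : Tendsto (fun r : ℝ => 1 / r) atTop (𝓝 0) := by
    simpa using tendsto_inv_atTop_zero
  have h3 : Tendsto (fun r : ℝ => Real.exp (-r)) atTop (𝓝 0) := Real.tendsto_exp_neg_atTop_nhds_zero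
  have := ((h1.const_sub 1).mul (h2.const_sub 1)).mul (h3.const_sub 1)
  simp only [sub_zero, mul_one] at this
  exact this

/-- The parameters are `lam = 1 - 1 / (r * n)` and `g = r ^ 2`. Bernoulli's inequality gives `lam ^
n ≥ 1 - 1 / r`, the bound `1 - x ≤ exp (-x)` gives `lam ^ (g * n) ≤ exp (-r)`, and the boxes left
out are a fraction `(r ^ 2 + 1) / n ≤ (r ^ 2 + 1) / r ^ 4`. -/
theorem exists_ratio_mul_expectMax_le (F : FinDist) {n : ℕ} (hn : 1 ≤ n) {r : ℕ}
    (hr : 1 ≤ r) (hrn : r ^ 4 ≤ n) :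
    ∃ A : TestTree n, A.IsSequentialAlgorithm ∧ ratio r * F.expectMax n ≤ A.reward F := by
  have hE := F.expectMax_nonneg n
  rcases Nat.lt_or_ge r 2 with h2 | h2
  -- Here the ratio is `0`, so any algorithm will do.
  · obtain rfl : r = 1 := by omega
    refine ⟨.choose ⟨0, hn⟩, ⟨trivial, Nat.zero_le _⟩, ?_⟩
    simp only [ratio]
    norm_num
    exact TestTree.reward_nonneg F _
  · have hr0 : (2 : ℝ) ≤ r := by exact_mod_cast h2
    have hrn' : (r : ℝ) ^ 4 ≤ n := by exact_mod_cast hrn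
    have hn1 : (1 : ℝ) ≤ n := by exact_mod_cast hn
    set lam : ℝ := 1 - 1 / (r * n) with hlam
    have hinv : 1 / ((r : ℝ) * n) ≤ 1 := by
      rw [div_le_one (by positivity)]; nlinarith
    have h0 : 0 ≤ lam := by linarith
    have h1 : lam ≤ 1 := by
      have : 0 ≤ 1 / ((r : ℝ) * n) := by positivity
      linarith
    have hg : r ^ 2 + 1 ≤ n := by
      have : r ^ 4 = r ^ 2 * r ^ 2 := by ring
      nlinarith [Nat.pow_le_pow_left h2 2]
    obtain ⟨A, hA, hAr⟩ := F.exists_reward_ge hn h0 h1 hg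
    refine ⟨A, hA, le_trans ?_ hAr⟩
    have e1 : 1 - 1 / (r : ℝ) ≤ lam ^ n := by
      have := one_add_mul_le_pow (a := -(1 / ((r : ℝ) * n))) (by linarith) n
      have e : 1 + (n : ℝ) * -(1 / ((r : ℝ) * n)) = 1 - 1 / r := by field_simp; ring
      rw [e] at this
      simpa [hlam, sub_eq_add_neg] using this
    have e2 : 1 - ((r : ℝ) ^ 2 + 1) / r ^ 4 ≤ ((n - (r ^ 2 + 1) : ℕ) : ℝ) / n := by
      rw [Nat.cast_sub hg]
      push_cast
      rw [sub_div, div_self (by positivity)]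
      gcongr
    have e3 : (lam ^ (r ^ 2)) ^ n ≤ Real.exp (-r) := by
      have : lam ≤ Real.exp (-(1 / ((r : ℝ) * n))) := Real.one_sub_le_exp_neg _
      calc (lam ^ (r ^ 2)) ^ n = lam ^ (r ^ 2 * n) := by rw [pow_mul]
        _ ≤ Real.exp (-(1 / ((r : ℝ) * n))) ^ (r ^ 2 * n) := by gcongr
        _ = Real.exp (-r) := by
          rw [← Real.exp_nat_mul]
          congr 1
          push_cast
          field_simp
    have p1 : 0 ≤ 1 - 1 / (r : ℝ) := by
      rw [sub_nonneg, div_le_one (by linarith)]; linarith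
    have p2 : 0 ≤ 1 - ((r : ℝ) ^ 2 + 1) / r ^ 4 := by
      rw [sub_nonneg, div_le_one (by positivity)]
      have : (r : ℝ) ^ 4 = r ^ 2 * r ^ 2 := by ring
      nlinarith [pow_le_pow_left₀ (by norm_num) hr0 2]
    have p3 : 0 ≤ 1 - Real.exp (-(r : ℝ)) := by
      rw [sub_nonneg, Real.exp_le_one_iff]; linarith
    unfold ratio
    calc (1 - ((r : ℝ) ^ 2 + 1) / r ^ 4) * (1 - 1 / r) * (1 - Real.exp (-r)) * F.expectMax n
        = (1 - 1 / (r : ℝ)) * (1 - ((r : ℝ) ^ 2 + 1) / r ^ 4) *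
          ((1 - Real.exp (-r)) * F.expectMax n) := by ring
      _ ≤ _ := by gcongr

/-- The competitive ratio for `n` boxes. -/
noncomputable def competitiveRatio (n : ℕ) : ℝ := ratio (Nat.sqrt (Nat.sqrt n))

theorem tendsto_competitiveRatio : Tendsto competitiveRatio atTop (𝓝 1) := by
  have hs : Tendsto Nat.sqrt atTop atTop :=
    tendsto_atTop.mpr fun b => by
      filter_upwards [eventually_ge_atTop (b * b)] with n hn using Nat.le_sqrt.mpr hn
  exact tendsto_ratio.comp (tendsto_natCast_atTop_atTop.comp (hs.comp hs))

theorem TestTree.IsOptimal.isCompetitive {n : ℕ} (hn : 1 ≤ n) {F : FinDist} {A : TestTree n}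
    (hA : A.IsOptimal F) : A.IsCompetitive (competitiveRatio n) F := by
  have h1 : 1 ≤ Nat.sqrt (Nat.sqrt n) := Nat.sqrt_pos.mpr (Nat.sqrt_pos.mpr hn)
  have h2 : Nat.sqrt (Nat.sqrt n) ^ 4 ≤ n := by
    calc Nat.sqrt (Nat.sqrt n) ^ 4 = (Nat.sqrt (Nat.sqrt n) ^ 2) ^ 2 := by ring
      _ ≤ (Nat.sqrt n) ^ 2 := Nat.pow_le_pow_left (Nat.sqrt_le' _) 2
      _ ≤ n := Nat.sqrt_le' n
  obtain ⟨B, hB, hBr⟩ := exists_ratio_mul_expectMax_le F hn h1 h2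
  exact hBr.trans (hA.reward_le hB)

/-! ### The first strict maximum of a list of options -/

/-- The maximum of `val` on `{0, …, k - 1}` and its first maximizer (`0` and `d` if no value is
positive). -/
def argmax (val : ℕ → ℕ) (d : ℕ) : ℕ → ℕ × ℕ
  | 0 => (0, d)
  | k + 1 => if (argmax val d k).1 < val k then (val k, k) else argmax val d k

theorem argmax_fst_succ (val : ℕ → ℕ) (d k : ℕ) :
    (argmax val d (k + 1)).1 = max (argmax val d k).1 (val k) := by
  rw [argmax]
  split_ifs with h
  · exact (max_eq_right h.le).symm
  · exact (max_eq_left (not_lt.mp h)).symm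

theorem le_argmax {val : ℕ → ℕ} {d k o : ℕ} (h : o < k) : val o ≤ (argmax val d k).1 := by
  induction k with
  | zero => omega
  | succ k ih =>
    rw [argmax_fst_succ]
    rcases Nat.lt_succ_iff_lt_or_eq.mp h with h | rfl
    · exact (ih h).trans (le_max_left _ _)
    · exact le_max_right _ _

theorem argmax_le {val : ℕ → ℕ} {d k b : ℕ} (h : ∀ o < k, val o ≤ b) :
    (argmax val d k).1 ≤ b := by
  induction k with
  | zero => exact Nat.zero_le _
  | succ k ih =>
    rw [argmax_fst_succ]
    exact max_le (ih fun o ho => h o (by omega)) (h k (by omega))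

theorem argmax_spec (val : ℕ → ℕ) (d k : ℕ) :
    ((argmax val d k).1 = 0 ∧ (argmax val d k).2 = d) ∨
      ((argmax val d k).2 < k ∧ (argmax val d k).1 = val (argmax val d k).2 ∧
        0 < (argmax val d k).1) := by
  induction k with
  | zero => exact Or.inl ⟨rfl, rfl⟩
  | succ k ih =>
    rw [argmax]
    split_ifs with h
    · exact Or.inr ⟨by simp, rfl, lt_of_le_of_lt (Nat.zero_le _) h⟩
    · rcases ih with ih | ih
      · exact Or.inl ih
      · exact Or.inr ⟨by omega, ih.2⟩

/-! ### The dynamic program -/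

/-- An instance with integral weights `p j` and values `v j`, for `j < m`. -/
structure Inst where
  n : ℕ
  m : ℕ
  p : ℕ → ℕ
  v : ℕ → ℕ

namespace Inst

variable (I : Inst)

/-- The code of the interval from the `l`-th to the `h`-th bound, where bound `j + 1` is the value
`v j` and bound `0` stands for no restriction. -/
def code (l h : ℕ) : ℕ := l * (I.m + 1) + h

/-- `v j` belongs to the interval with code `q`. -/
def InInterval (q j : ℕ) : Prop :=
  (q / (I.m + 1) = 0 ∨ I.v (q / (I.m + 1) - 1) ≤ I.v j) ∧
    (q % (I.m + 1) = 0 ∨ I.v j < I.v (q % (I.m + 1) - 1))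

instance (q j : ℕ) : Decidable (I.InInterval q j) := by unfold InInterval; infer_instance

/-- The weight of an interval. -/
def W (q : ℕ) : ℕ := ∑ j ∈ Finset.range I.m, if I.InInterval q j then I.p j else 0

/-- The weighted sum of the values in an interval. -/
def S (q : ℕ) : ℕ := ∑ j ∈ Finset.range I.m, if I.InInterval q j then I.p j * I.v j else 0

/-- As `S`, for the best one of the previous boxes; code `0` means that there is no such box. -/
def Sprev (q : ℕ) : ℕ := if q = 0 then 0 else I.S q

/-- The values of the options when no test is left: to choose the best previous box, the current
box, or the next box. -/
def finalVal (c qp qc o : ℕ) : ℕ :=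
  if o = 2 * I.m then I.Sprev qp * I.W qc * I.W 0
  else if o = 2 * I.m + 1 then I.S qc * I.W qp * I.W 0
  else if o = 2 * I.m + 2 ∧ c + 2 ≤ I.n then I.S 0 * I.W qp * I.W qc
  else 0

/-- The values of the options when tests are left: option `j < m` tests the current box for `v j`,
and option `m + j` tests the next box for `v j`. -/
def stepVal (u : ℕ → ℕ → ℕ → ℕ) (c qp qc o : ℕ) : ℕ :=
  if o < I.m then
    if I.InInterval qc o then
      I.W 0 * (u c qp (I.code (qc / (I.m + 1)) (o + 1)) + u c qp (I.code (o + 1) (qc % (I.m + 1))))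
    else 0
  else if o < 2 * I.m ∧ qc ≠ 0 ∧ I.W qc ≠ 0 ∧ c + 2 ≤ I.n then
    if I.Sprev qp * I.W qc ≤ I.S qc * I.W qp then
      I.W qp * (u (c + 1) qc (I.code 0 (o - I.m + 1)) + u (c + 1) qc (I.code (o - I.m + 1) 0))
    else
      I.W qc * (u (c + 1) qp (I.code 0 (o - I.m + 1)) + u (c + 1) qp (I.code (o - I.m + 1) 0))
  else 0

/-- Optimal value and option with `r` tests left, if box `c` is the current one, and `qp` and `qc`
are the intervals known for the best previous box and the current box. -/
def dp : ℕ → ℕ → ℕ → ℕ → ℕ × ℕ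
  | 0, c, qp, qc => argmax (I.finalVal c qp qc) (2 * I.m + 1) (2 * I.m + 3)
  | r + 1, c, qp, qc =>
    argmax (I.stepVal (fun c qp qc => (dp r c qp qc).1) c qp qc) (2 * I.m + 1) (2 * I.m + 3)

theorem W_le (q : ℕ) : I.W q ≤ I.W 0 := by
  refine Finset.sum_le_sum fun j _ => ?_
  have : I.InInterval 0 j := by simp [InInterval]
  rw [if_pos this]
  split_ifs <;> simp

theorem S_le (q : ℕ) : I.S q ≤ I.S 0 := by
  refine Finset.sum_le_sum fun j _ => ?_
  have : I.InInterval 0 j := by simp [InInterval]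
  rw [if_pos this]
  split_ifs <;> simp

theorem Sprev_le (q : ℕ) : I.Sprev q ≤ I.S 0 := by
  unfold Sprev
  split_ifs
  exacts [Nat.zero_le _, I.S_le q]

/-- A step of the recursion adds two values and multiplies by a weight, hence a factor `2 * W 0`.
The exponent `r` is at most the number of boxes, so the binary length remains polynomial. -/
theorem dp_fst_le (r : ℕ) : ∀ c qp qc,
    (I.dp r c qp qc).1 ≤ (2 * I.W 0) ^ r * (I.S 0 * I.W 0 * I.W 0) := by
  induction r with
  | zero =>
    intro c qp qc
    refine argmax_le fun o _ => ?_
    have h1 := I.W_le qp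
    have h2 := I.W_le qc
    have h3 := I.S_le qc
    have h4 := I.Sprev_le qp
    rw [pow_zero, one_mul]
    unfold finalVal
    split_ifs
    · gcongr
    · gcongr
    · gcongr
    · exact Nat.zero_le _
  | succ r ih =>
    intro c qp qc
    refine argmax_le fun o _ => ?_
    set b := (2 * I.W 0) ^ r * (I.S 0 * I.W 0 * I.W 0) with hb
    have hstep : ∀ w x y, w ≤ I.W 0 → x ≤ b → y ≤ b →
        w * (x + y) ≤ (2 * I.W 0) ^ (r + 1) * (I.S 0 * I.W 0 * I.W 0) := by
      intro w x y hw hx hy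
      calc w * (x + y) ≤ I.W 0 * (b + b) := by gcongr
        _ = _ := by rw [hb]; ring
    unfold stepVal
    split_ifs
    · exact hstep _ _ _ le_rfl (ih _ _ _) (ih _ _ _)
    · exact Nat.zero_le _
    · exact hstep _ _ _ (I.W_le _) (ih _ _ _) (ih _ _ _)
    · exact hstep _ _ _ (I.W_le _) (ih _ _ _) (ih _ _ _)
    · exact Nat.zero_le _

/-! ### The tree computed by the dynamic program -/

/-- The box with number `i`, reduced modulo `n`. -/
def box (hn : 0 < I.n) (i : ℕ) : Fin I.n := ⟨i % I.n, Nat.mod_lt _ hn⟩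

/-- The box chosen by option `o ≥ 2 * m`. -/
def finalBox (c β o : ℕ) : ℕ := if o = 2 * I.m then β else if o = 2 * I.m + 1 then c else c + 1

/-- The optimal tree; `β` is the best previous box. -/
def tree (hn : 0 < I.n) (val : Fin I.m → ℝ) : ℕ → ℕ → ℕ → ℕ → ℕ → TestTree I.n
  | 0, c, β, qp, qc => .choose (I.box hn (I.finalBox c β (I.dp 0 c qp qc).2))
  | r + 1, c, β, qp, qc =>
    if h : (I.dp (r + 1) c qp qc).2 < I.m then
      .test (I.box hn c) (val ⟨(I.dp (r + 1) c qp qc).2, h⟩)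
        (tree hn val r c β qp (I.code (qc / (I.m + 1)) ((I.dp (r + 1) c qp qc).2 + 1)))
        (tree hn val r c β qp (I.code ((I.dp (r + 1) c qp qc).2 + 1) (qc % (I.m + 1))))
    else if h : (I.dp (r + 1) c qp qc).2 - I.m < I.m then
      if I.Sprev qp * I.W qc ≤ I.S qc * I.W qp then
        .test (I.box hn (c + 1)) (val ⟨(I.dp (r + 1) c qp qc).2 - I.m, h⟩)
          (tree hn val r (c + 1) c qc (I.code 0 ((I.dp (r + 1) c qp qc).2 - I.m + 1)))
          (tree hn val r (c + 1) c qc (I.code ((I.dp (r + 1) c qp qc).2 - I.m + 1) 0))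
      else
        .test (I.box hn (c + 1)) (val ⟨(I.dp (r + 1) c qp qc).2 - I.m, h⟩)
          (tree hn val r (c + 1) β qp (I.code 0 ((I.dp (r + 1) c qp qc).2 - I.m + 1)))
          (tree hn val r (c + 1) β qp (I.code ((I.dp (r + 1) c qp qc).2 - I.m + 1) 0))
    else .choose (I.box hn (I.finalBox c β (I.dp (r + 1) c qp qc).2))

variable {I}

theorem box_eq (hn : 0 < I.n) {i : ℕ} (hi : i < I.n) : I.box hn i = ⟨i, hi⟩ :=
  Fin.ext (Nat.mod_eq_of_lt hi)

/-- Inadmissible options have value `0` and the search keeps strict improvements only. So a positive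
value comes from a legal test, and value `0` leaves the default option, the choice of the current
box. -/
theorem dp_spec (r c qp qc : ℕ) :
    ((I.dp (r + 1) c qp qc).1 = 0 ∧ (I.dp (r + 1) c qp qc).2 = 2 * I.m + 1) ∨
      (0 < (I.dp (r + 1) c qp qc).1 ∧ (I.dp (r + 1) c qp qc).2 < I.m ∧
        I.InInterval qc (I.dp (r + 1) c qp qc).2 ∧
        (I.dp (r + 1) c qp qc).1 = I.W 0 *
          ((I.dp r c qp (I.code (qc / (I.m + 1)) ((I.dp (r + 1) c qp qc).2 + 1))).1 +
          (I.dp r c qp (I.code ((I.dp (r + 1) c qp qc).2 + 1) (qc % (I.m + 1)))).1)) ∨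
      (0 < (I.dp (r + 1) c qp qc).1 ∧ ¬ (I.dp (r + 1) c qp qc).2 < I.m ∧
        (I.dp (r + 1) c qp qc).2 - I.m < I.m ∧ qc ≠ 0 ∧ I.W qc ≠ 0 ∧ c + 2 ≤ I.n ∧
        (I.dp (r + 1) c qp qc).1 = if I.Sprev qp * I.W qc ≤ I.S qc * I.W qp then
          I.W qp * ((I.dp r (c + 1) qc (I.code 0 ((I.dp (r + 1) c qp qc).2 - I.m + 1))).1 +
            (I.dp r (c + 1) qc (I.code ((I.dp (r + 1) c qp qc).2 - I.m + 1) 0)).1)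
        else
          I.W qc * ((I.dp r (c + 1) qp (I.code 0 ((I.dp (r + 1) c qp qc).2 - I.m + 1))).1 +
            (I.dp r (c + 1) qp (I.code ((I.dp (r + 1) c qp qc).2 - I.m + 1) 0)).1)) := by
  have h := argmax_spec (I.stepVal (fun c qp qc => (I.dp r c qp qc).1) c qp qc)
    (2 * I.m + 1) (2 * I.m + 3)
  rw [show argmax (I.stepVal (fun c qp qc => (I.dp r c qp qc).1) c qp qc) (2 * I.m + 1)
    (2 * I.m + 3) = I.dp (r + 1) c qp qc from rfl] at h
  rcases h with h | ⟨-, h2, h3⟩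
  · exact Or.inl h
  · right
    unfold stepVal at h2
    split_ifs at h2 with h4 h5 h6 h7
    · exact Or.inl ⟨h3, h4, h5, h2⟩
    · omega
    · exact Or.inr ⟨h3, h4, by omega, h6.2.1, h6.2.2.1, h6.2.2.2, by rw [if_pos h7]; exact h2⟩
    · exact Or.inr ⟨h3, h4, by omega, h6.2.1, h6.2.2.1, h6.2.2.2, by rw [if_neg h7]; exact h2⟩
    · omega

theorem tree_sequentialFrom (hn : 0 < I.n) (val : Fin I.m → ℝ) (r : ℕ) :
    ∀ c β qp qc, c < I.n → (I.tree hn val r c β qp qc).SequentialFrom (c + 1) ∧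
      (I.tree hn val r c β qp qc).numTests ≤ r := by
  induction r with
  | zero => intros; exact ⟨trivial, le_rfl⟩
  | succ r ih =>
    intro c β qp qc hc
    rw [tree]
    rcases dp_spec (I := I) r c qp qc with h | h | h
    · rw [dif_neg (by omega), dif_neg (by omega)]
      exact ⟨trivial, Nat.zero_le _⟩
    · rw [dif_pos h.2.1, box_eq hn hc]
      have h1 := ih c β qp (I.code (qc / (I.m + 1)) ((I.dp (r + 1) c qp qc).2 + 1)) hc
      have h2 := ih c β qp (I.code ((I.dp (r + 1) c qp qc).2 + 1) (qc % (I.m + 1))) hc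
      exact ⟨⟨Or.inl rfl, h1.1, h2.1⟩, Nat.succ_le_succ (max_le h1.2 h2.2)⟩
    · have hc' : c + 1 < I.n := by omega
      rw [dif_neg h.2.1, dif_pos h.2.2.1, box_eq hn hc']
      split_ifs
      all_goals
        exact ⟨⟨Or.inr rfl, (ih _ _ _ _ hc').1, (ih _ _ _ _ hc').1⟩,
          Nat.succ_le_succ (max_le (ih _ _ _ _ hc').2 (ih _ _ _ _ hc').2)⟩

/-- At the root the state already names box `0` as current although no box has been opened. The
guard `qc ≠ 0` rules out moving on, so a first test is of box `0`. -/
theorem tree_isSequentialAlgorithm (hn : 0 < I.n) (val : Fin I.m → ℝ) :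
    (I.tree hn val I.n 0 0 0 0).IsSequentialAlgorithm := by
  refine ⟨?_, (tree_sequentialFrom hn val I.n 0 0 0 0 hn).2⟩
  obtain ⟨r, hr⟩ : ∃ r, r + 1 = I.n := ⟨I.n - 1, by omega⟩
  suffices h : (I.tree hn val (r + 1) 0 0 0 0).SequentialFrom 0 by
    rwa [show I.tree hn val (r + 1) 0 0 0 0 = I.tree hn val I.n 0 0 0 0 by
      congr] at h
  rw [tree]
  rcases dp_spec (I := I) r 0 0 0 with h | h | h
  · rw [dif_neg (by omega), dif_neg (by omega)]
    trivial
  · rw [dif_pos h.2.1, box_eq hn hn]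
    exact ⟨Or.inr rfl, (tree_sequentialFrom hn val r _ _ _ _ hn).1,
      (tree_sequentialFrom hn val r _ _ _ _ hn).1⟩
  · exact absurd rfl h.2.2.2.1

/-! ### Optimality -/

/-- The weight of a box that is known to lie in the interval with code `q`. -/
noncomputable def weight (I : Inst) (q : ℕ) (j : Fin I.m) : ℝ :=
  if I.InInterval q j then (I.p j : ℝ) else 0

theorem weight_nonneg (q : ℕ) (j : Fin I.m) : 0 ≤ I.weight q j := by
  unfold weight
  split_ifs
  exacts [Nat.cast_nonneg _, le_rfl]

theorem sum_weight (q : ℕ) : ∑ j, I.weight q j = I.W q := by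
  rw [W, ← Fin.sum_univ_eq_sum_range (fun j => if I.InInterval q j then I.p j else 0)]
  push_cast
  rfl

theorem sum_weight_mul (q : ℕ) : ∑ j, I.weight q j * (I.v j : ℝ) = I.S q := by
  rw [S, ← Fin.sum_univ_eq_sum_range (fun j => if I.InInterval q j then I.p j * I.v j else 0)]
  push_cast
  refine Finset.sum_congr rfl fun j _ => ?_
  unfold weight
  split_ifs <;> simp

theorem code_div {l h : ℕ} (hh : h < I.m + 1) : I.code l h / (I.m + 1) = l := by
  rw [code, mul_comm, Nat.mul_add_div (Nat.succ_pos _), Nat.div_eq_of_lt hh, add_zero]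

theorem code_mod {l h : ℕ} (hh : h < I.m + 1) : I.code l h % (I.m + 1) = h := by
  rw [code, mul_comm, Nat.mul_add_mod, Nat.mod_eq_of_lt hh]

theorem code_ne_zero (l h : ℕ) : I.code (l + 1) h ≠ 0 := by
  have : 0 < (l + 1) * (I.m + 1) := by positivity
  unfold code
  omega

theorem inInterval_zero (j : ℕ) : I.InInterval 0 j := by simp [InInterval]

section

variable {val : Fin I.m → ℝ}

/-- As `v a` lies in the interval, it is a tighter upper bound than the old one and may replace it.
For a value outside, the old bound would be lost. -/
theorem weight_neg (hval : ∀ a j, val a ≤ val j ↔ I.v a ≤ I.v j)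
    {q : ℕ} {a : Fin I.m} (ha : I.InInterval q a) :
    (fun j => if val a ≤ val j then 0 else I.weight q j) =
      I.weight (I.code (q / (I.m + 1)) (a + 1)) := by
  funext j
  have ham := a.2
  have hiff : I.InInterval (I.code (q / (I.m + 1)) (a + 1)) j ↔
      (q / (I.m + 1) = 0 ∨ I.v (q / (I.m + 1) - 1) ≤ I.v j) ∧ I.v j < I.v a := by
    rw [InInterval, code_div (by omega), code_mod (by omega)]
    simp
  simp only [weight, hiff, hval]
  clear hiff
  split_ifs with h1 h2 h3 h3 <;> first | rfl | (exfalso; unfold InInterval at *; omega)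

theorem weight_pos (hval : ∀ a j, val a ≤ val j ↔ I.v a ≤ I.v j)
    {q : ℕ} {a : Fin I.m} (ha : I.InInterval q a) :
    (fun j => if val a ≤ val j then I.weight q j else 0) =
      I.weight (I.code (a + 1) (q % (I.m + 1))) := by
  funext j
  have hq : q % (I.m + 1) < I.m + 1 := Nat.mod_lt _ (Nat.succ_pos _)
  have hiff : I.InInterval (I.code (a + 1) (q % (I.m + 1))) j ↔
      I.v a ≤ I.v j ∧ (q % (I.m + 1) = 0 ∨ I.v j < I.v (q % (I.m + 1) - 1)) := by
    rw [InInterval, code_div hq, code_mod hq]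
    simp
  simp only [weight, hiff, hval]
  clear hiff
  split_ifs with h1 h2 h3 h3 <;> first | rfl | (exfalso; unfold InInterval at *; omega)

theorem wreward_test_val (hval : ∀ a j, val a ≤ val j ↔ I.v a ≤ I.v j)
    (g : Fin I.m → ℝ) {f : Fin I.n → Fin I.m → ℝ} {i : Fin I.n} {q : ℕ}
    (hf : f i = I.weight q) {a : Fin I.m} (ha : I.InInterval q a) (neg pos : TestTree I.n) :
    wreward val g f (.test i (val a) neg pos) =
      wreward val g (Function.update f i (I.weight (I.code (q / (I.m + 1)) (a + 1)))) neg +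
      wreward val g (Function.update f i (I.weight (I.code (a + 1) (q % (I.m + 1))))) pos := by
  rw [wreward_test, hf, weight_neg hval ha, weight_pos hval ha]

theorem wreward_test_self (g : Fin I.m → ℝ) (f : Fin I.n → Fin I.m → ℝ) (i : Fin I.n) (t : ℝ)
    (B : TestTree I.n) : wreward val g f (.test i t B B) = wreward val g f B := by
  unfold wreward
  refine Finset.sum_congr rfl fun x _ => ?_
  simp only [TestTree.select, ite_self]

/-- This pads trees that stop early, since the dynamic program has no choice option while tests are
left: a test with equal subtrees costs nothing. If the interval contains no value to test for, its
weight vanishes. -/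
theorem wreward_eq_zero_or_test_self (g : Fin I.m → ℝ) {f : Fin I.n → Fin I.m → ℝ} {i : Fin I.n}
    {q : ℕ} (hf : f i = I.weight q) (B : TestTree I.n) :
    wreward val g f B = 0 ∨ ∃ a : Fin I.m, I.InInterval q a ∧
      wreward val g f B = wreward val g f (.test i (val a) B B) := by
  by_cases h : ∃ a : Fin I.m, I.InInterval q a
  · obtain ⟨a, ha⟩ := h
    exact Or.inr ⟨a, ha, (wreward_test_self g f i _ B).symm⟩
  · push Not at h
    refine Or.inl (wreward_eq_zero (i := i) (fun j => ?_) B)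
    rw [hf, weight, if_neg (h j)]

/-- Every test may be replaced by one for a value in the interval. -/
theorem exists_wreward_eq_test_val (g : Fin I.m → ℝ) {f : Fin I.n → Fin I.m → ℝ} {i : Fin I.n}
    {q : ℕ} (hf : f i = I.weight q) (t : ℝ) (neg pos : TestTree I.n) :
    wreward val g f (.test i t neg pos) = 0 ∨ ∃ a : Fin I.m, I.InInterval q a ∧
      ∃ pos', (pos' = pos ∨ pos' = neg) ∧
        wreward val g f (.test i t neg pos) = wreward val g f (.test i (val a) neg pos') := by
  -- If no possible value passes `t`, the outcome is always negative and a vacuous test with `neg`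
  -- on both sides serves. Otherwise the least possible value that passes acts as `t` does.
  rcases (Finset.univ.filter fun j : Fin I.m => I.InInterval q j ∧ t ≤ val j).eq_empty_or_nonempty
    with h | h
  · have hall : ∀ j : Fin I.m, I.InInterval q j → ¬ t ≤ val j := fun j h1 h2 => by
      have : j ∈ Finset.univ.filter fun j : Fin I.m => I.InInterval q j ∧ t ≤ val j := by
        simp [h1, h2]
      rw [h] at this
      exact absurd this (Finset.notMem_empty j)
    have heq : wreward val g f (.test i t neg pos) = wreward val g f neg := by
      rw [wreward_test, wreward_eq_zero (i := i) (A := pos), add_zero]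
      · congr 1
        refine Function.update_eq_self_iff.mpr ?_
        funext j
        rw [hf, weight]
        by_cases h1 : I.InInterval q j
        · rw [if_neg (hall j h1)]
        · rw [if_neg h1, ite_self]
      · intro j
        rw [Function.update_self, hf, weight]
        by_cases h1 : I.InInterval q j
        · rw [if_neg (hall j h1)]
        · rw [if_neg h1, ite_self]
    rcases wreward_eq_zero_or_test_self g hf neg with h1 | ⟨a, ha, h1⟩
    · exact Or.inl (heq.trans h1)
    · exact Or.inr ⟨a, ha, neg, Or.inr rfl, heq.trans h1⟩
  · obtain ⟨a, ha, hmin⟩ := Finset.exists_min_image _ val h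
    simp only [Finset.mem_filter, Finset.mem_univ, true_and] at ha hmin
    refine Or.inr ⟨a, ha.1, pos, Or.inl rfl, ?_⟩
    have hiff : ∀ j : Fin I.m, I.InInterval q j → (t ≤ val j ↔ val a ≤ val j) := fun j hj =>
      ⟨fun h => hmin j ⟨hj, h⟩, fun h => ha.2.trans h⟩
    rw [wreward_test, wreward_test, hf]
    congr 3
    all_goals
      funext j
      rw [weight]
      by_cases h1 : I.InInterval q j
      · simp only [hiff j h1]
      · rw [if_neg h1, ite_self, ite_self]

end

/-! ### The dynamic program against arbitrary product weights. -/

/-- The total weight of the boxes before `c`. -/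
noncomputable def prevWeight (f : Fin I.n → Fin I.m → ℝ) (c : Fin I.n) : ℝ :=
  ∏ i ∈ Finset.Iio c, ∑ j, f i j

theorem prevWeight_nonneg {f : Fin I.n → Fin I.m → ℝ} (hf : ∀ i j, 0 ≤ f i j) (c : Fin I.n) :
    0 ≤ prevWeight f c :=
  Finset.prod_nonneg fun _ _ => Finset.sum_nonneg fun _ _ => hf _ _

theorem prevWeight_update (f : Fin I.n → Fin I.m → ℝ) {c i : Fin I.n} (h : c ≤ i)
    (w : Fin I.m → ℝ) : prevWeight (Function.update f i w) c = prevWeight f c :=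
  Finset.prod_congr rfl fun l hl => by
    rw [Function.update_of_ne (ne_of_lt (lt_of_lt_of_le (Finset.mem_Iio.mp hl) h))]

theorem prevWeight_succ (f : Fin I.n → Fin I.m → ℝ) {c : Fin I.n} (h : (c : ℕ) + 1 < I.n) :
    prevWeight f ⟨c + 1, h⟩ = prevWeight f c * ∑ j, f c j := by
  have : Finset.Iio (⟨c + 1, h⟩ : Fin I.n) = insert c (Finset.Iio c) := by
    ext i
    simp only [Finset.mem_Iio, Finset.mem_insert, Fin.lt_def, Fin.ext_iff]
    omega
  rw [prevWeight, this, Finset.prod_insert (by simp), mul_comm]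
  rfl

theorem prod_erase_eq {f : Fin I.n → Fin I.m → ℝ} {c : Fin I.n}
    (hf : ∀ i, c < i → f i = I.weight 0) :
    ∏ i ∈ Finset.univ.erase c, ∑ j, f i j = prevWeight f c * (I.W 0 : ℝ) ^ (I.n - 1 - c) := by
  have : Finset.univ.erase c = Finset.Iio c ∪ Finset.Ioi c := by
    ext i
    simp only [Finset.mem_erase, Finset.mem_univ, and_true, Finset.mem_union, Finset.mem_Iio,
      Finset.mem_Ioi]
    exact ne_iff_lt_or_gt
  rw [this, Finset.prod_union]
  · congr 1
    rw [Finset.prod_congr rfl (g := fun _ => (I.W 0 : ℝ)) (fun i hi => by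
      rw [hf i (Finset.mem_Ioi.mp hi), sum_weight]), Finset.prod_const, Fin.card_Ioi]
  · rw [Finset.disjoint_left]
    intro i h1 h2
    exact absurd (Finset.mem_Iio.mp h1) (not_lt.mpr (Finset.mem_Ioi.mp h2).le)

theorem prod_univ_eq {f : Fin I.n → Fin I.m → ℝ} {c : Fin I.n} {q : ℕ} (hc : f c = I.weight q)
    (hf : ∀ i, c < i → f i = I.weight 0) :
    ∏ i, ∑ j, f i j = I.W q * (prevWeight f c * (I.W 0 : ℝ) ^ (I.n - 1 - c)) := by
  rw [← Finset.mul_prod_erase _ _ (Finset.mem_univ c), prod_erase_eq hf, hc, sum_weight]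

/-- The payoff in terms of the integral values. -/
noncomputable def payoff (I : Inst) (j : Fin I.m) : ℝ := I.v j

theorem payoff_nonneg (j : Fin I.m) : 0 ≤ I.payoff j := Nat.cast_nonneg _

section Optimality

variable {val : Fin I.m → ℝ}

theorem update_nonneg {f : Fin I.n → Fin I.m → ℝ} (hf : ∀ i j, 0 ≤ f i j) (c : Fin I.n) (q : ℕ)
    (i : Fin I.n) (j : Fin I.m) : 0 ≤ Function.update f c (I.weight q) i j := by
  rcases eq_or_ne i c with rfl | h
  · rw [Function.update_self]; exact weight_nonneg q j
  · rw [Function.update_of_ne h]; exact hf i j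

/-- The upper bound on the reward that belongs to a state of the dynamic program. -/
def UpperBound (I : Inst) (val : Fin I.m → ℝ) (r : ℕ) (c : Fin I.n) (qp qc : ℕ) : Prop :=
  ∀ (f : Fin I.n → Fin I.m → ℝ) (B : TestTree I.n), B.SequentialFrom (c + 1) → B.numTests ≤ r →
    (∀ i j, 0 ≤ f i j) → f c = I.weight qc → (∀ i, c < i → f i = I.weight 0) →
    (∀ i, i < c → (∑ j, f i j * I.payoff j) * I.W qp ≤ I.Sprev qp * ∑ j, f i j) →
    wreward val I.payoff f B * (I.W qp * (I.W 0 : ℝ) ^ (r + 1)) ≤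
      (I.dp r c qp qc).1 * (prevWeight f c * (I.W 0 : ℝ) ^ (I.n - 1 - c))

/-- The outcomes of a retest split the weight of box `c` and leave the other factors alone, so the
bounds for the subtrees add up. The factor `W 0` in the recursion only keeps the normalization
uniform over both kinds of tests. -/
theorem retest_le (hval : ∀ a j, val a ≤ val j ↔ I.v a ≤ I.v j)
    {r : ℕ} {c : Fin I.n} {qp qc : ℕ}
    (ih : ∀ q, q ≠ 0 → UpperBound I val r c qp q)
    {f : Fin I.n → Fin I.m → ℝ} {a : Fin I.m} (ha : I.InInterval qc a) {neg pos : TestTree I.n}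
    (hneg : neg.SequentialFrom (c + 1)) (hpos : pos.SequentialFrom (c + 1))
    (hnegr : neg.numTests ≤ r) (hposr : pos.numTests ≤ r) (hf0 : ∀ i j, 0 ≤ f i j)
    (hc : f c = I.weight qc) (hf : ∀ i, c < i → f i = I.weight 0)
    (hprev : ∀ i, i < c → (∑ j, f i j * I.payoff j) * I.W qp ≤ I.Sprev qp * ∑ j, f i j) :
    wreward val I.payoff f (.test c (val a) neg pos) * (I.W qp * (I.W 0 : ℝ) ^ (r + 2)) ≤
      (I.dp (r + 1) c qp qc).1 * (prevWeight f c * (I.W 0 : ℝ) ^ (I.n - 1 - c)) := by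
  have ham := a.2
  have key : ∀ q B, q ≠ 0 → B.SequentialFrom (c + 1) → B.numTests ≤ r →
      wreward val I.payoff (Function.update f c (I.weight q)) B *
        (I.W qp * (I.W 0 : ℝ) ^ (r + 1)) ≤
      (I.dp r c qp q).1 * (prevWeight f c * (I.W 0 : ℝ) ^ (I.n - 1 - c)) := by
    intro q B hq hB hBr
    have := ih q hq (Function.update f c (I.weight q)) B hB hBr (update_nonneg hf0 c q)
      (Function.update_self ..) (fun i hi => by rw [Function.update_of_ne hi.ne']; exact hf i hi)
      (fun i hi => by rw [Function.update_of_ne hi.ne]; exact hprev i hi)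
    rwa [prevWeight_update f le_rfl] at this
  have h1 := key (I.code (qc / (I.m + 1)) (a + 1)) neg (by unfold code; omega) hneg hnegr
  have h2 := key (I.code (a + 1) (qc % (I.m + 1))) pos
    (code_ne_zero _ _) hpos hposr
  have h3 : I.W 0 * ((I.dp r c qp (I.code (qc / (I.m + 1)) (a + 1))).1 +
      (I.dp r c qp (I.code (a + 1) (qc % (I.m + 1)))).1) ≤ (I.dp (r + 1) c qp qc).1 := by
    have := le_argmax (val := I.stepVal (fun c qp qc => (I.dp r c qp qc).1) c qp qc)
      (d := 2 * I.m + 1) (k := 2 * I.m + 3) (o := a) (by omega)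
    rwa [stepVal, if_pos ham, if_pos ha, ← dp] at this
  have h3' : (I.W 0 : ℝ) * ((I.dp r c qp (I.code (qc / (I.m + 1)) (a + 1))).1 +
      (I.dp r c qp (I.code (a + 1) (qc % (I.m + 1)))).1) ≤ (I.dp (r + 1) c qp qc).1 := by
    exact_mod_cast h3
  rw [wreward_test_val hval I.payoff hc ha]
  have hP : 0 ≤ prevWeight f c * (I.W 0 : ℝ) ^ (I.n - 1 - c) :=
    mul_nonneg (prevWeight_nonneg hf0 c) (by positivity)
  refine le_trans ?_ (mul_le_mul_of_nonneg_right h3' hP)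
  have hW : (0 : ℝ) ≤ I.W 0 := Nat.cast_nonneg _
  have := mul_le_mul_of_nonneg_left (add_le_add h1 h2) hW
  calc _ = (I.W 0 : ℝ) * (wreward val I.payoff (Function.update f c
        (I.weight (I.code (qc / (I.m + 1)) (a + 1)))) neg * (I.W qp * (I.W 0 : ℝ) ^ (r + 1)) +
      wreward val I.payoff (Function.update f c
        (I.weight (I.code (a + 1) (qc % (I.m + 1))))) pos * (I.W qp * (I.W 0 : ℝ) ^ (r + 1))) := by
        ring
    _ ≤ _ := this
    _ = _ := by ring

/-- After the move, box `c` joins the previous boxes, and only the larger of its conditional mean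
and that of the old best one has to be remembered. Means are compared after cross-multiplication. -/
theorem move_le (hval : ∀ a j, val a ≤ val j ↔ I.v a ≤ I.v j)
    {r : ℕ} {c : Fin I.n} (hcn : (c : ℕ) + 1 < I.n) {qp qc : ℕ} (hqc : qc ≠ 0)
    (ih : ∀ qp q, q ≠ 0 → UpperBound I val r ⟨c + 1, hcn⟩ qp q)
    {f : Fin I.n → Fin I.m → ℝ} (a : Fin I.m) {neg pos : TestTree I.n}
    (hneg : neg.SequentialFrom (c + 2)) (hpos : pos.SequentialFrom (c + 2))
    (hnegr : neg.numTests ≤ r) (hposr : pos.numTests ≤ r) (hf0 : ∀ i j, 0 ≤ f i j)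
    (hc : f c = I.weight qc) (hf : ∀ i, c < i → f i = I.weight 0)
    (hprev : ∀ i, i < c → (∑ j, f i j * I.payoff j) * I.W qp ≤ I.Sprev qp * ∑ j, f i j) :
    wreward val I.payoff f (.test ⟨c + 1, hcn⟩ (val a) neg pos) *
        (I.W qp * (I.W 0 : ℝ) ^ (r + 2)) ≤
      (I.dp (r + 1) c qp qc).1 * (prevWeight f c * (I.W 0 : ℝ) ^ (I.n - 1 - c)) := by
  have ham := a.2
  have hP : 0 ≤ prevWeight f c * (I.W 0 : ℝ) ^ (I.n - 1 - c) :=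
    mul_nonneg (prevWeight_nonneg hf0 c) (by positivity)
  -- The recursion closes the option of moving on from a null interval, but then the reward is zero
  -- as well.
  rcases Nat.eq_zero_or_pos (I.W qc) with hWc | hWc
  · rw [wreward_eq_zero (i := c), zero_mul]
    · exact mul_nonneg (Nat.cast_nonneg _) hP
    · have h := sum_weight (I := I) qc
      rw [hWc, Nat.cast_zero, Finset.sum_eq_zero_iff_of_nonneg fun j _ => weight_nonneg qc j] at h
      exact fun j => by rw [hc]; exact h j (Finset.mem_univ j)
  rcases Nat.eq_zero_or_pos (I.W qp) with hWp | hWp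
  · rw [hWp, Nat.cast_zero, zero_mul, mul_zero]
    exact mul_nonneg (Nat.cast_nonneg _) hP
  have hWc' : (0 : ℝ) < I.W qc := by exact_mod_cast hWc
  have hWp' : (0 : ℝ) < I.W qp := by exact_mod_cast hWp
  have hW : (0 : ℝ) ≤ I.W 0 := Nat.cast_nonneg _
  have hclt : c < (⟨c + 1, hcn⟩ : Fin I.n) := Fin.lt_def.mpr (Nat.lt_succ_self _)
  have key : ∀ q' q B, q ≠ 0 → B.SequentialFrom (c + 2) → B.numTests ≤ r →
      (∀ i, i ≤ c → (∑ j, f i j * I.payoff j) * I.W q' ≤ I.Sprev q' * ∑ j, f i j) →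
      wreward val I.payoff (Function.update f ⟨c + 1, hcn⟩ (I.weight q)) B *
        (I.W q' * (I.W 0 : ℝ) ^ (r + 1)) ≤
      (I.dp r (c + 1) q' q).1 *
        (prevWeight f c * I.W qc * (I.W 0 : ℝ) ^ (I.n - 1 - (c + 1))) := by
    intro q' q B hq hB hBr hpr
    have := ih q' q hq (Function.update f ⟨c + 1, hcn⟩ (I.weight q)) B hB hBr
      (update_nonneg hf0 _ q)
      (Function.update_self ..) (fun i hi => by
        rw [Function.update_of_ne hi.ne']; exact hf i (hclt.trans hi))
      (fun i hi => by
        rw [Function.update_of_ne hi.ne]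
        exact hpr i (Fin.le_def.mpr (Nat.lt_succ_iff.mp (Fin.lt_def.mp hi))))
    rwa [prevWeight_update f le_rfl, prevWeight_succ, hc, sum_weight] at this
  have h3 := le_argmax (val := I.stepVal (fun c qp qc => (I.dp r c qp qc).1) c qp qc)
      (d := 2 * I.m + 1) (k := 2 * I.m + 3) (o := I.m + a) (by omega)
  rw [show argmax (I.stepVal (fun c qp qc => (I.dp r c qp qc).1) c qp qc) (2 * I.m + 1)
    (2 * I.m + 3) = I.dp (r + 1) c qp qc from rfl] at h3
  rw [stepVal, if_neg (by omega), if_pos ⟨by omega, hqc, hWc.ne', by omega⟩,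
    Nat.add_sub_cancel_left] at h3
  have hpow : (I.W 0 : ℝ) ^ (I.n - 1 - c) = I.W 0 * (I.W 0 : ℝ) ^ (I.n - 1 - (c + 1)) := by
    rw [← pow_succ']; congr 1; omega
  have hfull : f ⟨c + 1, hcn⟩ = I.weight 0 := hf _ hclt
  rw [wreward_test_val hval I.payoff hfull (inInterval_zero a), Nat.zero_div, Nat.zero_mod]
  have hcode1 : I.code 0 (a + 1) ≠ 0 := by unfold code; omega
  have hcode2 : I.code (a + 1) 0 ≠ 0 := code_ne_zero _ _
  have hScur : I.Sprev qc = I.S qc := if_neg hqc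
  have hpay : ∑ j, f c j * I.payoff j = I.S qc := by rw [hc]; exact sum_weight_mul qc
  have hwc : ∑ j, f c j = I.W qc := by rw [hc]; exact sum_weight qc
  split_ifs at h3 with hbet
  · have hbet' : (I.Sprev qp : ℝ) * I.W qc ≤ I.S qc * I.W qp := by exact_mod_cast hbet
    have hpr : ∀ i, i ≤ c → (∑ j, f i j * I.payoff j) * I.W qc ≤ I.Sprev qc * ∑ j, f i j := by
      intro i hi
      rw [hScur]
      rcases eq_or_lt_of_le hi with rfl | hi
      · rw [hpay, hwc]
      · have hwi : 0 ≤ ∑ j, f i j := Finset.sum_nonneg fun j _ => hf0 i j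
        refine le_of_mul_le_mul_right ?_ hWp'
        calc _ = (∑ j, f i j * I.payoff j) * I.W qp * I.W qc := by ring
          _ ≤ (I.Sprev qp * ∑ j, f i j) * I.W qc := by
              have := hprev i hi
              gcongr
          _ = (I.Sprev qp * I.W qc) * ∑ j, f i j := by ring
          _ ≤ (I.S qc * I.W qp) * ∑ j, f i j := by gcongr
          _ = _ := by ring
    have h1 := key qc (I.code 0 (a + 1)) neg hcode1 hneg hnegr hpr
    have h2 := key qc (I.code (a + 1) 0) pos hcode2 hpos hposr hpr
    have h3' : (I.W qp : ℝ) * ((I.dp r (c + 1) qc (I.code 0 (a + 1))).1 +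
      (I.dp r (c + 1) qc (I.code (a + 1) 0)).1) ≤ (I.dp (r + 1) c qp qc).1 := by
      exact_mod_cast h3
    refine le_trans ?_ (mul_le_mul_of_nonneg_right h3' hP)
    -- The successor states are normalized by `W qc` in place of `W qp`, so both sides carry an
    -- extra factor `W qc`.
    refine le_of_mul_le_mul_left ?_ hWc'
    have := mul_le_mul_of_nonneg_left (add_le_add h1 h2)
      (mul_nonneg hWp'.le hW)
    rw [hpow]
    refine le_trans (le_of_eq ?_) (this.trans (le_of_eq ?_))
    · ring
    · ring
  · have hbet' : (I.S qc : ℝ) * I.W qp ≤ I.Sprev qp * I.W qc := by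
      exact_mod_cast (not_le.mp hbet).le
    have hpr : ∀ i, i ≤ c → (∑ j, f i j * I.payoff j) * I.W qp ≤ I.Sprev qp * ∑ j, f i j := by
      intro i hi
      rcases eq_or_lt_of_le hi with rfl | hi
      · rw [hpay, hwc]; exact hbet'
      · exact hprev i hi
    have h1 := key qp (I.code 0 (a + 1)) neg hcode1 hneg hnegr hpr
    have h2 := key qp (I.code (a + 1) 0) pos hcode2 hpos hposr hpr
    have h3' : (I.W qc : ℝ) * ((I.dp r (c + 1) qp (I.code 0 (a + 1))).1 +
      (I.dp r (c + 1) qp (I.code (a + 1) 0)).1) ≤ (I.dp (r + 1) c qp qc).1 := by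
      exact_mod_cast h3
    refine le_trans ?_ (mul_le_mul_of_nonneg_right h3' hP)
    have := mul_le_mul_of_nonneg_left (add_le_add h1 h2) hW
    rw [hpow]
    refine le_trans (le_of_eq ?_) (this.trans (le_of_eq ?_))
    · ring
    · ring

/-- A previous box is bounded by the best one through `hprev`, and the current box is computed
exactly. All later boxes are untouched and equally good, so the next one stands for all of them. -/
theorem choose_le {c : Fin I.n} {qp qc : ℕ}
    {f : Fin I.n → Fin I.m → ℝ} (i : Fin I.n) (hf0 : ∀ i j, 0 ≤ f i j)
    (hc : f c = I.weight qc) (hf : ∀ i, c < i → f i = I.weight 0)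
    (hprev : ∀ i, i < c → (∑ j, f i j * I.payoff j) * I.W qp ≤ I.Sprev qp * ∑ j, f i j) :
    wreward val I.payoff f (.choose i) * (I.W qp * (I.W 0 : ℝ) ^ (0 + 1)) ≤
      (I.dp 0 c qp qc).1 * (prevWeight f c * (I.W 0 : ℝ) ^ (I.n - 1 - c)) := by
  have hP : 0 ≤ prevWeight f c * (I.W 0 : ℝ) ^ (I.n - 1 - c) :=
    mul_nonneg (prevWeight_nonneg hf0 c) (by positivity)
  have hle : ∀ o < 2 * I.m + 3, (I.finalVal c qp qc o : ℝ) ≤ (I.dp 0 c qp qc).1 := fun o ho => by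
    exact_mod_cast le_argmax ho
  have hall := prod_univ_eq hc hf
  rw [wreward_choose, zero_add, pow_one]
  have herase : 0 ≤ ∏ l ∈ Finset.univ.erase i, ∑ j, f l j :=
    Finset.prod_nonneg fun l _ => Finset.sum_nonneg fun j _ => hf0 l j
  rw [← Finset.mul_prod_erase _ _ (Finset.mem_univ i)] at hall
  rcases lt_trichotomy i c with hi | rfl | hi
  · refine le_trans ?_ (mul_le_mul_of_nonneg_right (hle (2 * I.m) (by omega)) hP)
    rw [finalVal, if_pos rfl]
    push_cast
    have h1 := hprev i hi
    calc _ = ((∑ j, f i j * I.payoff j) * I.W qp) * ((∏ l ∈ Finset.univ.erase i, ∑ j, f l j) *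
          I.W 0) := by ring
      _ ≤ (I.Sprev qp * ∑ j, f i j) * ((∏ l ∈ Finset.univ.erase i, ∑ j, f l j) * I.W 0) := by
          gcongr
      _ = I.Sprev qp * I.W 0 * ((∑ j, f i j) * ∏ l ∈ Finset.univ.erase i, ∑ j, f l j) := by ring
      _ = _ := by rw [hall]; ring
  · refine le_trans ?_ (mul_le_mul_of_nonneg_right (hle (2 * I.m + 1) (by omega)) hP)
    rw [finalVal, if_neg (by omega), if_pos rfl]
    push_cast
    rw [prod_erase_eq hf, hc]
    have : ∑ j, I.weight qc j * I.payoff j = I.S qc := sum_weight_mul qc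
    rw [this]
    exact le_of_eq (by ring)
  · refine le_trans ?_ (mul_le_mul_of_nonneg_right (hle (2 * I.m + 2) (by omega)) hP)
    have hin := i.2
    have hi' := Fin.lt_def.mp hi
    rw [finalVal, if_neg (by omega), if_neg (by omega), if_pos ⟨rfl, by omega⟩]
    push_cast
    rw [hf i hi, sum_weight] at hall
    have : ∑ j, f i j * I.payoff j = I.S 0 := by rw [hf i hi]; exact sum_weight_mul 0
    rw [this]
    calc _ = I.S 0 * I.W qp * (I.W 0 * ∏ l ∈ Finset.univ.erase i, ∑ j, f l j) := by ring
      _ ≤ _ := le_of_eq (by rw [hall]; ring)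

theorem upperBound (hval : ∀ a j, val a ≤ val j ↔ I.v a ≤ I.v j)
    (r : ℕ) : ∀ (c : Fin I.n) (qp qc : ℕ), qc ≠ 0 →
    UpperBound I val r c qp qc := by
  induction r with
  | zero =>
    intro c qp qc _ f B _ hBr hf0 hc hf hprev
    cases B with
    | choose i => exact choose_le i hf0 hc hf hprev
    | test => simp [TestTree.numTests] at hBr
  | succ r ih =>
    intro c qp qc hqc f B hB hBr hf0 hc hf hprev
    have hzero : wreward val I.payoff f B = 0 →
        wreward val I.payoff f B * (I.W qp * (I.W 0 : ℝ) ^ (r + 1 + 1)) ≤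
        (I.dp (r + 1) c qp qc).1 * (prevWeight f c * (I.W 0 : ℝ) ^ (I.n - 1 - c)) := by
      intro h
      rw [h, zero_mul]
      exact mul_nonneg (Nat.cast_nonneg _)
        (mul_nonneg (prevWeight_nonneg hf0 c) (by positivity))
    cases B with
    | choose i =>
      rcases wreward_eq_zero_or_test_self I.payoff hc (.choose i) with h | ⟨a, ha, h⟩
      · exact hzero h
      · rw [h]
        exact retest_le hval (ih c qp) ha trivial trivial (Nat.zero_le _) (Nat.zero_le _) hf0 hc hf
          hprev
    | test i t neg pos =>
      obtain ⟨hi, hneg, hpos⟩ := hB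
      simp only [TestTree.numTests, add_le_add_iff_right, max_le_iff] at hBr
      rcases hi with hi | hi
      · obtain rfl : i = c := Fin.ext (by omega)
        rcases exists_wreward_eq_test_val I.payoff hc t neg pos with h | ⟨a, ha, pos', hp, h⟩
        · exact hzero h
        · rw [h]
          have hp' : pos'.SequentialFrom (i + 1) ∧ pos'.numTests ≤ r := by
            rcases hp with rfl | rfl
            exacts [⟨hpos, hBr.2⟩, ⟨hneg, hBr.1⟩]
          exact retest_le hval (ih i qp) ha hneg hp'.1 hBr.1 hp'.2 hf0 hc hf hprev
      · have hcn : (c : ℕ) + 1 < I.n := hi ▸ i.2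
        obtain rfl : i = ⟨c + 1, hcn⟩ := Fin.ext hi
        have hfull := hf ⟨c + 1, hcn⟩ (Fin.lt_def.mpr (Nat.lt_succ_self _))
        rcases exists_wreward_eq_test_val I.payoff hfull t neg pos with h | ⟨a, ha, pos', hp, h⟩
        · exact hzero h
        · rw [h]
          have hp' : pos'.SequentialFrom (c + 2) ∧ pos'.numTests ≤ r := by
            rcases hp with rfl | rfl
            exacts [⟨hpos, hBr.2⟩, ⟨hneg, hBr.1⟩]
          exact move_le hval hcn hqc (ih _) a hneg hp'.1 hBr.1 hp'.2 hf0 hc hf hprev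

/-- The tree computed by the dynamic program attains the upper bound. -/
theorem dp_le_wreward_tree (hval : ∀ a j, val a ≤ val j ↔ I.v a ≤ I.v j)
    (hn : 0 < I.n) (r : ℕ) : ∀ (c : Fin I.n) (β qp qc : ℕ)
    (f : Fin I.n → Fin I.m → ℝ), (∀ i j, 0 ≤ f i j) → f c = I.weight qc →
    (∀ i, c < i → f i = I.weight 0) → 0 < I.W qp →
    (qp ≠ 0 → ∃ h : β < I.n, (⟨β, h⟩ : Fin I.n) < c ∧ f ⟨β, h⟩ = I.weight qp) →
    (I.dp r c qp qc).1 * (prevWeight f c * (I.W 0 : ℝ) ^ (I.n - 1 - c)) ≤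
      wreward val I.payoff f (I.tree hn val r c β qp qc) * (I.W qp * (I.W 0 : ℝ) ^ (r + 1)) := by
  induction r with
  | zero =>
    intro c β qp qc f hf0 hc hf hWp hβ
    rw [tree, zero_add, pow_one]
    have hR : ∀ B, 0 ≤ wreward val I.payoff f B := wreward_nonneg payoff_nonneg hf0
    have hW : (0 : ℝ) ≤ I.W 0 := Nat.cast_nonneg _
    have h := argmax_spec (I.finalVal c qp qc) (2 * I.m + 1) (2 * I.m + 3)
    rw [← dp] at h
    rcases h with h | ⟨-, h2, h3⟩
    · rw [h.1, Nat.cast_zero, zero_mul]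
      exact mul_nonneg (hR _) (by positivity)
    · rw [h2] at h3 ⊢
      generalize (I.dp 0 c qp qc).2 = o at h3 ⊢
      have hall := prod_univ_eq hc hf
      unfold finalVal at h3 ⊢
      split_ifs at h3 ⊢ with h4 h5 h6
      -- A positive value proves that a previous box exists, because `Sprev` vanishes at the code
      -- for none.
      · have hqp : qp ≠ 0 := by
          rintro rfl
          simp [Sprev] at h3
        obtain ⟨hβn, hβc, hβf⟩ := hβ hqp
        rw [finalBox, if_pos h4, box_eq hn hβn, wreward_choose]
        rw [← Finset.mul_prod_erase _ _ (Finset.mem_univ ⟨β, hβn⟩), hβf, sum_weight] at hall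
        have : ∑ j, f ⟨β, hβn⟩ j * I.payoff j = I.Sprev qp := by
          rw [hβf, Sprev, if_neg hqp]; exact sum_weight_mul qp
        rw [this]
        push_cast
        calc _ = I.Sprev qp * I.W 0 *
              (I.W qc * (prevWeight f c * (I.W 0 : ℝ) ^ (I.n - 1 - c))) := by ring
          _ ≤ _ := le_of_eq (by rw [← hall]; ring)
      · rw [finalBox, if_neg h4, if_pos h5, box_eq hn c.2, wreward_choose, prod_erase_eq hf, hc]
        have : ∑ j, I.weight qc j * I.payoff j = I.S qc := sum_weight_mul qc
        rw [this]
        push_cast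
        exact le_of_eq (by ring)
      · have hcn : (c : ℕ) + 1 < I.n := by omega
        rw [finalBox, if_neg h4, if_neg h5, box_eq hn hcn, wreward_choose]
        have hfull := hf ⟨c + 1, hcn⟩ (Fin.lt_def.mpr (Nat.lt_succ_self _))
        rw [← Finset.mul_prod_erase _ _ (Finset.mem_univ ⟨c + 1, hcn⟩), hfull, sum_weight] at hall
        have : ∑ j, f ⟨c + 1, hcn⟩ j * I.payoff j = I.S 0 := by
          rw [hfull]; exact sum_weight_mul 0
        rw [this]
        push_cast
        calc _ = I.S 0 * I.W qp *
              (I.W qc * (prevWeight f c * (I.W 0 : ℝ) ^ (I.n - 1 - c))) := by ring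
          _ ≤ _ := le_of_eq (by rw [← hall]; ring)
      · omega
  | succ r ih =>
    intro c β qp qc f hf0 hc hf hWp hβ
    rw [tree]
    have hR : ∀ B, 0 ≤ wreward val I.payoff f B := wreward_nonneg payoff_nonneg hf0
    have hW : (0 : ℝ) ≤ I.W 0 := Nat.cast_nonneg _
    rcases dp_spec (I := I) r c qp qc with h | ⟨-, h1, h2, h3⟩ | ⟨-, h1, h2, h3, h4, h5, h6⟩
    · rw [h.1, Nat.cast_zero, zero_mul]
      exact mul_nonneg (hR _) (by positivity)
    · rw [dif_pos h1, box_eq hn c.2, wreward_test_val hval I.payoff hc (a := ⟨_, h1⟩) h2, h3]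
      generalize (I.dp (r + 1) c qp qc).2 = o at h1
      have key : ∀ q, (I.dp r c qp q).1 * (prevWeight f c * (I.W 0 : ℝ) ^ (I.n - 1 - c)) ≤
          wreward val I.payoff (Function.update f c (I.weight q)) (I.tree hn val r c β qp q) *
            (I.W qp * (I.W 0 : ℝ) ^ (r + 1)) := by
        intro q
        have := ih c β qp q (Function.update f c (I.weight q)) (update_nonneg hf0 c q)
          (Function.update_self ..)
          (fun i hi => by rw [Function.update_of_ne hi.ne']; exact hf i hi) hWp
          (fun hq => by
            obtain ⟨hβn, hβc, hβf⟩ := hβ hq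
            exact ⟨hβn, hβc, by rw [Function.update_of_ne hβc.ne]; exact hβf⟩)
        rwa [prevWeight_update f le_rfl] at this
      have e := mul_le_mul_of_nonneg_left (add_le_add (key (I.code (qc / (I.m + 1)) (o + 1)))
        (key (I.code (o + 1) (qc % (I.m + 1))))) hW
      push_cast
      refine le_trans (le_of_eq ?_) (e.trans (le_of_eq ?_))
      · ring
      · ring
    · have hcn : (c : ℕ) + 1 < I.n := by omega
      have hclt : c < (⟨c + 1, hcn⟩ : Fin I.n) := Fin.lt_def.mpr (Nat.lt_succ_self _)
      have hfull := hf ⟨c + 1, hcn⟩ hclt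
      have hWc : 0 < I.W qc := Nat.pos_of_ne_zero h4
      have hWc' : (0 : ℝ) < I.W qc := by exact_mod_cast hWc
      have hpow : (I.W 0 : ℝ) ^ (I.n - 1 - c) = I.W 0 * (I.W 0 : ℝ) ^ (I.n - 1 - (c + 1)) := by
        rw [← pow_succ']; congr 1; omega
      rw [dif_neg h1, dif_pos h2, box_eq hn hcn, h6, hpow]
      generalize hj : (I.dp (r + 1) c qp qc).2 - I.m = j at h2
      have key : ∀ β' q' q, 0 < I.W q' →
          (q' ≠ 0 → ∃ h : β' < I.n, (⟨β', h⟩ : Fin I.n) < ⟨c + 1, hcn⟩ ∧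
            f ⟨β', h⟩ = I.weight q') →
          (I.dp r (c + 1) q' q).1 *
              (prevWeight f c * I.W qc * (I.W 0 : ℝ) ^ (I.n - 1 - (c + 1))) ≤
            wreward val I.payoff (Function.update f ⟨c + 1, hcn⟩ (I.weight q))
              (I.tree hn val r (c + 1) β' q' q) * (I.W q' * (I.W 0 : ℝ) ^ (r + 1)) := by
        intro β' q' q hWq hβ'
        have := ih ⟨c + 1, hcn⟩ β' q' q (Function.update f ⟨c + 1, hcn⟩ (I.weight q))
          (update_nonneg hf0 _ q) (Function.update_self ..)
          (fun i hi => by rw [Function.update_of_ne hi.ne']; exact hf i (hclt.trans hi)) hWq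
          (fun hq => by
            obtain ⟨hβn, hβc, hβf⟩ := hβ' hq
            exact ⟨hβn, hβc, by rw [Function.update_of_ne hβc.ne]; exact hβf⟩)
        rwa [prevWeight_update f le_rfl, prevWeight_succ, hc, sum_weight] at this
      split_ifs with hbet
      · rw [wreward_test_val hval I.payoff hfull (inInterval_zero _), Nat.zero_div, Nat.zero_mod]
        have hcc : qc ≠ 0 → ∃ h : (c : ℕ) < I.n, (⟨c, h⟩ : Fin I.n) < ⟨c + 1, hcn⟩ ∧
            f ⟨c, h⟩ = I.weight qc := fun _ => ⟨c.2, hclt, hc⟩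
        have e := mul_le_mul_of_nonneg_left (add_le_add (key c qc (I.code 0 (j + 1)) hWc hcc)
          (key c qc (I.code (j + 1) 0) hWc hcc)) (mul_nonneg (Nat.cast_nonneg (I.W qp)) hW)
        push_cast
        refine le_of_mul_le_mul_left ?_ hWc'
        refine le_trans (le_of_eq ?_) (e.trans (le_of_eq ?_))
        · ring
        · ring
      · rw [wreward_test_val hval I.payoff hfull (inInterval_zero _), Nat.zero_div, Nat.zero_mod]
        have hcc : qp ≠ 0 → ∃ h : β < I.n, (⟨β, h⟩ : Fin I.n) < ⟨c + 1, hcn⟩ ∧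
            f ⟨β, h⟩ = I.weight qp := fun hq => by
          obtain ⟨hβn, hβc, hβf⟩ := hβ hq
          exact ⟨hβn, hβc.trans hclt, hβf⟩
        have e := mul_le_mul_of_nonneg_left (add_le_add (key β qp (I.code 0 (j + 1)) hWp hcc)
          (key β qp (I.code (j + 1) 0) hWp hcc)) hW
        push_cast
        refine le_trans (le_of_eq ?_) (e.trans (le_of_eq ?_))
        · ring
        · ring

/-- The root has `qc = 0`, which `upperBound` excludes. But a sequential algorithm must start with
box `0`, so one application of `retest_le` leads to states with nonzero codes. -/
theorem wreward_le_wreward_tree (hval : ∀ a j, val a ≤ val j ↔ I.v a ≤ I.v j)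
    (hn : 0 < I.n) (hE : 0 < I.W 0) {B : TestTree I.n}
    (hB : B.IsSequentialAlgorithm) :
    wreward val I.payoff (fun _ => I.weight 0) B ≤
      wreward val I.payoff (fun _ => I.weight 0) (I.tree hn val I.n 0 0 0 0) := by
  set f : Fin I.n → Fin I.m → ℝ := fun _ => I.weight 0 with hf
  have hf0 : ∀ i j, 0 ≤ f i j := fun _ j => weight_nonneg 0 j
  have hE' : (0 : ℝ) < I.W 0 := by exact_mod_cast hE
  have hlow := dp_le_wreward_tree hval hn I.n ⟨0, hn⟩ 0 0 0 f hf0 rfl (fun _ _ => rfl) hE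
    (fun h => absurd rfl h)
  have hprev : ∀ i : Fin I.n, i < ⟨0, hn⟩ →
      (∑ j, f i j * I.payoff j) * I.W 0 ≤ I.Sprev 0 * ∑ j, f i j := fun i hi =>
    absurd (Fin.lt_def.mp hi) (Nat.not_lt_zero _)
  refine le_of_mul_le_mul_right (le_trans ?_ hlow)
    (by positivity : (0 : ℝ) < I.W 0 * (I.W 0 : ℝ) ^ (I.n + 1))
  obtain ⟨r, hr⟩ := Nat.exists_eq_succ_of_ne_zero hn.ne'
  have hzero : wreward val I.payoff f B = 0 →
      wreward val I.payoff f B * (I.W 0 * (I.W 0 : ℝ) ^ (I.n + 1)) ≤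
      (I.dp I.n 0 0 0).1 *
        (prevWeight f ⟨0, hn⟩ * (I.W 0 : ℝ) ^ (I.n - 1 - (⟨0, hn⟩ : Fin I.n))) := by
    intro h
    rw [h, zero_mul]
    exact mul_nonneg (Nat.cast_nonneg _)
      (mul_nonneg (prevWeight_nonneg hf0 _) (by positivity))
  have hret : ∀ {a : Fin I.m} {neg pos : TestTree I.n}, neg.SequentialFrom 1 →
      pos.SequentialFrom 1 → neg.numTests ≤ r → pos.numTests ≤ r →
      wreward val I.payoff f (.test ⟨0, hn⟩ (val a) neg pos) *
        (I.W 0 * (I.W 0 : ℝ) ^ (I.n + 1)) ≤ (I.dp I.n 0 0 0).1 *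
        (prevWeight f ⟨0, hn⟩ * (I.W 0 : ℝ) ^ (I.n - 1 - (⟨0, hn⟩ : Fin I.n))) := by
    intro a neg pos h1 h2 h3 h4
    have := retest_le hval (r := r) (c := ⟨0, hn⟩) (qp := 0) (qc := 0) (f := f)
      (fun q hq => upperBound hval r _ _ _ hq) (inInterval_zero a) h1 h2 h3 h4 hf0 rfl
      (fun _ _ => rfl) hprev
    have e1 : r + 2 = I.n + 1 := by omega
    have e2 : r + 1 = I.n := by omega
    rw [e1, e2] at this
    exact this
  obtain ⟨hB1, hB2⟩ := hB
  cases B with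
  | choose i =>
    rcases wreward_eq_zero_or_test_self (i := ⟨0, hn⟩) I.payoff
        (show f ⟨0, hn⟩ = I.weight 0 from rfl)
      (.choose i) with h | ⟨a, ha, h⟩
    · exact hzero h
    · rw [h]
      exact hret trivial trivial (Nat.zero_le _) (Nat.zero_le _)
  | test i t neg pos =>
    obtain ⟨hi, hneg, hpos⟩ := hB1
    obtain rfl : i = ⟨0, hn⟩ := Fin.ext (by rcases hi with hi | hi <;> simp_all)
    have hB2 : neg.numTests ≤ r ∧ pos.numTests ≤ r := by
      rw [← max_le_iff]
      rw [TestTree.numTests] at hB2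
      omega
    rcases exists_wreward_eq_test_val I.payoff (show f ⟨0, hn⟩ = I.weight 0 from rfl) t neg pos
      with h | ⟨a, ha, pos', hp, h⟩
    · exact hzero h
    · rw [h]
      have hp' : pos'.SequentialFrom 1 ∧ pos'.numTests ≤ r := by
        rcases hp with rfl | rfl
        exacts [⟨hpos, hB2.2⟩, ⟨hneg, hB2.1⟩]
      exact hret hneg hp'.1 hB2.1 hp'.2

end Optimality

end Inst

/-! ### Reasoning about programs and their running time -/

/-- All registers and memory cells hold numbers up to `X`. -/
def Store.BoundedBy (X : ℕ) (s : Store) : Prop := (∀ x, s.reg x ≤ X) ∧ ∀ a, s.cell a ≤ X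

namespace Expr

/-- If all registers and cells are at most `X ≥ 2`, then the value is at most `X ^ degree`. -/
def degree : Expr → ℕ
  | lit c => c + 1
  | reg _ => 1
  | cell _ => 1
  | op _ e₁ e₂ => e₁.degree + e₂.degree + 1

/-- The cost in units of the binary length of a bound on the memory contents. -/
def weight : Expr → ℕ
  | lit c => c + 2
  | reg _ => 2
  | cell e => e.weight + 2
  | op _ e₁ e₂ => e₁.weight + e₂.weight + 1 + (e₁.degree + e₂.degree + 1)

theorem degree_pos (e : Expr) : 0 < e.degree := by cases e <;> simp [degree]

/-- Intermediate results may exceed `X`, but only by a power fixed by the expression. The extra `1`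
in the degree of an operation absorbs the factor `2` of a sum. -/
theorem eval_le {X : ℕ} (hX : 2 ≤ X) {s : Store} (hs : s.BoundedBy X) (e : Expr) :
    e.eval s ≤ X ^ e.degree := by
  induction e with
  | lit c =>
    calc c ≤ 2 ^ c := Nat.lt_two_pow_self.le
      _ ≤ 2 ^ (c + 1) := Nat.pow_le_pow_right (by norm_num) (Nat.le_succ c)
      _ ≤ X ^ (c + 1) := Nat.pow_le_pow_left hX _
  | reg x => simpa [degree, eval] using hs.1 x
  | cell e => simpa [degree, eval] using hs.2 _
  | op o e₁ e₂ h₁ h₂ =>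
    have hX1 : 1 ≤ X := by omega
    have l₁ : X ^ e₁.degree ≤ X ^ (e₁.degree + e₂.degree) := Nat.pow_le_pow_right hX1 (by omega)
    have l₂ : X ^ e₂.degree ≤ X ^ (e₁.degree + e₂.degree) := Nat.pow_le_pow_right hX1 (by omega)
    have l₃ : X ^ (e₁.degree + e₂.degree) * 2 ≤ X ^ (e₁.degree + e₂.degree + 1) := by
      rw [pow_succ]; exact Nat.mul_le_mul_left _ hX
    have l₄ : e₁.eval s * e₂.eval s ≤ X ^ (e₁.degree + e₂.degree) := by
      rw [pow_add]; exact Nat.mul_le_mul h₁ h₂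
    have l₅ : 1 ≤ X ^ (e₁.degree + e₂.degree) := Nat.one_le_pow _ _ hX1
    simp only [eval, degree]
    cases o <;> simp only [Op.eval]
    · omega
    · omega
    · omega
    · have := Nat.div_le_self (e₁.eval s) (e₂.eval s); omega
    · split_ifs <;> omega

theorem size_eval_le {X : ℕ} (hX : 2 ≤ X) {s : Store} (hs : s.BoundedBy X) (e : Expr) :
    (e.eval s).size ≤ e.degree * X.size := by
  rw [Nat.size_le, mul_comm, pow_mul]
  refine (e.eval_le hX hs).trans_lt ?_
  exact Nat.pow_lt_pow_left (Nat.lt_size_self X) e.degree_pos.ne'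

theorem cost_le {X : ℕ} (hX : 2 ≤ X) {s : Store} (hs : s.BoundedBy X) (e : Expr) :
    e.cost s ≤ e.weight * X.size := by
  have h1 : 1 ≤ X.size := Nat.size_pos.mpr (by omega)
  induction e with
  | lit c =>
    have := size_eval_le hX hs (lit c)
    simp only [eval, degree, cost, weight] at *
    nlinarith
  | reg x =>
    have := size_eval_le hX hs (reg x)
    simp only [eval, degree, cost, weight] at *
    nlinarith
  | cell e h =>
    have := size_eval_le hX hs (cell e)
    simp only [eval, degree, cost, weight] at *
    nlinarith
  | op o e₁ e₂ h₁ h₂ =>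
    have := size_eval_le hX hs (op o e₁ e₂)
    simp only [eval, degree, cost, weight] at *
    nlinarith

end Expr

/-- Started in `s`, the program halts within time `T * X.size`, keeps the memory contents bounded
by `X`, and reaches a store that satisfies `Q`. -/
def Exec (X : ℕ) (P : Program) (s : Store) (T : ℕ) (Q : Store → Prop) : Prop :=
  s.BoundedBy X → ∃ t s', Runs P s t s' ∧ t ≤ T * X.size ∧ s'.BoundedBy X ∧ Q s'

namespace Exec

variable {X : ℕ} {s : Store} {Q : Store → Prop}

theorem mono {P : Program} {T T' : ℕ} {Q' : Store → Prop} (h : Exec X P s T Q) (hT : T ≤ T')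
    (hQ : ∀ s', Q s' → Q' s') : Exec X P s T' Q' := fun hs => by
  obtain ⟨t, s', h1, h2, h3, h4⟩ := h hs
  exact ⟨t, s', h1, h2.trans (Nat.mul_le_mul_right _ hT), h3, hQ s' h4⟩

/-- Only the final result has to respect the memory bound; intermediate values are charged through
`weight`. -/
theorem assign (hX : 2 ≤ X) {x : ℕ} {e : Expr} (he : e.eval s ≤ X)
    (hQ : Q { s with reg := Function.update s.reg x (e.eval s) }) :
    Exec X (.assign x e) s (e.weight + 1) Q := fun hs => by
  refine ⟨_, _, Runs.assign x e s, ?_, ⟨fun y => ?_, hs.2⟩, hQ⟩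
  · have := e.cost_le hX hs
    have h1 : 1 ≤ X.size := Nat.size_pos.mpr (by omega)
    nlinarith
  · rcases eq_or_ne y x with rfl | h
    · simpa using he
    · simpa [h] using hs.1 y

theorem store (hX : 2 ≤ X) {a e : Expr} (he : e.eval s ≤ X)
    (hQ : Q { s with cell := Function.update s.cell (a.eval s) (e.eval s) }) :
    Exec X (.store a e) s (a.weight + e.weight + 1) Q := fun hs => by
  refine ⟨_, _, Runs.store a e s, ?_, ⟨hs.1, fun y => ?_⟩, hQ⟩
  · have := e.cost_le hX hs
    have := a.cost_le hX hs
    have h1 : 1 ≤ X.size := Nat.size_pos.mpr (by omega)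
    nlinarith
  · rcases eq_or_ne y (a.eval s) with rfl | h
    · simpa using he
    · simpa [h] using hs.2 y

theorem emit (hX : 2 ≤ X) {e : Expr} (hQ : Q { s with out := s.out ++ [e.eval s] }) :
    Exec X (.emit e) s (e.weight + 1) Q := fun hs => by
  refine ⟨_, _, Runs.emit e s, ?_, hs, hQ⟩
  have := e.cost_le hX hs
  have h1 : 1 ≤ X.size := Nat.size_pos.mpr (by omega)
  nlinarith

theorem seq {P R : Program} {T₁ T₂ : ℕ}
    (h : Exec X P s T₁ fun s' => Exec X R s' T₂ Q) : Exec X (.seq P R) s (T₁ + T₂) Q :=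
  fun hs => by
    obtain ⟨t, s', h1, h2, h3, h4⟩ := h hs
    obtain ⟨t', s'', h1', h2', h3', h4'⟩ := h4 h3
    exact ⟨_, s'', Runs.seq h1 h1', by rw [add_mul]; exact add_le_add h2 h2', h3', h4'⟩

end Exec

/-- Run `P` with `x = 0, 1, …` as long as `x < e`. -/
def Program.forLoop (x : ℕ) (e : Expr) (P : Program) : Program :=
  .seq (.assign x (.lit 0))
    (.loop (.op .sub e (.reg x)) (.seq P (.assign x (.op .add (.reg x) (.lit 1)))))

/-- The time of `k` iterations of a loop body that takes time `T`. -/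
def forTime (x : ℕ) (e : Expr) (k T : ℕ) : ℕ :=
  ((Expr.lit 0).weight + 1) + ((Expr.op .sub e (.reg x)).weight + 1) +
    k * (T + ((Expr.op .sub e (.reg x)).weight + 1) +
      ((Expr.op .add (.reg x) (.lit 1)).weight + 1))

/-- The loop condition is a truncated difference, nonzero exactly while the counter is below `k`.
The invariant describes the store just after the counter was set, and `k ≤ X` keeps the counter
within bounds. -/
theorem Exec.forLoop {X : ℕ} (hX : 2 ≤ X) {x : ℕ} {e : Expr} {P : Program} {k T : ℕ}
    (hk : k ≤ X) (Inv : ℕ → Store → Prop) {s : Store} {Q : Store → Prop}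
    (hreg : ∀ i s, Inv i s → s.reg x = i) (he : ∀ i s, Inv i s → e.eval s = k)
    (h0 : Inv 0 { s with reg := Function.update s.reg x 0 })
    (hstep : ∀ i s, i < k → Inv i s → Exec X P s T fun s' => s'.reg x = i ∧
      Inv (i + 1) { s' with reg := Function.update s'.reg x (i + 1) })
    (hQ : ∀ s, Inv k s → Q s) :
    Exec X (.forLoop x e P) s (forTime x e k T) Q := by
  have h1 : 1 ≤ X.size := Nat.size_pos.mpr (by omega)
  have main : ∀ d i s, i + d = k → Inv i s →
      Exec X (.loop (.op .sub e (.reg x)) (.seq P (.assign x (.op .add (.reg x) (.lit 1))))) s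
        (((Expr.op .sub e (.reg x)).weight + 1) +
          d * (T + ((Expr.op .sub e (.reg x)).weight + 1) +
            ((Expr.op .add (.reg x) (.lit 1)).weight + 1))) Q := by
    intro d
    induction d with
    | zero =>
      intro i s hi hs hb
      have hcost := (Expr.op .sub e (.reg x)).cost_le hX hb
      refine ⟨_, s, Runs.loop_done ?_, ?_, hb, hQ s (by obtain rfl : i = k := hi; exact hs)⟩
      · simp only [Expr.eval, Op.eval, hreg i s hs, he i s hs]
        omega
      · nlinarith
    | succ d ih =>
      intro i s hi hs hb
      have hcost := (Expr.op .sub e (.reg x)).cost_le hX hb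
      have hbody : Exec X (.seq P (.assign x (.op .add (.reg x) (.lit 1)))) s
          (T + ((Expr.op .add (.reg x) (.lit 1)).weight + 1)) (Inv (i + 1)) := by
        refine Exec.seq ((hstep i s (by omega) hs).mono le_rfl fun s' hs' => ?_)
        have hev : (Expr.op .add (.reg x) (.lit 1)).eval s' = i + 1 := by
          simp [Expr.eval, Op.eval, hs'.1]
        exact Exec.assign hX (by rw [hev]; omega) (by rw [hev]; exact hs'.2)
      obtain ⟨t1, s1, r1, b1, c1, q1⟩ := hbody hb
      obtain ⟨t2, s2, r2, b2, c2, q2⟩ := ih (i + 1) s1 (by omega) q1 c1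
      refine ⟨_, s2, Runs.loop_step ?_ r1 r2, ?_, c2, q2⟩
      · simp only [Expr.eval, Op.eval, hreg i s hs, he i s hs]
        omega
      · nlinarith
  unfold forTime Program.forLoop
  rw [add_assoc]
  refine Exec.seq (Exec.assign hX (Nat.zero_le _) ?_)
  exact main k 0 _ (zero_add k) h0

/-! ### Expressions for the dynamic program

Register `0` holds the number of boxes, register `1` the number of values, registers `2` and `3`
the common denominators of the probabilities and the values. Registers from `10` on are used by
loops. -/

namespace Expr

def add (a b : Expr) : Expr := op .add a b
def sub (a b : Expr) : Expr := op .sub a b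
def mul (a b : Expr) : Expr := op .mul a b
def div (a b : Expr) : Expr := op .div a b
def le (a b : Expr) : Expr := op .le a b
def lt (a b : Expr) : Expr := le (add a (lit 1)) b
def eq (a b : Expr) : Expr := mul (le a b) (le b a)
def mod (a b : Expr) : Expr := sub a (mul (div a b) b)
/-- `if c then a else b` for a condition with value `0` or `1`. -/
def ite (c a b : Expr) : Expr := add (mul c a) (mul (sub (lit 1) c) b)

variable (s : Store) (a b : Expr)

theorem eval_lit (c : ℕ) : (lit c).eval s = c := rfl
theorem eval_reg (x : ℕ) : (reg x).eval s = s.reg x := rfl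
theorem eval_cell : (cell a).eval s = s.cell (a.eval s) := rfl
theorem eval_add : (add a b).eval s = a.eval s + b.eval s := rfl
theorem eval_sub : (sub a b).eval s = a.eval s - b.eval s := rfl
theorem eval_mul : (mul a b).eval s = a.eval s * b.eval s := rfl
theorem eval_div : (div a b).eval s = a.eval s / b.eval s := rfl
theorem eval_le' : (le a b).eval s = if a.eval s ≤ b.eval s then 1 else 0 := rfl
theorem eval_lt : (lt a b).eval s = if a.eval s < b.eval s then 1 else 0 := rfl
theorem eval_eq : (eq a b).eval s = if a.eval s = b.eval s then 1 else 0 := by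
  rw [eq, eval_mul, eval_le', eval_le']
  split_ifs <;> first | rfl | (exfalso; omega)
theorem eval_mod : (mod a b).eval s = a.eval s % b.eval s := by
  rw [mod, eval_sub, eval_mul, eval_div]
  have := Nat.div_add_mod' (a.eval s) (b.eval s)
  omega
-- Both alternatives are evaluated and one is multiplied by `0`. So the alternative not taken may
-- read meaningless cells, and no branching is needed.
theorem eval_ite {c : Expr} {p : Prop} [Decidable p] (hc : c.eval s = if p then 1 else 0) :
    (ite c a b).eval s = if p then a.eval s else b.eval s := by
  rw [ite, eval_add, eval_mul, eval_mul, eval_sub, hc, eval_lit]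
  split_ifs <;> simp

end Expr

/-! ### The data of the program -/

/-- The input: numerators and denominators of the values and the probabilities. -/
structure Data where
  n : ℕ
  m : ℕ
  vn : ℕ → ℕ
  vd : ℕ → ℕ
  pn : ℕ → ℕ
  pd : ℕ → ℕ

namespace Data

variable (d : Data)

/-- A common denominator of the probabilities. -/
def pden : ℕ := ∏ j ∈ Finset.range d.m, d.pd j

/-- A common denominator of the values. -/
def vden : ℕ := ∏ j ∈ Finset.range d.m, d.vd j

/-- The instance with integral weights and values. -/
def inst : Inst where
  n := d.n
  m := d.m
  p j := d.pn j * (d.pden / d.pd j)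
  v j := d.vn j * (d.vden / d.vd j)

/-- The number of interval codes. -/
def K : ℕ := (d.m + 1) * (d.m + 1)

/-- The number of states. -/
def N : ℕ := (d.n + 1) * d.n * d.n * d.K * d.K

/-- The number of the state in which `t` tests have been made, `c` is the current box, `β` the best
previous one, and `qp` and `qc` are the intervals of `β` and `c`. -/
def index (t c β qp qc : ℕ) : ℕ := (((t * d.n + c) * d.n + β) * d.K + qp) * d.K + qc

def qcOf (σ : ℕ) : ℕ := σ % d.K
def qpOf (σ : ℕ) : ℕ := σ / d.K % d.K
def βOf (σ : ℕ) : ℕ := σ / d.K / d.K % d.n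
def cOf (σ : ℕ) : ℕ := σ / d.K / d.K / d.n % d.n
def tOf (σ : ℕ) : ℕ := σ / d.K / d.K / d.n / d.n

variable {d}

theorem K_pos : 0 < d.K := Nat.mul_pos (Nat.succ_pos _) (Nat.succ_pos _)

theorem mul_add_div_eq {a b k : ℕ} (h : b < k) : (a * k + b) / k = a := by
  rw [mul_comm, Nat.mul_add_div (by omega), Nat.div_eq_of_lt h, add_zero]

theorem mul_add_mod_eq {a b k : ℕ} (h : b < k) : (a * k + b) % k = b := by
  rw [mul_comm, Nat.mul_add_mod, Nat.mod_eq_of_lt h]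

section

variable {t c β qp qc : ℕ}

theorem qcOf_index (h5 : qc < d.K) : d.qcOf (d.index t c β qp qc) = qc := mul_add_mod_eq h5

theorem qpOf_index (h4 : qp < d.K) (h5 : qc < d.K) : d.qpOf (d.index t c β qp qc) = qp := by
  rw [qpOf, index, mul_add_div_eq h5, mul_add_mod_eq h4]

theorem βOf_index (h3 : β < d.n) (h4 : qp < d.K) (h5 : qc < d.K) :
    d.βOf (d.index t c β qp qc) = β := by
  rw [βOf, index, mul_add_div_eq h5, mul_add_div_eq h4, mul_add_mod_eq h3]

theorem cOf_index (h2 : c < d.n) (h3 : β < d.n) (h4 : qp < d.K) (h5 : qc < d.K) :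
    d.cOf (d.index t c β qp qc) = c := by
  rw [cOf, index, mul_add_div_eq h5, mul_add_div_eq h4, mul_add_div_eq h3, mul_add_mod_eq h2]

theorem tOf_index (h2 : c < d.n) (h3 : β < d.n) (h4 : qp < d.K) (h5 : qc < d.K) :
    d.tOf (d.index t c β qp qc) = t := by
  rw [tOf, index, mul_add_div_eq h5, mul_add_div_eq h4, mul_add_div_eq h3, mul_add_div_eq h2]

theorem mul_add_lt {a b k l : ℕ} (ha : a < l) (hb : b < k) : a * k + b < l * k := by
  calc a * k + b < a * k + k := by omega
    _ = (a + 1) * k := by ring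
    _ ≤ l * k := Nat.mul_le_mul_right _ ha

theorem index_lt_N (h1 : t ≤ d.n) (h2 : c < d.n) (h3 : β < d.n) (h4 : qp < d.K) (h5 : qc < d.K) :
    d.index t c β qp qc < d.N :=
  mul_add_lt (mul_add_lt (mul_add_lt (mul_add_lt (Nat.lt_succ_of_le h1) h2) h3) h4) h5

/-- The number of tests made is the leading digit of a state, so successors have larger numbers.
Treating the states in decreasing order makes them available in time. -/
theorem lt_index {σ : ℕ} (hn : 0 < d.n) (h : d.tOf σ < t) : σ < d.index t c β qp qc := by
  have h1 : σ / d.K / d.K / d.n / d.n < t := h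
  have h2 := (Nat.div_lt_iff_lt_mul hn).mp h1
  have h3 := (Nat.div_lt_iff_lt_mul hn).mp (Nat.lt_add_right c h2)
  have h4 := (Nat.div_lt_iff_lt_mul K_pos).mp (Nat.lt_add_right β h3)
  have h5 := (Nat.div_lt_iff_lt_mul K_pos).mp (Nat.lt_add_right qp h4)
  exact Nat.lt_add_right qc h5

end

theorem qcOf_lt (σ : ℕ) : d.qcOf σ < d.K := Nat.mod_lt _ K_pos
theorem qpOf_lt (σ : ℕ) : d.qpOf σ < d.K := Nat.mod_lt _ K_pos
theorem βOf_lt (hn : 0 < d.n) (σ : ℕ) : d.βOf σ < d.n := Nat.mod_lt _ hn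
theorem cOf_lt (hn : 0 < d.n) (σ : ℕ) : d.cOf σ < d.n := Nat.mod_lt _ hn

theorem code_lt {l h : ℕ} (hl : l ≤ d.m) (hh : h ≤ d.m) : d.inst.code l h < d.K :=
  mul_add_lt (Nat.lt_succ_of_le hl) (Nat.lt_succ_of_le hh)

theorem div_le {q : ℕ} (h : q < d.K) : q / (d.m + 1) ≤ d.m :=
  Nat.lt_succ_iff.mp (Nat.div_lt_of_lt_mul h)

theorem mod_le (q : ℕ) : q % (d.m + 1) ≤ d.m :=
  Nat.lt_succ_iff.mp (Nat.mod_lt _ (Nat.succ_pos _))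

variable (d)

/-- Optimal value and option in state `σ`. -/
def dpAt (σ : ℕ) : ℕ × ℕ := d.inst.dp (d.n - d.tOf σ) (d.cOf σ) (d.qpOf σ) (d.qcOf σ)

/-- The value of option `o` in state `σ`. -/
def valAt (σ o : ℕ) : ℕ :=
  if d.n ≤ d.tOf σ then d.inst.finalVal (d.cOf σ) (d.qpOf σ) (d.qcOf σ) o
  else d.inst.stepVal (fun c qp qc => (d.inst.dp (d.n - (d.tOf σ + 1)) c qp qc).1)
    (d.cOf σ) (d.qpOf σ) (d.qcOf σ) o

/-- Both clauses of the recursion become one search over the same range of options, which a single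
inner loop performs. -/
theorem dpAt_eq (σ : ℕ) : d.dpAt σ = argmax (d.valAt σ) (2 * d.m + 1) (2 * d.m + 3) := by
  unfold dpAt valAt
  by_cases h : d.n ≤ d.tOf σ
  · simp only [if_pos h]
    rw [Nat.sub_eq_zero_of_le h, Inst.dp]
    rfl
  · simp only [if_neg h]
    obtain ⟨r, hr⟩ : ∃ r, d.n - d.tOf σ = r + 1 := ⟨d.n - d.tOf σ - 1, by omega⟩
    have hr' : d.n - (d.tOf σ + 1) = r := by omega
    rw [hr, hr', Inst.dp]
    rfl

/-- The program works with numbers up to `X`. -/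
structure Fits (X : ℕ) : Prop where
  two_le : 2 ≤ X
  n_pos : 0 < d.n
  pd_pos : ∀ j < d.m, 0 < d.pd j
  vd_pos : ∀ j < d.m, 0 < d.vd j
  W_zero : d.inst.W 0 = d.pden
  n_le : d.n ≤ X
  m_le : 2 * d.m + 3 ≤ X
  pden_le : d.pden ≤ X
  vden_le : d.vden ≤ X
  K_le : d.K ≤ X
  N_le : d.N ≤ X
  S_le : d.inst.S 0 ≤ X
  dp_le : ∀ σ, (d.dpAt σ).1 ≤ X

/-- The cells contain the input. -/
structure HasInput (s : Store) : Prop where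
  n_eq : s.cell 0 = d.n
  m_eq : s.cell 1 = d.m
  vn_eq : ∀ j < d.m, s.cell (4 * j + 2) = d.vn j
  vd_eq : ∀ j < d.m, s.cell (4 * j + 3) = d.vd j
  pn_eq : ∀ j < d.m, s.cell (4 * j + 4) = d.pn j
  pd_eq : ∀ j < d.m, s.cell (4 * j + 5) = d.pd j

/-- The first registers are initialized. -/
structure Ready (s : Store) : Prop extends d.HasInput s where
  reg_zero : s.reg 0 = d.n
  reg_one : s.reg 1 = d.m
  reg_two : s.reg 2 = d.pden
  reg_three : s.reg 3 = d.vden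

/-- The tables of the weights and sums of intervals are filled up to `k`. -/
def HasTables (k : ℕ) (s : Store) : Prop :=
  ∀ q < k, s.cell (4 * d.m + 2 + (8 * q + 0)) = d.inst.W q ∧
    s.cell (4 * d.m + 2 + (8 * q + 1)) = d.inst.S q

/-- The tables of optimal values and options are filled from state `l` on. -/
def HasStates (l : ℕ) (s : Store) : Prop :=
  ∀ σ, l ≤ σ → σ < d.N → s.cell (4 * d.m + 2 + (8 * σ + 2)) = (d.dpAt σ).1 ∧
    s.cell (4 * d.m + 2 + (8 * σ + 3)) = (d.dpAt σ).2

variable {d}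

theorem HasInput.congr {s s' : Store} (h : d.HasInput s)
    (hc : ∀ a < 4 * d.m + 2, s'.cell a = s.cell a) : d.HasInput s' where
  n_eq := by rw [hc _ (by omega), h.n_eq]
  m_eq := by rw [hc _ (by omega), h.m_eq]
  vn_eq j hj := by rw [hc _ (by omega), h.vn_eq j hj]
  vd_eq j hj := by rw [hc _ (by omega), h.vd_eq j hj]
  pn_eq j hj := by rw [hc _ (by omega), h.pn_eq j hj]
  pd_eq j hj := by rw [hc _ (by omega), h.pd_eq j hj]

theorem Ready.congr {s s' : Store} (h : d.Ready s) (hr : ∀ x < 4, s'.reg x = s.reg x)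
    (hc : ∀ a < 4 * d.m + 2, s'.cell a = s.cell a) : d.Ready s' where
  toHasInput := h.toHasInput.congr hc
  reg_zero := by rw [hr _ (by omega), h.reg_zero]
  reg_one := by rw [hr _ (by omega), h.reg_one]
  reg_two := by rw [hr _ (by omega), h.reg_two]
  reg_three := by rw [hr _ (by omega), h.reg_three]

theorem Ready.update_reg {s : Store} (h : d.Ready s) {x : ℕ} (hx : 4 ≤ x) (v : ℕ) :
    d.Ready { s with reg := Function.update s.reg x v } :=
  h.congr (fun y hy => Function.update_of_ne (by omega) _ _) fun _ _ => rfl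

theorem Ready.update_cell {s : Store} (h : d.Ready s) {a : ℕ} (ha : 4 * d.m + 2 ≤ a) (v : ℕ) :
    d.Ready { s with cell := Function.update s.cell a v } :=
  h.congr (fun _ _ => rfl) fun y hy => Function.update_of_ne (by omega) _ _

/-- The tables start behind the input and are interleaved with stride `8`: offsets `0` and `1` for
intervals, `2` and `3` for states. Writes to one table thus never hit another. -/
theorem HasTables.update_cell {s : Store} {k : ℕ} (h : d.HasTables k s) {a : ℕ}
    (ha : ∀ q < k, a ≠ 4 * d.m + 2 + (8 * q + 0) ∧ a ≠ 4 * d.m + 2 + (8 * q + 1)) (v : ℕ) :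
    d.HasTables k { s with cell := Function.update s.cell a v } := fun q hq => by
  have h1 := ha q hq
  have h2 := h q hq
  exact ⟨(Function.update_of_ne h1.1.symm _ _).trans h2.1,
    (Function.update_of_ne h1.2.symm _ _).trans h2.2⟩

end Data

/-! ### Evaluation of the expressions -/

namespace Expr

def bound : Expr := add (reg 1) (lit 1)
def numCodes : Expr := mul bound bound
def numStates : Expr :=
  mul (mul (mul (mul (add (reg 0) (lit 1)) (reg 0)) (reg 0)) numCodes) numCodes

def inputAt (k : ℕ) (j : Expr) : Expr := cell (add (mul (lit 4) j) (lit k))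
def value (j : Expr) : Expr := mul (inputAt 2 j) (div (reg 3) (inputAt 3 j))
def prob (j : Expr) : Expr := mul (inputAt 4 j) (div (reg 2) (inputAt 5 j))

def inInterval (l h j : Expr) : Expr :=
  mul (le (mul (le (lit 1) l) (value (sub l (lit 1)))) (value j))
    (le (mul (le (lit 1) h) (add (value j) (lit 1))) (value (sub h (lit 1))))

def address (k : ℕ) (i : Expr) : Expr :=
  add (add (mul (lit 4) (reg 1)) (lit 2)) (add (mul (lit 8) i) (lit k))
def tableAt (k : ℕ) (i : Expr) : Expr := cell (address k i)
def sumPrev (q : Expr) : Expr := ite (eq q (lit 0)) (lit 0) (tableAt 1 q)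

def code (l h : Expr) : Expr := add (mul l bound) h
def index (t c β qp qc : Expr) : Expr :=
  add (mul (add (mul (add (mul (add (mul t (reg 0)) c) (reg 0)) β) numCodes) qp) numCodes) qc

def qcOf (σ : Expr) : Expr := mod σ numCodes
def qpOf (σ : Expr) : Expr := mod (div σ numCodes) numCodes
def βOf (σ : Expr) : Expr := mod (div (div σ numCodes) numCodes) (reg 0)
def cOf (σ : Expr) : Expr := mod (div (div (div σ numCodes) numCodes) (reg 0)) (reg 0)
def tOf (σ : Expr) : Expr := div (div (div (div σ numCodes) numCodes) (reg 0)) (reg 0)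

def better (σ : Expr) : Expr :=
  le (mul (sumPrev (qpOf σ)) (tableAt 0 (qcOf σ))) (mul (tableAt 1 (qcOf σ)) (tableAt 0 (qpOf σ)))

def twice (e : Expr) : Expr := mul (lit 2) e

def finalVal (σ o : Expr) : Expr :=
  ite (eq o (twice (reg 1))) (mul (mul (sumPrev (qpOf σ)) (tableAt 0 (qcOf σ))) (reg 2))
  (ite (eq o (add (twice (reg 1)) (lit 1)))
    (mul (mul (tableAt 1 (qcOf σ)) (tableAt 0 (qpOf σ))) (reg 2))
  (ite (mul (eq o (add (twice (reg 1)) (lit 2))) (le (add (cOf σ) (lit 2)) (reg 0)))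
    (mul (mul (tableAt 1 (lit 0)) (tableAt 0 (qpOf σ))) (tableAt 0 (qcOf σ)))
  (lit 0)))

/-- The numbers of the next states for a negative and for a positive outcome, if the current box is
tested for value `j`. -/
def retestNeg (σ j : Expr) : Expr :=
  index (add (tOf σ) (lit 1)) (cOf σ) (βOf σ) (qpOf σ)
    (code (div (qcOf σ) bound) (add j (lit 1)))
def retestPos (σ j : Expr) : Expr :=
  index (add (tOf σ) (lit 1)) (cOf σ) (βOf σ) (qpOf σ)
    (code (add j (lit 1)) (mod (qcOf σ) bound))

/-- The number of the next state with interval `q`, if the next box is tested. -/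
def moveTo (σ q : Expr) : Expr :=
  ite (better σ) (index (add (tOf σ) (lit 1)) (add (cOf σ) (lit 1)) (cOf σ) (qcOf σ) q)
    (index (add (tOf σ) (lit 1)) (add (cOf σ) (lit 1)) (βOf σ) (qpOf σ) q)
def moveNeg (σ j : Expr) : Expr := moveTo σ (code (lit 0) (add j (lit 1)))
def movePos (σ j : Expr) : Expr := moveTo σ (code (add j (lit 1)) (lit 0))

def stepVal (σ o : Expr) : Expr :=
  ite (lt o (reg 1))
    (ite (inInterval (div (qcOf σ) bound) (mod (qcOf σ) bound) o)
      (mul (reg 2) (add (tableAt 2 (retestNeg σ o)) (tableAt 2 (retestPos σ o)))) (lit 0))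
  (ite (mul (mul (lt o (twice (reg 1))) (le (lit 1) (qcOf σ)))
      (mul (le (lit 1) (tableAt 0 (qcOf σ))) (le (add (cOf σ) (lit 2)) (reg 0))))
    (mul (ite (better σ) (tableAt 0 (qpOf σ)) (tableAt 0 (qcOf σ)))
      (add (tableAt 2 (moveNeg σ (sub o (reg 1)))) (tableAt 2 (movePos σ (sub o (reg 1))))))
    (lit 0))

def valAt (σ o : Expr) : Expr := ite (le (reg 0) (tOf σ)) (finalVal σ o) (stepVal σ o)

theorem eval_and {s : Store} {a b : Expr} {p q : Prop} [Decidable p] [Decidable q]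
    (ha : a.eval s = if p then 1 else 0) (hb : b.eval s = if q then 1 else 0) :
    (mul a b).eval s = if p ∧ q then 1 else 0 := by
  rw [eval_mul, ha, hb]
  split_ifs <;> first | rfl | (exfalso; tauto)

theorem eval_one_le {s : Store} {a : Expr} :
    (le (lit 1) a).eval s = if a.eval s ≠ 0 then 1 else 0 := by
  rw [eval_le', eval_lit]
  split_ifs <;> first | rfl | (exfalso; omega)

section

variable {d : Data} {s : Store} (hs : d.Ready s)
include hs

theorem eval_bound : bound.eval s = d.m + 1 := by
  rw [bound, eval_add, eval_reg, eval_lit, hs.reg_one]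

theorem eval_numCodes : numCodes.eval s = d.K := by
  rw [numCodes, eval_mul, eval_bound hs, Data.K]

theorem eval_numStates : numStates.eval s = d.N := by
  simp only [numStates, eval_mul, eval_add, eval_reg, eval_lit, eval_numCodes hs, hs.reg_zero,
    Data.N]

theorem eval_value {j : Expr} (hj : j.eval s < d.m) :
    (value j).eval s = d.inst.v (j.eval s) := by
  simp only [value, inputAt, eval_mul, eval_div, eval_cell, eval_add, eval_lit, eval_reg,
    hs.vn_eq _ hj, hs.vd_eq _ hj, hs.reg_three, Data.inst]

theorem eval_prob {j : Expr} (hj : j.eval s < d.m) :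
    (prob j).eval s = d.inst.p (j.eval s) := by
  simp only [prob, inputAt, eval_mul, eval_div, eval_cell, eval_add, eval_lit, eval_reg,
    hs.pn_eq _ hj, hs.pd_eq _ hj, hs.reg_two, Data.inst]

/-- Multiplying the left side of a comparison by the indicator of a nonzero bound makes an absent
bound vacuously satisfied; whatever `value` yields for the index `0 - 1` is then harmless. -/
theorem eval_inInterval {l h j : Expr} {q : ℕ} (hq : q < d.K) (hj : j.eval s < d.m)
    (hl : l.eval s = q / (d.m + 1)) (hh : h.eval s = q % (d.m + 1)) :
    (inInterval l h j).eval s = if d.inst.InInterval q (j.eval s) then 1 else 0 := by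
  have h1 := Data.div_le hq
  have h2 := Data.mod_le (d := d) q
  refine eval_and ?_ ?_
  · rw [eval_le', eval_mul, eval_one_le, eval_value hs hj, hl]
    change _ = if q / (d.m + 1) = 0 ∨ d.inst.v (q / (d.m + 1) - 1) ≤ _ then 1 else 0
    rcases Nat.eq_zero_or_pos (q / (d.m + 1)) with h0 | h0
    · simp [h0]
    · have he : (sub l (lit 1)).eval s = q / (d.m + 1) - 1 := by rw [eval_sub, hl, eval_lit]
      rw [eval_value hs (by rw [he]; omega), he]
      simp [h0.ne']
  · rw [eval_le', eval_mul, eval_one_le, eval_add, eval_value hs hj, hh, eval_lit]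
    change _ = if q % (d.m + 1) = 0 ∨ _ < d.inst.v (q % (d.m + 1) - 1) then 1 else 0
    rcases Nat.eq_zero_or_pos (q % (d.m + 1)) with h0 | h0
    · simp [h0]
    · have he : (sub h (lit 1)).eval s = q % (d.m + 1) - 1 := by rw [eval_sub, hh, eval_lit]
      rw [eval_value hs (by rw [he]; omega), he]
      simp [h0.ne']

theorem eval_address (k : ℕ) (i : Expr) :
    (address k i).eval s = 4 * d.m + 2 + (8 * i.eval s + k) := by
  simp only [address, eval_add, eval_mul, eval_lit, eval_reg, hs.reg_one]

theorem eval_code (l h : Expr) : (code l h).eval s = d.inst.code (l.eval s) (h.eval s) := by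
  simp only [code, eval_add, eval_mul, eval_bound hs]
  rfl

theorem eval_index (t c β qp qc : Expr) : (index t c β qp qc).eval s =
    d.index (t.eval s) (c.eval s) (β.eval s) (qp.eval s) (qc.eval s) := by
  simp only [index, eval_add, eval_mul, eval_reg, eval_numCodes hs, hs.reg_zero, Data.index]

theorem eval_qcOf (σ : Expr) : (qcOf σ).eval s = d.qcOf (σ.eval s) := by
  simp only [qcOf, eval_mod, eval_numCodes hs, Data.qcOf]

theorem eval_qpOf (σ : Expr) : (qpOf σ).eval s = d.qpOf (σ.eval s) := by
  simp only [qpOf, eval_mod, eval_div, eval_numCodes hs, Data.qpOf]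

theorem eval_βOf (σ : Expr) : (βOf σ).eval s = d.βOf (σ.eval s) := by
  simp only [βOf, eval_mod, eval_div, eval_reg, eval_numCodes hs, hs.reg_zero, Data.βOf]

theorem eval_cOf (σ : Expr) : (cOf σ).eval s = d.cOf (σ.eval s) := by
  simp only [cOf, eval_mod, eval_div, eval_reg, eval_numCodes hs, hs.reg_zero, Data.cOf]

theorem eval_tOf (σ : Expr) : (tOf σ).eval s = d.tOf (σ.eval s) := by
  simp only [tOf, eval_div, eval_reg, eval_numCodes hs, hs.reg_zero, Data.tOf]

variable (hT : d.HasTables d.K s)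
include hT

theorem eval_tableAt_zero {q : Expr} (hq : q.eval s < d.K) :
    (tableAt 0 q).eval s = d.inst.W (q.eval s) := by
  rw [tableAt, eval_cell, eval_address hs, (hT _ hq).1]

theorem eval_tableAt_one {q : Expr} (hq : q.eval s < d.K) :
    (tableAt 1 q).eval s = d.inst.S (q.eval s) := by
  rw [tableAt, eval_cell, eval_address hs, (hT _ hq).2]

theorem eval_sumPrev {q : Expr} (hq : q.eval s < d.K) :
    (sumPrev q).eval s = d.inst.Sprev (q.eval s) := by
  rw [sumPrev, eval_ite _ _ _ (eval_eq ..), eval_tableAt_one hs hT hq]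
  rfl

theorem eval_better (σ : Expr) : (better σ).eval s =
    if d.inst.Sprev (d.qpOf (σ.eval s)) * d.inst.W (d.qcOf (σ.eval s)) ≤
      d.inst.S (d.qcOf (σ.eval s)) * d.inst.W (d.qpOf (σ.eval s)) then 1 else 0 := by
  have h1 : (qcOf σ).eval s < d.K := by rw [eval_qcOf hs]; exact Data.qcOf_lt _
  have h2 : (qpOf σ).eval s < d.K := by rw [eval_qpOf hs]; exact Data.qpOf_lt _
  rw [better, eval_le', eval_mul, eval_mul, eval_sumPrev hs hT h2, eval_tableAt_zero hs hT h1,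
    eval_tableAt_zero hs hT h2, eval_tableAt_one hs hT h1, eval_qcOf hs, eval_qpOf hs]

theorem eval_finalVal {X : ℕ} (hX : d.Fits X) (σ o : Expr) : (finalVal σ o).eval s =
    d.inst.finalVal (d.cOf (σ.eval s)) (d.qpOf (σ.eval s)) (d.qcOf (σ.eval s)) (o.eval s) := by
  have h1 : (qcOf σ).eval s < d.K := by rw [eval_qcOf hs]; exact Data.qcOf_lt _
  have h2 : (qpOf σ).eval s < d.K := by rw [eval_qpOf hs]; exact Data.qpOf_lt _
  have h3 : (lit 0).eval s < d.K := Data.K_pos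
  rw [finalVal, eval_ite _ _ _ (eval_eq ..), eval_ite _ _ _ (eval_eq ..),
    eval_ite _ _ _ (eval_and (eval_eq ..) (eval_le' ..))]
  simp only [eval_mul, eval_sumPrev hs hT h2, eval_tableAt_zero hs hT h1,
    eval_tableAt_zero hs hT h2, eval_tableAt_one hs hT h1, eval_tableAt_one hs hT h3,
    eval_qcOf hs, eval_qpOf hs, eval_cOf hs, twice, eval_add, eval_lit, eval_reg, hs.reg_zero,
    hs.reg_one, hs.reg_two, ← hX.W_zero]
  rfl

omit hT in
theorem eval_retestNeg (σ j : Expr) : (retestNeg σ j).eval s =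
    d.index (d.tOf (σ.eval s) + 1) (d.cOf (σ.eval s)) (d.βOf (σ.eval s)) (d.qpOf (σ.eval s))
      (d.inst.code (d.qcOf (σ.eval s) / (d.m + 1)) (j.eval s + 1)) := by
  simp only [retestNeg, eval_index hs, eval_add, eval_lit, eval_code hs, eval_div, eval_bound hs,
    eval_qcOf hs, eval_qpOf hs, eval_cOf hs, eval_βOf hs, eval_tOf hs]

omit hT in
theorem eval_retestPos (σ j : Expr) : (retestPos σ j).eval s =
    d.index (d.tOf (σ.eval s) + 1) (d.cOf (σ.eval s)) (d.βOf (σ.eval s)) (d.qpOf (σ.eval s))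
      (d.inst.code (j.eval s + 1) (d.qcOf (σ.eval s) % (d.m + 1))) := by
  simp only [retestPos, eval_index hs, eval_add, eval_lit, eval_code hs, eval_mod, eval_bound hs,
    eval_qcOf hs, eval_qpOf hs, eval_cOf hs, eval_βOf hs, eval_tOf hs]

theorem eval_moveTo (σ q : Expr) : (moveTo σ q).eval s =
    if d.inst.Sprev (d.qpOf (σ.eval s)) * d.inst.W (d.qcOf (σ.eval s)) ≤
      d.inst.S (d.qcOf (σ.eval s)) * d.inst.W (d.qpOf (σ.eval s)) then
      d.index (d.tOf (σ.eval s) + 1) (d.cOf (σ.eval s) + 1) (d.cOf (σ.eval s))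
        (d.qcOf (σ.eval s)) (q.eval s)
    else d.index (d.tOf (σ.eval s) + 1) (d.cOf (σ.eval s) + 1) (d.βOf (σ.eval s))
        (d.qpOf (σ.eval s)) (q.eval s) := by
  rw [moveTo, eval_ite _ _ _ (eval_better hs hT σ)]
  simp only [eval_index hs, eval_add, eval_lit,
    eval_qcOf hs, eval_qpOf hs, eval_cOf hs, eval_βOf hs, eval_tOf hs]

omit hT in
theorem eval_tableAt_two {l : ℕ} (hU : d.HasStates l s)
    {e : Expr} {t c β qp qc : ℕ} (he : e.eval s = d.index t c β qp qc) (ht : t ≤ d.n)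
    (hc : c < d.n) (hβ : β < d.n) (hqp : qp < d.K) (hqc : qc < d.K)
    (hl : l ≤ d.index t c β qp qc) :
    (tableAt 2 e).eval s = (d.inst.dp (d.n - t) c qp qc).1 := by
  rw [tableAt, eval_cell, eval_address hs, he,
    (hU _ hl (Data.index_lt_N ht hc hβ hqp hqc)).1, Data.dpAt, Data.tOf_index hc hβ hqp hqc,
    Data.cOf_index hc hβ hqp hqc, Data.qpOf_index hqp hqc, Data.qcOf_index hqc]

/-- The successors lie beyond `σ`, so their cells are filled, and the guards of an option ensure
that all digits of the successor numbers are in range. -/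
theorem eval_stepVal {X : ℕ} (hX : d.Fits X) {σ o : Expr} (hU : d.HasStates (σ.eval s + 1) s)
    (ht : d.tOf (σ.eval s) < d.n) : (stepVal σ o).eval s =
    d.inst.stepVal (fun c qp qc => (d.inst.dp (d.n - (d.tOf (σ.eval s) + 1)) c qp qc).1)
      (d.cOf (σ.eval s)) (d.qpOf (σ.eval s)) (d.qcOf (σ.eval s)) (o.eval s) := by
  have h1 : (qcOf σ).eval s < d.K := by rw [eval_qcOf hs]; exact Data.qcOf_lt _
  have h2 : (qpOf σ).eval s < d.K := by rw [eval_qpOf hs]; exact Data.qpOf_lt _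
  have hqc := Data.qcOf_lt (d := d) (σ.eval s)
  have hqp := Data.qpOf_lt (d := d) (σ.eval s)
  have hn := hX.n_pos
  have hc := Data.cOf_lt hn (σ.eval s)
  have hβ := Data.βOf_lt hn (σ.eval s)
  have hlt : ∀ {c β qp qc}, σ.eval s + 1 ≤ d.index (d.tOf (σ.eval s) + 1) c β qp qc :=
    Data.lt_index hn (Nat.lt_succ_self _)
  have hdiv := Data.div_le hqc
  have hmod := Data.mod_le (d := d) (d.qcOf (σ.eval s))
  rw [stepVal, eval_ite _ _ _ (eval_lt ..), eval_reg, hs.reg_one]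
  unfold Inst.stepVal
  refine ite_congr rfl (fun ho => ?_) (fun ho => ?_)
  · rw [eval_ite _ _ _ (eval_inInterval hs hqc ho
      (by rw [eval_div, eval_qcOf hs, eval_bound hs])
      (by rw [eval_mod, eval_qcOf hs, eval_bound hs]))]
    refine ite_congr rfl (fun _ => ?_) (fun _ => rfl)
    have ho' : o.eval s < d.m := ho
    rw [eval_mul, eval_add, eval_reg, hs.reg_two, ← hX.W_zero,
      eval_tableAt_two hs hU (eval_retestNeg hs σ o) ht hc hβ hqp
        (Data.code_lt hdiv ho') hlt,
      eval_tableAt_two hs hU (eval_retestPos hs σ o) ht hc hβ hqp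
        (Data.code_lt ho' hmod) hlt]
    rfl
  · rw [eval_ite _ _ _ (eval_and (eval_and (eval_lt ..) eval_one_le) (eval_and eval_one_le
      (eval_le' ..))), eval_tableAt_zero hs hT h1]
    simp only [eval_qcOf hs, eval_cOf hs, twice, eval_mul, eval_add, eval_lit, eval_reg,
      hs.reg_zero, hs.reg_one]
    refine ite_congr (by simp only [and_assoc]; rfl) (fun hcond => ?_) (fun _ => rfl)
    have hcn : d.cOf (σ.eval s) + 1 < d.n := hcond.2.2.2
    have ho' : o.eval s - d.m < d.m := by
      have h3 : o.eval s < 2 * d.m := hcond.1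
      have h4 : ¬ o.eval s < d.m := ho
      omega
    have he : (sub o (reg 1)).eval s = o.eval s - d.m := by rw [eval_sub, eval_reg, hs.reg_one]
    have e1 := eval_moveTo hs hT σ (code (lit 0) (add (sub o (reg 1)) (lit 1)))
    have e2 := eval_moveTo hs hT σ (code (add (sub o (reg 1)) (lit 1)) (lit 0))
    rw [eval_code hs, eval_add, he, eval_lit, eval_lit] at e1 e2
    rw [eval_ite _ _ _ (eval_better hs hT σ), eval_tableAt_zero hs hT h1,
      eval_tableAt_zero hs hT h2, eval_qcOf hs, eval_qpOf hs, moveNeg, movePos]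
    have hk1 : d.inst.code 0 (o.eval s - d.m + 1) < d.K := Data.code_lt (Nat.zero_le _) ho'
    have hk2 : d.inst.code (o.eval s - d.m + 1) 0 < d.K := Data.code_lt ho' (Nat.zero_le _)
    split_ifs at e1 e2 ⊢ with hb
    · rw [eval_tableAt_two hs hU e1 ht hcn hc hqc hk1 hlt,
        eval_tableAt_two hs hU e2 ht hcn hc hqc hk2 hlt]
      rfl
    · rw [eval_tableAt_two hs hU e1 ht hcn hβ hqp hk1 hlt,
        eval_tableAt_two hs hU e2 ht hcn hβ hqp hk2 hlt]
      rfl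

theorem eval_valAt {X : ℕ} (hX : d.Fits X) {σ o : Expr} (hU : d.HasStates (σ.eval s + 1) s) :
    (valAt σ o).eval s = d.valAt (σ.eval s) (o.eval s) := by
  rw [valAt, eval_ite _ _ _ (eval_le' ..), eval_reg, hs.reg_zero, eval_tOf hs, Data.valAt]
  refine ite_congr rfl (fun _ => eval_finalVal hs hT hX σ o) (fun h => ?_)
  exact eval_stepVal hs hT hX hU (not_le.mp h)

end

end Expr

/-! ### The output -/

/-- The table entry of state `σ`. -/
def Data.entryAt (d : Data) (hn : 0 < d.n) (σ : ℕ) : Entry d.inst.n d.inst.m :=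
  if h : (d.dpAt σ).2 < d.inst.m then
    .test (d.inst.box hn (d.cOf σ)) ⟨_, h⟩
      (d.index (d.tOf σ + 1) (d.cOf σ) (d.βOf σ) (d.qpOf σ)
        (d.inst.code (d.qcOf σ / (d.m + 1)) ((d.dpAt σ).2 + 1)))
      (d.index (d.tOf σ + 1) (d.cOf σ) (d.βOf σ) (d.qpOf σ)
        (d.inst.code ((d.dpAt σ).2 + 1) (d.qcOf σ % (d.m + 1))))
  else if h : (d.dpAt σ).2 - d.inst.m < d.inst.m then
    if d.inst.Sprev (d.qpOf σ) * d.inst.W (d.qcOf σ) ≤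
        d.inst.S (d.qcOf σ) * d.inst.W (d.qpOf σ) then
      .test (d.inst.box hn (d.cOf σ + 1)) ⟨_, h⟩
        (d.index (d.tOf σ + 1) (d.cOf σ + 1) (d.cOf σ) (d.qcOf σ)
          (d.inst.code 0 ((d.dpAt σ).2 - d.inst.m + 1)))
        (d.index (d.tOf σ + 1) (d.cOf σ + 1) (d.cOf σ) (d.qcOf σ)
          (d.inst.code ((d.dpAt σ).2 - d.inst.m + 1) 0))
    else
      .test (d.inst.box hn (d.cOf σ + 1)) ⟨_, h⟩
        (d.index (d.tOf σ + 1) (d.cOf σ + 1) (d.βOf σ) (d.qpOf σ)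
          (d.inst.code 0 ((d.dpAt σ).2 - d.inst.m + 1)))
        (d.index (d.tOf σ + 1) (d.cOf σ + 1) (d.βOf σ) (d.qpOf σ)
          (d.inst.code ((d.dpAt σ).2 - d.inst.m + 1) 0))
  else .choose (d.inst.box hn (d.inst.finalBox (d.cOf σ) (d.βOf σ) (d.dpAt σ).2))

namespace Expr

/-- `a` for tests of the current box, `b` for tests of the next box, `c` for a final choice. -/
def outCases (σ a b c : Expr) : Expr :=
  ite (lt (tableAt 3 σ) (reg 1)) a (ite (lt (sub (tableAt 3 σ) (reg 1)) (reg 1)) b c)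

def outKind (σ : Expr) : Expr := outCases σ (lit 1) (lit 1) (lit 0)
def outBox (σ : Expr) : Expr :=
  mod (outCases σ (cOf σ) (add (cOf σ) (lit 1))
    (ite (eq (tableAt 3 σ) (twice (reg 1))) (βOf σ)
      (ite (eq (tableAt 3 σ) (add (twice (reg 1)) (lit 1))) (cOf σ) (add (cOf σ) (lit 1))))) (reg 0)
def outValue (σ : Expr) : Expr :=
  outCases σ (tableAt 3 σ) (sub (tableAt 3 σ) (reg 1)) (lit 0)
def outNeg (σ : Expr) : Expr :=
  outCases σ (retestNeg σ (tableAt 3 σ)) (moveNeg σ (sub (tableAt 3 σ) (reg 1))) (lit 0)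
def outPos (σ : Expr) : Expr :=
  outCases σ (retestPos σ (tableAt 3 σ)) (movePos σ (sub (tableAt 3 σ) (reg 1))) (lit 0)

theorem encode_entryAt {d : Data} {s : Store} (hs : d.Ready s) (hT : d.HasTables d.K s)
    (hn : 0 < d.n) {σ : Expr} (hU : d.HasStates 0 s) (hσ : σ.eval s < d.N) :
    (d.entryAt hn (σ.eval s)).encode = [(outKind σ).eval s, (outBox σ).eval s,
      (outValue σ).eval s, (outNeg σ).eval s, (outPos σ).eval s] := by
  have ho : (tableAt 3 σ).eval s = (d.dpAt (σ.eval s)).2 := by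
    rw [tableAt, eval_cell, eval_address hs, (hU _ (Nat.zero_le _) hσ).2]
  have hcases : ∀ a b c : Expr, (outCases σ a b c).eval s =
      if (d.dpAt (σ.eval s)).2 < d.m then a.eval s else
        if (d.dpAt (σ.eval s)).2 - d.m < d.m then b.eval s else c.eval s := fun a b c => by
    rw [outCases, eval_ite _ _ _ (eval_lt ..), eval_ite _ _ _ (eval_lt ..), eval_sub, ho, eval_reg,
      hs.reg_one]
  have hbox : (ite (eq (tableAt 3 σ) (twice (reg 1))) (βOf σ)
      (ite (eq (tableAt 3 σ) (add (twice (reg 1)) (lit 1))) (cOf σ)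
        (add (cOf σ) (lit 1)))).eval s =
      d.inst.finalBox (d.cOf (σ.eval s)) (d.βOf (σ.eval s)) (d.dpAt (σ.eval s)).2 := by
    rw [eval_ite _ _ _ (eval_eq ..), eval_ite _ _ _ (eval_eq ..)]
    simp only [twice, eval_add, eval_mul, eval_lit, eval_reg, hs.reg_one, ho, eval_cOf hs,
      eval_βOf hs]
    rfl
  rw [outKind, outBox, eval_mod, outValue, outNeg, outPos, hcases, hcases, hcases, hcases, hcases,
    hbox, eval_retestNeg hs, eval_retestPos hs, moveNeg, movePos, eval_moveTo hs hT,
    eval_moveTo hs hT, eval_code hs, eval_code hs, eval_sub, ho]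
  simp only [eval_add, eval_sub, eval_lit, eval_reg, hs.reg_one, hs.reg_zero, ho, eval_cOf hs]
  unfold Data.entryAt
  have hm : d.inst.m = d.m := rfl
  split_ifs <;> first | rfl | (exfalso; omega)

end Expr

/-! ### The program -/

namespace Program

open ThresholdTesting.Expr

/-- The time of a program without loops and branches. -/
def weight : Program → ℕ
  | assign _ e => e.weight + 1
  | store a e => a.weight + e.weight + 1
  | emit e => e.weight + 1
  | seq P Q => P.weight + Q.weight
  | _ => 0

def initBefore : Program :=
  seq (assign 0 (cell (lit 0))) (seq (assign 1 (cell (lit 1)))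
    (seq (assign 2 (lit 1)) (assign 3 (lit 1))))
def initBody : Program :=
  seq (assign 2 (mul (reg 2) (inputAt 5 (reg 10)))) (assign 3 (mul (reg 3) (inputAt 3 (reg 10))))

/-- Compute the common denominators. -/
def init : Program := seq initBefore (forLoop 10 (reg 1) initBody)

def tablesBefore : Program := seq (assign 12 (lit 0)) (assign 13 (lit 0))
def tablesBody : Program :=
  seq (assign 12 (add (reg 12) (mul (inInterval (div (reg 11) bound) (mod (reg 11) bound) (reg 10))
      (prob (reg 10)))))
    (assign 13 (add (reg 13) (mul (inInterval (div (reg 11) bound) (mod (reg 11) bound) (reg 10))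
      (mul (prob (reg 10)) (value (reg 10))))))
def tablesAfter : Program :=
  seq (store (address 0 (reg 11)) (reg 12)) (store (address 1 (reg 11)) (reg 13))

/-- Compute the weights and weighted sums of all intervals. -/
def tables : Program :=
  forLoop 11 numCodes (seq tablesBefore (seq (forLoop 10 (reg 1) tablesBody) tablesAfter))

/-- The states are treated in decreasing order. -/
def stateExpr : Expr := sub (sub numStates (lit 1)) (reg 11)
def numOptions : Expr := add (twice (reg 1)) (lit 3)

def statesBefore : Program :=
  seq (assign 12 (lit 0)) (assign 13 (add (twice (reg 1)) (lit 1)))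
-- The option in register `13` is updated first, because both comparisons need the old maximum in
-- register `12`.
def statesBody : Program :=
  seq (assign 13 (ite (lt (reg 12) (valAt stateExpr (reg 10))) (reg 10) (reg 13)))
    (assign 12 (ite (lt (reg 12) (valAt stateExpr (reg 10))) (valAt stateExpr (reg 10)) (reg 12)))
def statesAfter : Program :=
  seq (store (address 2 stateExpr) (reg 12)) (store (address 3 stateExpr) (reg 13))

/-- Compute the optimal values and options of all states. -/
def states : Program :=
  forLoop 11 numStates (seq statesBefore (seq (forLoop 10 numOptions statesBody) statesAfter))

def outputBody : Program :=
  seq (emit (outKind (reg 11))) (seq (emit (outBox (reg 11))) (seq (emit (outValue (reg 11)))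
    (seq (emit (outNeg (reg 11))) (emit (outPos (reg 11))))))

/-- Write the table. -/
def output : Program := forLoop 11 numStates outputBody

/-- The program that computes an optimal sequential algorithm. -/
def solve : Program := seq init (seq tables (seq states output))

end Program

section Execution

open ThresholdTesting.Expr Program

variable {d : Data} {X : ℕ} {s : Store}

theorem eval_stateExpr (hs : d.Ready s) {i : ℕ} (h11 : s.reg 11 = i) :
    stateExpr.eval s = d.N - 1 - i := by
  rw [stateExpr, eval_sub, eval_sub, eval_numStates hs, eval_lit, eval_reg, h11]

variable (hX : d.Fits X)
include hX

theorem exec_init (hs : d.HasInput s) (ho : s.out = []) :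
    Exec X init s (initBefore.weight + forTime 10 (reg 1) d.m initBody.weight)
      fun s' => d.Ready s' ∧ s'.out = [] := by
  have h2 := hX.two_le
  have hm : d.m ≤ X := by have := hX.m_le; omega
  unfold init initBefore
  refine Exec.seq (Exec.seq (Exec.assign h2 ?_ (Exec.seq (Exec.assign h2 ?_
    (Exec.seq (Exec.assign h2 ?_ (Exec.assign h2 ?_ ?_)))))))
  · simpa only [eval_cell, eval_lit, hs.n_eq] using hX.n_le
  · simpa only [eval_cell, eval_lit, hs.m_eq] using hm
  · simp only [eval_lit]; omega
  · simp only [eval_lit]; omega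
  simp only [eval_cell, eval_lit, hs.n_eq, hs.m_eq]
  refine Exec.forLoop h2 hm (fun i s => d.HasInput s ∧ s.reg 0 = d.n ∧ s.reg 1 = d.m ∧
    s.reg 2 = ∏ j ∈ Finset.range i, d.pd j ∧ s.reg 3 = ∏ j ∈ Finset.range i, d.vd j ∧
    s.reg 10 = i ∧ s.out = []) (fun i s h => h.2.2.2.2.2.1) (fun i s h => h.2.2.1) ?_ ?_ ?_
  · exact ⟨hs.congr fun _ _ => rfl, by simp, by simp, by simp, by simp, by simp, ho⟩
  · rintro i s hi ⟨hin, e0, e1, e2, e3, e10, eo⟩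
    have hp : (mul (reg 2) (inputAt 5 (reg 10))).eval s =
        ∏ j ∈ Finset.range (i + 1), d.pd j := by
      rw [Finset.prod_range_succ]
      simp only [inputAt, eval_mul, eval_reg, eval_cell, eval_add, eval_lit, e2, e10,
        hin.pd_eq i hi]
    have hv : (mul (reg 3) (inputAt 3 (reg 10))).eval s =
        ∏ j ∈ Finset.range (i + 1), d.vd j := by
      rw [Finset.prod_range_succ]
      simp only [inputAt, eval_mul, eval_reg, eval_cell, eval_add, eval_lit, e3, e10,
        hin.vd_eq i hi]
    have hsub : Finset.range (i + 1) ⊆ Finset.range d.m := Finset.range_subset_range.mpr hi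
    unfold initBody
    refine Exec.seq (Exec.assign h2 ?_ ?_)
    · rw [hp]
      -- Denominators are at least `1`, so partial products do not exceed the full one.
      exact (Finset.prod_le_prod_of_subset_of_one_le' hsub fun j hj _ =>
        hX.pd_pos j (Finset.mem_range.mp hj)).trans hX.pden_le
    · have hv' : (mul (reg 3) (inputAt 3 (reg 10))).eval
          { s with reg := Function.update s.reg 2 ((mul (reg 2) (inputAt 5 (reg 10))).eval s) } =
          ∏ j ∈ Finset.range (i + 1), d.vd j := by
        rw [← hv]
        simp [inputAt, eval_mul, eval_reg, eval_cell, eval_add, eval_lit]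
      refine Exec.assign h2 ?_ ?_
      · rw [hv']
        exact (Finset.prod_le_prod_of_subset_of_one_le' hsub fun j hj _ =>
          hX.vd_pos j (Finset.mem_range.mp hj)).trans hX.vden_le
      · rw [hv', hp]
        exact ⟨by simp [e10], hin.congr fun _ _ => rfl, by simp [e0], by simp [e1], by simp,
          by simp, by simp, eo⟩
  · rintro s ⟨hin, e0, e1, e2, e3, -, eo⟩
    exact ⟨⟨hin, e0, e1, e2, e3⟩, eo⟩

theorem exec_tables (hs : d.Ready s) (ho : s.out = []) :
    Exec X tables s (forTime 11 numCodes d.K (tablesBefore.weight +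
      (forTime 10 (reg 1) d.m tablesBody.weight + tablesAfter.weight)))
      fun s' => d.Ready s' ∧ d.HasTables d.K s' ∧ s'.out = [] := by
  have h2 := hX.two_le
  have hm : d.m ≤ X := by have := hX.m_le; omega
  refine Exec.forLoop h2 hX.K_le (fun q s => d.Ready s ∧ d.HasTables q s ∧ s.reg 11 = q ∧
    s.out = []) (fun q s h => h.2.2.1) (fun q s h => eval_numCodes h.1) ?_ ?_ ?_
  · exact ⟨hs.update_reg (by norm_num) _, fun q hq => absurd hq (Nat.not_lt_zero q), by simp, ho⟩
  · rintro q s hq ⟨hr, ht, e11, eo⟩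
    unfold tablesBefore
    refine Exec.seq (Exec.seq (Exec.assign h2 ?_ (Exec.assign h2 ?_ ?_)))
    · simp only [eval_lit]; omega
    · simp only [eval_lit]; omega
    refine Exec.seq (Exec.forLoop h2 hm (fun i s => d.Ready s ∧ d.HasTables q s ∧ s.reg 11 = q ∧
      s.out = [] ∧ s.reg 10 = i ∧
      s.reg 12 = ∑ j ∈ Finset.range i, (if d.inst.InInterval q j then d.inst.p j else 0) ∧
      s.reg 13 = ∑ j ∈ Finset.range i,
        (if d.inst.InInterval q j then d.inst.p j * d.inst.v j else 0))
      (fun i s h => h.2.2.2.2.1) (fun i s h => h.1.reg_one) ?_ ?_ ?_)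
    · exact ⟨((hr.update_reg (by norm_num) _).update_reg (by norm_num) _).update_reg
        (by norm_num) _, ht, by simp [e11], eo, by simp, by simp [eval_lit], by simp [eval_lit]⟩
    · rintro i s hi ⟨hr, ht, e11, eo, e10, e12, e13⟩
      have key : ∀ {s : Store}, d.Ready s → s.reg 11 = q → s.reg 10 = i →
          (inInterval (div (reg 11) bound) (mod (reg 11) bound) (reg 10)).eval s =
            (if d.inst.InInterval q i then 1 else 0) ∧
          (prob (reg 10)).eval s = d.inst.p i ∧ (value (reg 10)).eval s = d.inst.v i := by
        intro s hr e11 e10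
        have hj : (reg 10).eval s < d.m := by rwa [eval_reg, e10]
        have e := eval_inInterval (l := div (reg 11) bound) (h := mod (reg 11) bound) hr hq hj
          (by rw [eval_div, eval_bound hr, eval_reg, e11])
          (by rw [eval_mod, eval_bound hr, eval_reg, e11])
        have e' := eval_prob hr hj
        have e'' := eval_value hr hj
        rw [eval_reg, e10] at e e' e''
        exact ⟨e, e', e''⟩
      have hsub : Finset.range (i + 1) ⊆ Finset.range d.m := Finset.range_subset_range.mpr hi
      have hw : (add (reg 12) (mul (inInterval (div (reg 11) bound) (mod (reg 11) bound) (reg 10))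
          (prob (reg 10)))).eval s = ∑ j ∈ Finset.range (i + 1),
            (if d.inst.InInterval q j then d.inst.p j else 0) := by
        obtain ⟨k1, k2, -⟩ := key hr e11 e10
        rw [eval_add, eval_mul, k1, k2, eval_reg, e12, Finset.sum_range_succ]
        simp
      have hle : ∑ j ∈ Finset.range (i + 1), (if d.inst.InInterval q j then d.inst.p j else 0) ≤
          X := by
        refine (Finset.sum_le_sum_of_subset hsub).trans ((d.inst.W_le q).trans ?_)
        rw [hX.W_zero]
        exact hX.pden_le
      obtain ⟨w, hw'⟩ : ∃ w, w = ∑ j ∈ Finset.range (i + 1),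
        (if d.inst.InInterval q j then d.inst.p j else 0) := ⟨_, rfl⟩
      rw [← hw'] at hw hle
      have hr' := hr.update_reg (x := 12) (by norm_num) w
      have hv : (add (reg 13) (mul (inInterval (div (reg 11) bound) (mod (reg 11) bound) (reg 10))
          (mul (prob (reg 10)) (value (reg 10))))).eval
            { s with reg := Function.update s.reg 12 w } =
          ∑ j ∈ Finset.range (i + 1),
            (if d.inst.InInterval q j then d.inst.p j * d.inst.v j else 0) := by
        obtain ⟨k1, k2, k3⟩ := key hr' (by simp [e11]) (by simp [e10])
        rw [eval_add, eval_mul, eval_mul, k1, k2, k3, eval_reg, Finset.sum_range_succ, ← e13]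
        simp
      unfold tablesBody
      refine Exec.seq (Exec.assign h2 ?_ (Exec.assign h2 ?_ ?_))
      · rw [hw]; exact hle
      · rw [hw, hv]
        exact (Finset.sum_le_sum_of_subset hsub).trans ((d.inst.S_le q).trans hX.S_le)
      · rw [hw, hv]
        exact ⟨by simp [e10], (hr'.update_reg (by norm_num) _).update_reg (by norm_num) _, ht,
          by simp [e11], eo, by simp, by simp [← hw'], by simp⟩
    · rintro s ⟨hr, ht, e11, eo, -, e12, e13⟩
      have e12' : s.reg 12 = d.inst.W q := e12
      have e13' : s.reg 13 = d.inst.S q := e13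
      have a0 : (address 0 (reg 11)).eval s = 4 * d.m + 2 + (8 * q + 0) := by
        rw [eval_address hr, eval_reg, e11]
      unfold tablesAfter
      refine Exec.seq (Exec.store h2 ?_ ?_)
      · rw [eval_reg, e12']
        exact (d.inst.W_le q).trans (hX.W_zero.le.trans hX.pden_le)
      · have hr' := hr.update_cell (a := 4 * d.m + 2 + (8 * q + 0)) (by omega) (d.inst.W q)
        have ht' := ht.update_cell (a := 4 * d.m + 2 + (8 * q + 0))
          (fun _ _ => ⟨by omega, by omega⟩) (d.inst.W q)
        rw [a0, eval_reg, e12']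
        have a1 : (address 1 (reg 11)).eval
            { s with cell := Function.update s.cell (4 * d.m + 2 + (8 * q + 0)) (d.inst.W q) } =
              4 * d.m + 2 + (8 * q + 1) := by
          rw [eval_address hr', eval_reg, e11]
        refine Exec.store h2 ?_ ?_
        · rw [eval_reg]
          exact le_of_eq_of_le e13' ((d.inst.S_le q).trans hX.S_le)
        · rw [a1, eval_reg]
          refine ⟨e11, (hr'.update_cell (by omega) _).update_reg (by norm_num) _, ?_, by simp, eo⟩
          have ht'' := ht'.update_cell (a := 4 * d.m + 2 + (8 * q + 1))
            (fun _ _ => ⟨by omega, by omega⟩) (s.reg 13)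
          intro q' hq'
          rcases Nat.lt_succ_iff_lt_or_eq.mp hq' with h | rfl
          · exact ht'' q' h
          · refine ⟨?_, ?_⟩
            · simp
            · simp [e13']
  · rintro s ⟨hr, ht, -, eo⟩
    exact ⟨hr, ht, eo⟩

theorem exec_states (hs : d.Ready s) (hT : d.HasTables d.K s) (ho : s.out = []) :
    Exec X states s (forTime 11 numStates d.N (statesBefore.weight +
      (forTime 10 numOptions (2 * d.m + 3) statesBody.weight + statesAfter.weight)))
      fun s' => d.Ready s' ∧ d.HasTables d.K s' ∧ d.HasStates 0 s' ∧ s'.out = [] := by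
  have h2 := hX.two_le
  have hm := hX.m_le
  have hopt : ∀ {s}, d.Ready s → numOptions.eval s = 2 * d.m + 3 := fun hr => by
    simp only [numOptions, twice, eval_add, eval_mul, eval_lit, eval_reg, hr.reg_one]
  refine Exec.forLoop h2 hX.N_le (fun i s => d.Ready s ∧ d.HasTables d.K s ∧
    d.HasStates (d.N - i) s ∧ s.reg 11 = i ∧ s.out = []) (fun i s h => h.2.2.2.1)
    (fun i s h => eval_numStates h.1) ?_ ?_ ?_
  · exact ⟨hs.update_reg (by norm_num) _, hT, fun σ h1 h2 => by omega, by simp, ho⟩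
  · rintro i s hi ⟨hr, ht, hu, e11, eo⟩
    -- Iteration `i` treats the `i`-th state from the end; the states from `σ + 1` on are done.
    set σ := d.N - 1 - i with hσ
    have hσN : d.N - i = σ + 1 := by omega
    rw [hσN] at hu
    unfold statesBefore
    refine Exec.seq (Exec.seq (Exec.assign h2 ?_ (Exec.assign h2 ?_ ?_)))
    · simp only [eval_lit]; omega
    · simp only [twice, eval_add, eval_mul, eval_lit, eval_reg]
      simp [hr.reg_one]
      omega
    refine Exec.seq (Exec.forLoop h2 hm (fun o s => d.Ready s ∧ d.HasTables d.K s ∧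
      d.HasStates (σ + 1) s ∧ s.reg 11 = i ∧ s.out = [] ∧ s.reg 10 = o ∧
      s.reg 12 = (argmax (d.valAt σ) (2 * d.m + 1) o).1 ∧
      s.reg 13 = (argmax (d.valAt σ) (2 * d.m + 1) o).2)
      (fun i s h => h.2.2.2.2.2.1) (fun i s h => hopt h.1) ?_ ?_ ?_)
    · refine ⟨((hr.update_reg (by norm_num) _).update_reg (by norm_num) _).update_reg
        (by norm_num) _, ht, hu, by simp [e11], eo, by simp, by simp [eval_lit, argmax], ?_⟩
      simp [eval_lit, argmax, twice, eval_add, eval_mul, eval_reg, hr.reg_one]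
    · rintro o s hoo ⟨hr, ht, hu, e11, eo, e10, e12, e13⟩
      have key : ∀ {s : Store}, d.Ready s → d.HasTables d.K s → d.HasStates (σ + 1) s →
          s.reg 11 = i → s.reg 10 = o → (valAt stateExpr (reg 10)).eval s = d.valAt σ o := by
        intro s hr ht hu e11 e10
        have hse := eval_stateExpr hr e11
        rw [eval_valAt hr ht hX (by rw [hse]; exact hu), hse, eval_reg, e10]
      -- Running maxima are bounded by the final one, which fits by `dp_le`.
      have hle : ∀ o', o' ≤ 2 * d.m + 3 →
          (argmax (d.valAt σ) (2 * d.m + 1) o').1 ≤ X ∧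
          (argmax (d.valAt σ) (2 * d.m + 1) o').2 ≤ X := by
        intro o' ho'
        constructor
        · refine argmax_le fun o'' h'' => ?_
          refine le_trans ?_ (hX.dp_le σ)
          rw [d.dpAt_eq]
          exact le_argmax (by omega)
        · rcases argmax_spec (d.valAt σ) (2 * d.m + 1) o' with h | h
          · rw [h.2]; omega
          · have := h.1; omega
      have hstep : argmax (d.valAt σ) (2 * d.m + 1) (o + 1) =
          if (argmax (d.valAt σ) (2 * d.m + 1) o).1 < d.valAt σ o then (d.valAt σ o, o)
          else argmax (d.valAt σ) (2 * d.m + 1) o := rfl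
      have hv1 : (ite (lt (reg 12) (valAt stateExpr (reg 10))) (reg 10) (reg 13)).eval s =
          (argmax (d.valAt σ) (2 * d.m + 1) (o + 1)).2 := by
        rw [eval_ite _ _ _ (eval_lt ..), key hr ht hu e11 e10, eval_reg, eval_reg, eval_reg, e12,
          e13, e10, hstep]
        split_ifs <;> rfl
      obtain ⟨w, hw⟩ : ∃ w, w = (argmax (d.valAt σ) (2 * d.m + 1) (o + 1)).2 := ⟨_, rfl⟩
      rw [← hw] at hv1
      set s1 : Store := { s with reg := Function.update s.reg 13 w } with hs1
      have hr1 : d.Ready s1 := hr.update_reg (by norm_num) _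
      have hv2 : (ite (lt (reg 12) (valAt stateExpr (reg 10))) (valAt stateExpr (reg 10))
          (reg 12)).eval s1 = (argmax (d.valAt σ) (2 * d.m + 1) (o + 1)).1 := by
        have e12' : s1.reg 12 = (argmax (d.valAt σ) (2 * d.m + 1) o).1 := by simp [hs1, e12]
        rw [eval_ite _ _ _ (eval_lt ..),
          key hr1 ht hu (by simp [hs1, e11]) (by simp [hs1, e10]), eval_reg, e12', hstep]
        split_ifs <;> rfl
      unfold statesBody
      refine Exec.seq (Exec.assign h2 ?_ ?_)
      · rw [hv1, hw]; exact (hle _ (by omega)).2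
      · rw [hv1]
        refine Exec.assign h2 ?_ ?_
        · rw [hv2]; exact (hle _ (by omega)).1
        · rw [hv2]
          exact ⟨by simp [e10], (hr1.update_reg (by norm_num) _).update_reg (by norm_num) _,
            ht, hu, by simp [e11], eo, by simp, by simp, by simp [← hw]⟩
    · rintro s ⟨hr, ht, hu, e11, eo, -, e12, e13⟩
      rw [← d.dpAt_eq] at e12 e13
      have hse := eval_stateExpr hr e11
      have a2 : (address 2 stateExpr).eval s = 4 * d.m + 2 + (8 * σ + 2) := by
        rw [eval_address hr, hse]
      unfold statesAfter
      refine Exec.seq (Exec.store h2 ?_ ?_)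
      · rw [eval_reg, e12]; exact hX.dp_le σ
      · have hr' := hr.update_cell (a := 4 * d.m + 2 + (8 * σ + 2)) (by omega) (d.dpAt σ).1
        have ht' := ht.update_cell (a := 4 * d.m + 2 + (8 * σ + 2))
          (fun _ _ => ⟨by omega, by omega⟩) (d.dpAt σ).1
        rw [a2, eval_reg, e12]
        have a3 : (address 3 stateExpr).eval
            { s with cell := Function.update s.cell (4 * d.m + 2 + (8 * σ + 2)) (d.dpAt σ).1 } =
              4 * d.m + 2 + (8 * σ + 3) := by
          rw [eval_address hr', eval_stateExpr hr' e11]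
        refine Exec.store h2 ?_ ?_
        · rw [eval_reg]
          refine le_of_eq_of_le e13 ?_
          rw [d.dpAt_eq]
          rcases argmax_spec (d.valAt σ) (2 * d.m + 1) (2 * d.m + 3) with h | h
          · rw [h.2]; omega
          · have := h.1; omega
        · rw [a3, eval_reg]
          refine ⟨e11, (hr'.update_cell (by omega) _).update_reg (by norm_num) _,
            ht'.update_cell (fun _ _ => ⟨by omega, by omega⟩) _, ?_, by simp, eo⟩
          intro σ' h1 h3
          have h1' : σ ≤ σ' := by omega
          rcases eq_or_lt_of_le h1' with rfl | h4
          · refine ⟨?_, ?_⟩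
            · simp
            · simp [e13]
          · have hu' := hu σ' h4 h3
            refine ⟨Eq.trans ?_ hu'.1, Eq.trans ?_ hu'.2⟩
            · exact (Function.update_of_ne (by omega) _ _).trans
                (Function.update_of_ne (by omega) _ _)
            · exact (Function.update_of_ne (by omega) _ _).trans
                (Function.update_of_ne (by omega) _ _)
  · rintro s ⟨hr, ht, hu, -, eo⟩
    rw [Nat.sub_self] at hu
    exact ⟨hr, ht, hu, eo⟩

theorem exec_output (hs : d.Ready s) (hT : d.HasTables d.K s) (hU : d.HasStates 0 s)
    (ho : s.out = []) :
    Exec X output s (forTime 11 numStates d.N outputBody.weight)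
      fun s' => s'.out = ((List.range d.N).map (d.entryAt hX.n_pos)).flatMap Entry.encode := by
  have h2 := hX.two_le
  refine Exec.forLoop h2 hX.N_le (fun i s => d.Ready s ∧ d.HasTables d.K s ∧
    d.HasStates 0 s ∧ s.reg 11 = i ∧
    s.out = ((List.range i).map (d.entryAt hX.n_pos)).flatMap Entry.encode)
    (fun i s h => h.2.2.2.1) (fun i s h => eval_numStates h.1) ?_ ?_ ?_
  · exact ⟨hs.update_reg (by norm_num) _, hT, hU, by simp, by simpa using ho⟩
  · rintro i s hi ⟨hr, ht, hu, e11, eo⟩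
    -- The output tape is write-only, so the five numbers of a block do not depend on what was
    -- already emitted.
    have hev : ∀ (e : Expr) (l : List ℕ), e.eval { s with out := l } = e.eval s := by
      intro e l
      induction e with
      | lit => rfl
      | reg => rfl
      | cell e ih => simp only [eval, ih]
      | op o a b iha ihb => simp only [eval, iha, ihb]
    have henc := encode_entryAt (σ := reg 11) hr ht hX.n_pos hu (by rw [eval_reg, e11]; exact hi)
    rw [eval_reg, e11] at henc
    unfold outputBody
    refine Exec.seq (Exec.emit h2 (Exec.seq (Exec.emit h2 (Exec.seq (Exec.emit h2 (Exec.seq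
      (Exec.emit h2 (Exec.emit h2 ?_))))))))
    refine ⟨e11, hr.congr (fun y hy => Function.update_of_ne (by omega) _ _) fun _ _ => rfl, ht,
      hu, by simp, ?_⟩
    simp only [hev, List.range_succ, List.map_append, List.flatMap_append, ← eo, List.map_cons,
      List.map_nil, List.flatMap_cons, List.flatMap_nil, henc, List.append_assoc, List.append_nil,
      List.cons_append, List.nil_append]
  · rintro s ⟨-, -, -, -, eo⟩
    exact eo

/-- The running time of the program in units of the binary length of the largest number. -/
def _root_.ThresholdTesting.Data.time (d : Data) : ℕ :=
  (initBefore.weight + forTime 10 (reg 1) d.m initBody.weight) +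
    (forTime 11 numCodes d.K (tablesBefore.weight +
      (forTime 10 (reg 1) d.m tablesBody.weight + tablesAfter.weight)) +
    (forTime 11 numStates d.N (statesBefore.weight +
      (forTime 10 numOptions (2 * d.m + 3) statesBody.weight + statesAfter.weight)) +
    forTime 11 numStates d.N outputBody.weight))

theorem exec_solve (hs : d.HasInput s) (ho : s.out = []) :
    Exec X solve s d.time
      fun s' => s'.out = ((List.range d.N).map (d.entryAt hX.n_pos)).flatMap Entry.encode := by
  unfold solve Data.time
  refine Exec.seq ((exec_init hX hs ho).mono le_rfl fun s1 h1 => ?_)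
  refine Exec.seq ((exec_tables hX h1.1 h1.2).mono le_rfl fun s2 h2 => ?_)
  refine Exec.seq ((exec_states hX h2.1 h2.2.1 h2.2.2).mono le_rfl fun s3 h3 => ?_)
  exact exec_output hX h3.1 h3.2.1 h3.2.2.1 h3.2.2.2

end Execution

/-! ### Bounds on the numbers and the running time -/

namespace Data

variable {d : Data}

/-- The plain product of all denominators is no longer than the input, so it can serve as a common
denominator without computing a least one. -/
theorem prod_le_two_pow {ι : Type*} (t : Finset ι) (f : ι → ℕ) :
    ∏ j ∈ t, f j ≤ 2 ^ ∑ j ∈ t, (f j).size := by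
  rw [← Finset.prod_pow_eq_pow_sum]
  exact Finset.prod_le_prod' fun j _ => (Nat.lt_size_self (f j)).le

/-- The binary length of the largest number that occurs for an input of size `z`. -/
def maxLength (z : ℕ) : ℕ := z * z + 7 * z + 2

/-- The values of the dynamic program dominate the exponent: `z` factors `2 * W 0 ≤ 2 ^ (z + 1)` and
a final factor of at most `2 ^ (5 * z)` give `z * z + 6 * z`. The number of states needs `7 * z`. -/
theorem fits {z : ℕ} (hn : 0 < d.n) (hpd : ∀ j < d.m, 0 < d.pd j) (hvd : ∀ j < d.m, 0 < d.vd j)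
    (hW : d.inst.W 0 = d.pden) (hnz : d.n ≤ z) (hmz : d.m ≤ z) (hp : d.pden ≤ 2 ^ z)
    (hv : d.vden ≤ 2 ^ z) (hvn : ∀ j < d.m, d.vn j ≤ 2 ^ z) : d.Fits (2 ^ maxLength z) := by
  have hz : z + 1 ≤ 2 ^ z := Nat.lt_two_pow_self
  have hle : ∀ {a k : ℕ}, a ≤ 2 ^ k → k ≤ maxLength z → a ≤ 2 ^ maxLength z := fun h hk =>
    h.trans (Nat.pow_le_pow_right (by norm_num) hk)
  have hm1 : d.m + 1 ≤ 2 ^ z := by omega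
  have hn1 : d.n + 1 ≤ 2 ^ z := by omega
  have hn0 : d.n ≤ 2 ^ z := by omega
  have hK : d.K ≤ 2 ^ (2 * z) := by
    rw [two_mul, pow_add]
    exact Nat.mul_le_mul hm1 hm1
  have hS : d.inst.S 0 ≤ 2 ^ (3 * z) := by
    calc d.inst.S 0 ≤ d.inst.W 0 * 2 ^ (2 * z) := by
          rw [Inst.S, Inst.W, Finset.sum_mul]
          refine Finset.sum_le_sum fun j hj => ?_
          split_ifs
          · refine Nat.mul_le_mul_left _ ?_
            rw [two_mul, pow_add]
            exact Nat.mul_le_mul (hvn j (Finset.mem_range.mp hj))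
              ((Nat.div_le_self _ _).trans hv)
          · simp
      _ ≤ 2 ^ z * 2 ^ (2 * z) := by rw [hW]; gcongr
      _ = 2 ^ (3 * z) := by ring
  refine ⟨hle (k := 1) le_rfl (by unfold maxLength; omega), hn, hpd, hvd, hW,
    hle hn0 (by unfold maxLength; nlinarith), hle (k := z + 2) ?_ (by unfold maxLength; nlinarith),
    hle hp (by unfold maxLength; nlinarith), hle hv (by unfold maxLength; nlinarith),
    hle hK (by unfold maxLength; nlinarith), hle (k := 7 * z) ?_ (by unfold maxLength; nlinarith),
    hle hS (by unfold maxLength; nlinarith), fun σ => hle (k := z * z + 6 * z) ?_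
      (by unfold maxLength; omega)⟩
  · rw [pow_add]; omega
  · calc d.N ≤ 2 ^ z * 2 ^ z * 2 ^ z * 2 ^ (2 * z) * 2 ^ (2 * z) := by unfold N; gcongr
      _ = 2 ^ (7 * z) := by ring
  · calc (d.dpAt σ).1 ≤ (2 * d.inst.W 0) ^ (d.n - d.tOf σ) *
          (d.inst.S 0 * d.inst.W 0 * d.inst.W 0) := Inst.dp_fst_le _ _ _ _ _
      _ ≤ (2 ^ (z + 1)) ^ z * (2 ^ (3 * z) * 2 ^ z * 2 ^ z) := by
          rw [hW]
          have h1 : 2 * d.pden ≤ 2 ^ (z + 1) := by rw [pow_succ]; omega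
          have h2 : d.n - d.tOf σ ≤ z := by omega
          have h3 : 1 ≤ 2 ^ (z + 1) := Nat.one_le_two_pow
          gcongr ?_ * (?_ * ?_ * ?_)
          exact (Nat.pow_le_pow_left h1 _).trans (Nat.pow_le_pow_right h3 h2)
      _ = 2 ^ (z * z + 6 * z) := by ring

end Data

/-- The function `f` is bounded by a polynomial in `size`. -/
def PolyBounded {ι : Type} (size f : ι → ℕ) : Prop :=
  ∃ q : Polynomial ℕ, ∀ i, f i ≤ q.eval (size i)

namespace PolyBounded

variable {ι : Type} {size f g : ι → ℕ}

theorem const (c : ℕ) : PolyBounded size fun _ => c := ⟨.C c, fun _ => by simp⟩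

theorem of_le (h : ∀ i, f i ≤ size i) : PolyBounded size f := ⟨.X, fun i => by simpa using h i⟩

theorem add (hf : PolyBounded size f) (hg : PolyBounded size g) :
    PolyBounded size fun i => f i + g i := by
  obtain ⟨p, hp⟩ := hf
  obtain ⟨q, hq⟩ := hg
  exact ⟨p + q, fun i => by rw [Polynomial.eval_add]; exact add_le_add (hp i) (hq i)⟩

theorem mul (hf : PolyBounded size f) (hg : PolyBounded size g) :
    PolyBounded size fun i => f i * g i := by
  obtain ⟨p, hp⟩ := hf
  obtain ⟨q, hq⟩ := hg
  exact ⟨p * q, fun i => by rw [Polynomial.eval_mul]; exact Nat.mul_le_mul (hp i) (hq i)⟩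

theorem forTime (x : ℕ) (e : Expr) (hf : PolyBounded size f) (hg : PolyBounded size g) :
    PolyBounded size fun i => forTime x e (f i) (g i) :=
  (const _).add (hf.mul ((hg.add (const _)).add (const _)))

theorem dataTime {D : ι → Data} (hn : PolyBounded size fun i => (D i).n)
    (hm : PolyBounded size fun i => (D i).m) : PolyBounded size fun i => (D i).time := by
  have hK : PolyBounded size fun i => (D i).K := (hm.add (const 1)).mul (hm.add (const 1))
  have hN : PolyBounded size fun i => (D i).N :=
    ((((hn.add (const 1)).mul hn).mul hn).mul hK).mul hK
  exact ((const _).add (forTime _ _ hm (const _))).add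
    ((forTime _ _ hK ((const _).add ((forTime _ _ hm (const _)).add (const _)))).add
      ((forTime _ _ hN ((const _).add ((forTime _ _ (((const 2).mul hm).add (const 3))
        (const _)).add (const _)))).add (forTime _ _ hN (const _))))

end PolyBounded

/-! ### The input -/

theorem getD_flatMap {α : Type*} (f : α → List ℕ) {b k : ℕ} (hf : ∀ a, (f a).length = b)
    (hk : k < b) (l : List α) : ∀ (i : ℕ) (h : i < l.length),
      (l.flatMap f).getD (b * i + k) 0 = (f l[i]).getD k 0 := by
  induction l with
  | nil => intro i h; exact absurd h (Nat.not_lt_zero _)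
  | cons a l ih =>
    intro i h
    rw [List.flatMap_cons]
    cases i with
    | zero =>
      rw [mul_zero, zero_add, List.getD_append _ _ _ _ (by rw [hf]; exact hk)]
      rfl
    | succ i =>
      rw [List.getD_append_right _ _ _ _ (by rw [hf, mul_add]; omega), hf,
        show b * (i + 1) + k - b = b * i + k by rw [mul_add]; omega,
        ih i (by simpa using h)]
      rfl

theorem getD_le {l : List ℕ} {X : ℕ} (h : ∀ x ∈ l, x ≤ X) (a : ℕ) : l.getD a 0 ≤ X := by
  rcases lt_or_ge a l.length with ha | ha
  · rw [List.getD_eq_getElem _ _ ha]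
    exact h _ (List.getElem_mem ha)
  · rw [List.getD_eq_default _ _ ha]
    exact Nat.zero_le _

namespace RatDist

variable (n : ℕ) (G : RatDist)

/-- The input for `n` boxes with distribution `G`. -/
def data : Data where
  n := n
  m := G.m
  vn j := if h : j < G.m then (G.v ⟨j, h⟩).num else 0
  vd j := if h : j < G.m then (G.v ⟨j, h⟩).den else 0
  pn j := if h : j < G.m then (G.p ⟨j, h⟩).num else 0
  pd j := if h : j < G.m then (G.p ⟨j, h⟩).den else 0

theorem data_vn (j : Fin G.m) : (G.data n).vn j = (G.v j).num := dif_pos j.2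
theorem data_vd (j : Fin G.m) : (G.data n).vd j = (G.v j).den := dif_pos j.2
theorem data_pn (j : Fin G.m) : (G.data n).pn j = (G.p j).num := dif_pos j.2
theorem data_pd (j : Fin G.m) : (G.data n).pd j = (G.p j).den := dif_pos j.2

theorem encode_getD (j : Fin G.m) {k : ℕ} (hk : k < 4) :
    (G.encode n).getD (4 * j + k + 2) 0 =
      [(G.v j).num, (G.v j).den, (G.p j).num, (G.p j).den].getD k 0 := by
  have h := getD_flatMap
    (fun j : Fin G.m => [(G.v j).num, (G.v j).den, (G.p j).num, (G.p j).den])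
    (fun _ => rfl) hk (List.finRange G.m) j (by simp)
  rw [List.getElem_finRange] at h
  exact h

theorem hasInput : (G.data n).HasInput (initStore (G.encode n)) where
  n_eq := rfl
  m_eq := rfl
  vn_eq j hj := (G.encode_getD n ⟨j, hj⟩ (k := 0) (by norm_num)).trans
    (G.data_vn n ⟨j, hj⟩).symm
  vd_eq j hj := (G.encode_getD n ⟨j, hj⟩ (k := 1) (by norm_num)).trans
    (G.data_vd n ⟨j, hj⟩).symm
  pn_eq j hj := (G.encode_getD n ⟨j, hj⟩ (k := 2) (by norm_num)).trans
    (G.data_pn n ⟨j, hj⟩).symm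
  pd_eq j hj := (G.encode_getD n ⟨j, hj⟩ (k := 3) (by norm_num)).trans
    (G.data_pd n ⟨j, hj⟩).symm

theorem le_inputSize : n ≤ G.inputSize n := Nat.le_add_right _ _

theorem size_le_inputSize (j : Fin G.m) : (G.v j).num.size ≤ G.inputSize n ∧
    (G.v j).den.size ≤ G.inputSize n ∧ (G.p j).num.size ≤ G.inputSize n ∧
    (G.p j).den.size ≤ G.inputSize n := by
  have h := Finset.single_le_sum (f := fun j => (G.v j).num.size + (G.v j).den.size +
    (G.p j).num.size + (G.p j).den.size) (fun _ _ => Nat.zero_le _) (Finset.mem_univ j)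
  unfold inputSize
  omega

theorem m_le_inputSize : G.m ≤ G.inputSize n := by
  have h : ∑ _j : Fin G.m, 1 ≤ ∑ j, ((G.v j).num.size + (G.v j).den.size + (G.p j).num.size +
      (G.p j).den.size) := by
    refine Finset.sum_le_sum fun j _ => ?_
    have := Nat.size_pos.mpr (G.p j).den_pos
    omega
  rw [Finset.sum_const, Finset.card_univ, Fintype.card_fin, smul_eq_mul, mul_one] at h
  exact h.trans (Nat.le_add_left _ _)

theorem le_two_pow_inputSize {a : ℕ} (h : a.size ≤ G.inputSize n) : a ≤ 2 ^ G.inputSize n :=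
  (Nat.size_le.mp h).le

theorem pden_le : (G.data n).pden ≤ 2 ^ G.inputSize n := by
  refine (Data.prod_le_two_pow _ _).trans (Nat.pow_le_pow_right (by norm_num) ?_)
  rw [← Fin.sum_univ_eq_sum_range (fun j => ((G.data n).pd j).size)]
  refine le_trans (Finset.sum_le_sum fun (j : Fin G.m) _ => ?_) (Nat.le_add_left _ n)
  have := congrArg Nat.size (G.data_pd n j)
  omega

theorem vden_le : (G.data n).vden ≤ 2 ^ G.inputSize n := by
  refine (Data.prod_le_two_pow _ _).trans (Nat.pow_le_pow_right (by norm_num) ?_)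
  rw [← Fin.sum_univ_eq_sum_range (fun j => ((G.data n).vd j).size)]
  refine le_trans (Finset.sum_le_sum fun (j : Fin G.m) _ => ?_) (Nat.le_add_left _ n)
  have := congrArg Nat.size (G.data_vd n j)
  omega

theorem boundedBy : (initStore (G.encode n)).BoundedBy (2 ^ Data.maxLength (G.inputSize n)) := by
  refine ⟨fun _ => Nat.zero_le _, fun a => getD_le (fun x hx => ?_) a⟩
  refine (G.le_two_pow_inputSize n (a := x) ?_).trans (Nat.pow_le_pow_right (by norm_num)
    (by unfold Data.maxLength; nlinarith))
  have hsize : ∀ {a}, a ≤ G.inputSize n → a.size ≤ G.inputSize n := fun h =>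
    Nat.size_le.mpr (h.trans_lt Nat.lt_two_pow_self)
  simp only [encode, List.mem_cons, List.mem_flatMap, List.mem_finRange, true_and,
    List.not_mem_nil, or_false] at hx
  rcases hx with rfl | rfl | ⟨j, rfl | rfl | rfl | rfl⟩
  · exact hsize (G.le_inputSize x)
  · exact hsize (G.m_le_inputSize n)
  · exact (G.size_le_inputSize n j).1
  · exact (G.size_le_inputSize n j).2.1
  · exact (G.size_le_inputSize n j).2.2.1
  · exact (G.size_le_inputSize n j).2.2.2

/-! ### The integral instance -/

theorem cast_mul_div {a b k : ℕ} (hb : b ≠ 0) (h : b ∣ k) :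
    ((a * (k / b) : ℕ) : ℝ) = k * ((a : ℝ) / b) := by
  have hb' : (b : ℝ) ≠ 0 := by exact_mod_cast hb
  rw [Nat.cast_mul, Nat.cast_div h hb']
  ring

theorem cast_inst_v (j : Fin G.m) :
    ((G.data n).inst.v j : ℝ) = (G.data n).vden * G.toFinDist.v j := by
  refine (cast_mul_div ?_ (Finset.dvd_prod_of_mem _ (Finset.mem_range.mpr j.2))).trans ?_
  · rw [data_vd]; exact (G.v j).den_ne_zero
  · rw [data_vd, data_vn]
    congr 1
    exact (NNRat.cast_def _).symm

theorem cast_inst_p (j : Fin G.m) :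
    ((G.data n).inst.p j : ℝ) = (G.data n).pden * G.toFinDist.p j := by
  refine (cast_mul_div ?_ (Finset.dvd_prod_of_mem _ (Finset.mem_range.mpr j.2))).trans ?_
  · rw [data_pd]; exact (G.p j).den_ne_zero
  · rw [data_pd, data_pn]
    congr 1
    exact (NNRat.cast_def _).symm

theorem weight_zero (j : Fin G.m) :
    (G.data n).inst.weight 0 j = (G.data n).pden * G.toFinDist.p j := by
  rw [← cast_inst_p]
  exact if_pos (Inst.inInterval_zero _)

/-- The probabilities sum to `1`, so the scaled ones sum to the common denominator. This is why the
program can use register `2` for the total weight. -/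
theorem W_zero : (G.data n).inst.W 0 = (G.data n).pden := by
  have h := (G.data n).inst.sum_weight 0
  have h' : ∑ j, (G.data n).inst.weight 0 j = (G.data n).pden * ∑ j, G.toFinDist.p j := by
    rw [Finset.mul_sum]
    exact Finset.sum_congr rfl fun j _ => G.weight_zero n j
  rw [G.toFinDist.p_sum, mul_one] at h'
  exact_mod_cast h.symm.trans h'

theorem vd_pos (j : ℕ) (hj : j < (G.data n).m) : 0 < (G.data n).vd j := by
  have := G.data_vd n ⟨j, hj⟩
  exact lt_of_lt_of_eq (G.v ⟨j, hj⟩).den_pos this.symm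

theorem pd_pos (j : ℕ) (hj : j < (G.data n).m) : 0 < (G.data n).pd j := by
  have := G.data_pd n ⟨j, hj⟩
  exact lt_of_lt_of_eq (G.p ⟨j, hj⟩).den_pos this.symm

theorem vden_pos : 0 < (G.data n).vden :=
  Finset.prod_pos fun j hj => G.vd_pos n j (Finset.mem_range.mp hj)

theorem pden_pos : 0 < (G.data n).pden :=
  Finset.prod_pos fun j hj => G.pd_pos n j (Finset.mem_range.mp hj)

variable {n}

theorem fits (hn : 0 < n) : (G.data n).Fits (2 ^ Data.maxLength (G.inputSize n)) :=
  Data.fits hn (G.pd_pos n) (G.vd_pos n) (G.W_zero n) (G.le_inputSize n) (G.m_le_inputSize n)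
    (G.pden_le n) (G.vden_le n) fun j hj => by
      have := G.data_vn n ⟨j, hj⟩
      exact this.le.trans (G.le_two_pow_inputSize n (G.size_le_inputSize n ⟨j, hj⟩).1)

theorem v_le_iff (a j : Fin G.m) :
    G.toFinDist.v a ≤ G.toFinDist.v j ↔ (G.data n).inst.v a ≤ (G.data n).inst.v j := by
  have h : (0 : ℝ) < (G.data n).vden := by exact_mod_cast G.vden_pos n
  rw [← mul_le_mul_iff_right₀ h, ← cast_inst_v, ← cast_inst_v, Nat.cast_le]

/-- Scaling to integers multiplies every reward by the same positive constant, so optimality carries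
over. -/
theorem wreward_eq (A : TestTree n) :
    wreward G.toFinDist.v (G.data n).inst.payoff (fun _ => (G.data n).inst.weight 0) A =
      (G.data n).pden ^ n * (G.data n).vden * A.reward G.toFinDist := by
  unfold TestTree.reward FinDist.expect wreward
  rw [Finset.mul_sum]
  refine Finset.sum_congr rfl fun x _ => ?_
  have h1 : ∏ i, (G.data n).inst.weight 0 (x i) =
      (G.data n).pden ^ n * ∏ i, G.toFinDist.p (x i) := by
    rw [Finset.prod_congr rfl fun i _ => G.weight_zero n (x i), Finset.prod_mul_distrib,
      Finset.prod_const, Finset.card_univ, Fintype.card_fin]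
  refine (congrArg₂ (· * ·) h1 (G.cast_inst_v n _)).trans ?_
  ring

/-- The tree that is described by the output of the program. -/
noncomputable def optimalTree (hn : 0 < n) : TestTree n :=
  (G.data n).inst.tree hn G.toFinDist.v n 0 0 0 0

theorem optimalTree_isOptimal (hn : 0 < n) : (G.optimalTree hn).IsOptimal G.toFinDist := by
  refine TestTree.isOptimal_of_forall_le
    (Inst.tree_isSequentialAlgorithm (I := (G.data n).inst) hn G.toFinDist.v) fun B hB => ?_
  have h := Inst.wreward_le_wreward_tree (I := (G.data n).inst) (val := G.toFinDist.v)
    G.v_le_iff hn (by rw [W_zero]; exact G.pden_pos n) hB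
  have h1 := G.wreward_eq B
  have h2 := G.wreward_eq (G.optimalTree hn)
  have h3 : (0 : ℝ) < (G.data n).pden ^ n * (G.data n).vden := by
    have := G.pden_pos n
    have := G.vden_pos n
    positivity
  exact le_of_mul_le_mul_left (h1.symm.le.trans (h.trans h2.le)) h3

end RatDist

/-! ### The output describes the tree -/

theorem Data.dpAt_index {d : Data} {t c β qp qc : ℕ} (h2 : c < d.n) (h3 : β < d.n)
    (h4 : qp < d.K) (h5 : qc < d.K) :
    d.dpAt (d.index t c β qp qc) = d.inst.dp (d.n - t) c qp qc := by
  rw [dpAt, tOf_index h2 h3 h4 h5, cOf_index h2 h3 h4 h5, qpOf_index h4 h5, qcOf_index h5]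

theorem getElem?_map_range {α : Type*} (f : ℕ → α) {k l : ℕ} (h : k < l) :
    ((List.range l).map f)[k]? = some (f k) := by
  simp [h]

/-- Testing options have final value `0` and are never selected, so the entries of the last layer
are choices. -/
theorem Inst.two_mul_le_dp_zero (I : Inst) (c qp qc : ℕ) : 2 * I.m ≤ (I.dp 0 c qp qc).2 := by
  have h := argmax_spec (I.finalVal c qp qc) (2 * I.m + 1) (2 * I.m + 3)
  rw [show argmax (I.finalVal c qp qc) (2 * I.m + 1) (2 * I.m + 3) = I.dp 0 c qp qc from rfl] at h
  rcases h with h | ⟨-, h2, h3⟩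
  · omega
  · by_contra hlt
    rw [h2, finalVal, if_neg (by omega), if_neg (by omega), if_neg (by omega)] at h3
    exact lt_irrefl _ h3

namespace RatDist

variable {n : ℕ} (G : RatDist)

/-- The table that the program computes. -/
def table (hn : 0 < n) : List (Entry n G.m) :=
  (List.range (G.data n).N).map ((G.data n).entryAt hn)

/-- Induction on the remaining tests, with `t + r = n` tying the digit `t` of a state to the budget.
All successors taken have digits in range; entries that are not reached play no role. -/
theorem describes_tree (hn : 0 < n) (r : ℕ) : ∀ t c β qp qc, t + r = n → c < n → β < n →
    qp < (G.data n).K → qc < (G.data n).K →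
    Describes G.toFinDist (G.table hn) ((G.data n).index t c β qp qc)
      ((G.data n).inst.tree hn G.toFinDist.v r c β qp qc) := by
  have hentry : ∀ {t c β qp qc : ℕ} {e : Entry n G.m}, t ≤ n → c < n → β < n →
      qp < (G.data n).K → qc < (G.data n).K →
      (G.data n).entryAt hn ((G.data n).index t c β qp qc) = e →
      (G.table hn)[(G.data n).index t c β qp qc]? = some e := by
    intro t c β qp qc e h1 h2 h3 h4 h5 he
    have := Data.index_lt_N (d := G.data n) h1 h2 h3 h4 h5
    exact (getElem?_map_range _ this).trans (congrArg some he)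
  induction r with
  | zero =>
    intro t c β qp qc ht hc hβ hqp hqc
    refine Describes.choose (hentry (by omega) hc hβ hqp hqc ?_)
    have hd : (G.data n).dpAt ((G.data n).index t c β qp qc) = (G.data n).inst.dp 0 c qp qc := by
      rw [Data.dpAt_index hc hβ hqp hqc, show (G.data n).n - t = 0 from by
        change n - t = 0; omega]
    have h := Inst.two_mul_le_dp_zero (G.data n).inst c qp qc
    unfold Data.entryAt
    simp only [hd]
    rw [dif_neg (by omega), dif_neg (by omega), Data.cOf_index hc hβ hqp hqc,
      Data.βOf_index hβ hqp hqc]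
    rfl
  | succ r ih =>
    intro t c β qp qc ht hc hβ hqp hqc
    have hd : (G.data n).dpAt ((G.data n).index t c β qp qc) =
        (G.data n).inst.dp (r + 1) c qp qc := by
      rw [Data.dpAt_index hc hβ hqp hqc, show (G.data n).n - t = r + 1 from by
        change n - t = r + 1; omega]
    have hnext : t + 1 + r = n := by omega
    have hk1 : ∀ {j}, j < (G.data n).m → (G.data n).inst.code 0 (j + 1) < (G.data n).K :=
      fun h => Data.code_lt (Nat.zero_le _) h
    have hk2 : ∀ {j}, j < (G.data n).m → (G.data n).inst.code (j + 1) 0 < (G.data n).K :=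
      fun h => Data.code_lt h (Nat.zero_le _)
    have e := hentry (e := (G.data n).entryAt hn ((G.data n).index t c β qp qc))
      (by omega) hc hβ hqp hqc rfl
    unfold Data.entryAt at e
    simp only [hd] at e
    rw [Data.cOf_index hc hβ hqp hqc, Data.βOf_index hβ hqp hqc, Data.qpOf_index hqp hqc,
      Data.qcOf_index hqc, Data.tOf_index hc hβ hqp hqc] at e
    have htree := Inst.tree.eq_2 (I := (G.data n).inst) hn G.toFinDist.v c β qp qc r
    have hcast : ∀ {k : ℕ} {A B : TestTree n}, A = B → Describes G.toFinDist (G.table hn) k B →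
      Describes G.toFinDist (G.table hn) k A := fun h h' => h ▸ h'
    rcases Inst.dp_spec (I := (G.data n).inst) r c qp qc with h | h | h
    · rw [dif_neg (by omega), dif_neg (by omega)] at e htree
      exact hcast htree (Describes.choose e)
    · rw [dif_pos h.2.1] at e htree
      refine hcast htree (Describes.test e
        (ih (t + 1) c β qp _ hnext hc hβ hqp (Data.code_lt (Data.div_le hqc) h.2.1))
        (ih (t + 1) c β qp _ hnext hc hβ hqp (Data.code_lt h.2.1 (Data.mod_le _))))
    · have hc' : c + 1 < n := h.2.2.2.2.2.1
      rw [dif_neg h.2.1, dif_pos h.2.2.1] at e htree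
      split_ifs at e htree with hb
      · exact hcast htree (Describes.test e
          (ih (t + 1) (c + 1) c qc _ hnext hc' hc hqc (hk1 h.2.2.1))
          (ih (t + 1) (c + 1) c qc _ hnext hc' hc hqc (hk2 h.2.2.1)))
      · exact hcast htree (Describes.test e
          (ih (t + 1) (c + 1) β qp _ hnext hc' hβ hqp (hk1 h.2.2.1))
          (ih (t + 1) (c + 1) β qp _ hnext hc' hβ hqp (hk2 h.2.2.1)))

theorem describes_optimalTree (hn : 0 < n) :
    Describes G.toFinDist (G.table hn) 0 (G.optimalTree hn) := by
  have h := G.describes_tree hn n 0 0 0 0 0 (zero_add n) hn hn Data.K_pos Data.K_pos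
  rwa [show (G.data n).index 0 0 0 0 0 = 0 by simp [Data.index]] at h

theorem outputsWithin_solve (hn : 0 < n) : OutputsWithin Program.solve (G.encode n)
    ((G.table hn).flatMap Entry.encode)
    ((G.data n).time * (Data.maxLength (G.inputSize n) + 1)) := by
  obtain ⟨t, s, h1, h2, -, h4⟩ := exec_solve (G.fits hn) (G.hasInput n) rfl (G.boundedBy n)
  rw [Nat.size_pow] at h2
  exact ⟨t, s, h1, h2, h4⟩

end RatDist

theorem exists_polynomial_time_le : ∃ q : Polynomial ℕ, ∀ (n : ℕ) (G : RatDist),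
    (G.data n).time * (Data.maxLength (G.inputSize n) + 1) ≤ q.eval (G.inputSize n) := by
  obtain ⟨q, hq⟩ : PolyBounded (fun i : ℕ × RatDist => i.2.inputSize i.1) fun i =>
      (i.2.data i.1).time * (Data.maxLength (i.2.inputSize i.1) + 1) := by
    have hz : PolyBounded (fun i : ℕ × RatDist => i.2.inputSize i.1)
      fun i => i.2.inputSize i.1 := .of_le fun _ => le_rfl
    exact (PolyBounded.dataTime (.of_le fun i => i.2.le_inputSize i.1)
      (.of_le fun i => i.2.m_le_inputSize i.1)).mul
        ((((hz.mul hz).add ((PolyBounded.const 7).mul hz)).add (.const 2)).add (.const 1))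
  exact ⟨q, fun n G => hq (n, G)⟩

end ThresholdTesting

open ThresholdTesting

theorem corollary10 :
    ∃ c : ℕ → ℝ, Tendsto c atTop (𝓝 1) ∧
      -- for every finite discrete distribution there is an optimal sequential algorithm, and
      -- every such algorithm is `(1 - o(1))`-competitive, uniformly in the distribution
      (∀ (n : ℕ), 1 ≤ n → ∀ F : FinDist,
        (∃ A : TestTree n, A.IsOptimal F) ∧
        ∀ A : TestTree n, A.IsOptimal F → A.IsCompetitive (c n) F) ∧
      -- an optimal (hence competitive) sequential algorithm is computed in polynomial time
      (∃ (P : Program) (q : Polynomial ℕ), ∀ (n : ℕ), 1 ≤ n → ∀ G : RatDist,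
        ∃ (D : List (Entry n G.m)) (A : TestTree n),
          OutputsWithin P (G.encode n) (D.flatMap Entry.encode) (q.eval (G.inputSize n)) ∧
          Describes G.toFinDist D 0 A ∧
          A.IsOptimal G.toFinDist ∧
          A.IsCompetitive (c n) G.toFinDist) := by
  refine ⟨competitiveRatio, tendsto_competitiveRatio, fun n hn F =>
    ⟨TestTree.exists_isOptimal hn F, fun A hA => hA.isCompetitive hn⟩, ?_⟩
  obtain ⟨q, hq⟩ := exists_polynomial_time_le
  refine ⟨Program.solve, q, fun n hn G => ⟨G.table hn, G.optimalTree hn, ?_,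
    G.describes_optimalTree hn, G.optimalTree_isOptimal hn,
    (G.optimalTree_isOptimal hn).isCompetitive hn⟩⟩
  obtain ⟨t, s, h1, h2, h3⟩ := G.outputsWithin_solve hn
  exact ⟨t, s, h1, h2.trans (hq n G), h3⟩
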